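/- A dynamic path network consists of vertices $v_1,\dots,v_n$ ($n\ge 1$) arranged from left to right, with positive integral weights $w_i$ (numbers of evacuees), edges $(v_i,v_{i+1})$ with real lengths $l_i\ge 0$ and arbitrary real capacities $c_i>0$, and a transit time $\tau\ge 0$ per unit distance. A sink may be placed at a vertex or at any point of an edge (distances along an edge are prorated). Evacuees move as a continuous fluid: they may wait at vertices, they enter an edge (or the part of an edge leading to a sink on it) at a rate of at most its capacity, and travelling a distance $d$ takes time $d\tau$; a sink has infinite capacity, so the evacuees from its left and from its right do not interfere, and evacuees at the location of the sink are evacuated at time $0$. Sinks $s_1,\dots,s_k$, not necessarily distinct, are feasible for time $t$ if the path can be divided into $k$ consecutive, possibly empty, subpaths such that for each $j$ for which the $j$-th subpath $P[v_a,v_b]$ is non-empty, $s_j$ lies on it and all evacuees of $v_a,\dots,v_b$ can travel along it to $s_j$ within time $t$. An optimal $k$-sink is a choice of $k$ sinks that attains the least such $t$ over all choices of $k$ sinks. Theorem. There are a single real-RAM program (unit cost for array accesses, comparisons, addition, truncated subtraction and halving of natural numbers, and the four field operations on real numbers, without rounding) and a constant $C$ such that for every dynamic path network with $n\ge 1$ vertices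 and every $k\ge 1$, the program, given $n$, $k$, $\tau$, $(w_i)$, $(l_i)$, $(c_i)$, halts after at most $C\,n\log^3(n+1)$ steps and outputs the locations of an optimal $k$-sink. (If $k>n$, it outputs $n$ sinks that attain the least evacuation time possible with $k$ sinks.) Thus an optimal $k$-sink is found in $O(n\log^3 n)$ time, independently of $k$. -/

import Mathlib

/-! ## Dynamic path networks -/

/-- A dynamic path network with vertices `v₀, …, vₙ₋₁` (`n ≥ 1`) arranged from left to right and
edges `eᵢ = (vᵢ, vᵢ₊₁)`, `i < n - 1`. The vertex weights are positive integers, the lengths are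
nonnegative reals, the (arbitrary) capacities are positive reals, and `τ` is the transit time for a
unit distance. -/
structure DynamicPath where
  n : ℕ
  n_pos : 0 < n
  weight : Fin n → ℕ
  weight_pos : ∀ i, 0 < weight i
  length : Fin (n - 1) → ℝ
  length_nonneg : ∀ i, 0 ≤ length i
  capacity : Fin (n - 1) → ℝ
  capacity_pos : ∀ i, 0 < capacity i
  τ : ℝ
  τ_nonneg : 0 ≤ τ

/-- The point of the path which lies on the edge `(v_idx, v_{idx+1})`, at the fraction `frac` of
its length from `v_idx`; `frac = 0` is the vertex `v_idx` itself. -/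
@[ext]
structure PathPoint where
  idx : ℕ
  frac : ℝ

/-- A fluid of evacuees moves along a line of `m` places `0, 1, …, m - 1` into a sink. Place `j`
initially holds the amount `p j`. From place `j` a link leads to place `j + 1`, and from place
`m - 1` a link leads to the sink; fluid may enter link `j` at rate at most `q j`, takes the time
`r j` to traverse it, and may wait at the places. The predicate says that there is a flow for which
everything is in the sink at time `t`.

The flow is given by its cumulative functions: `D j x` is the amount that has entered link `j` up to
time `x`. -/
def LineEvacuation (m : ℕ) (p q r : ℕ → ℝ) (t : ℝ) : Prop :=
  ∃ D : ℕ → ℝ → ℝ,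
    -- nothing moves before time zero, and nothing moves backwards
    (∀ j < m, ∀ x ≤ 0, D j x = 0) ∧
    (∀ j < m, Monotone (D j)) ∧
    -- the rate at which link `j` is entered is at most `q j`
    (∀ j < m, ∀ x y, x ≤ y → D j y - D j x ≤ q j * (y - x)) ∧
    -- what has entered a link was at its tail from the beginning or has arrived there
    (0 < m → ∀ x, D 0 x ≤ p 0) ∧
    (∀ j, j + 1 < m → ∀ x, D (j + 1) x ≤ p (j + 1) + D j (x - r j)) ∧
    -- everything has arrived in the sink at time `t`
    (∀ j, j + 1 = m → D j (t - r j) = ∑ i ∈ Finset.range m, p i)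

namespace DynamicPath

variable (N : DynamicPath)

/-- The weight of `vᵢ`. -/
noncomputable def w (i : ℕ) : ℝ := if h : i < N.n then (N.weight ⟨i, h⟩ : ℝ) else 0

/-- The length of `(vᵢ, vᵢ₊₁)`. -/
noncomputable def l (i : ℕ) : ℝ := if h : i < N.n - 1 then N.length ⟨i, h⟩ else 0

/-- The capacity of `(vᵢ, vᵢ₊₁)`. -/
noncomputable def c (i : ℕ) : ℝ := if h : i < N.n - 1 then N.capacity ⟨i, h⟩ else 0

/-- `s` lies on the subpath `P[v_a, v_b]`, on a vertex or on an edge. -/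
def OnSubpath (a b : ℕ) (s : PathPoint) : Prop :=
  a ≤ s.idx ∧ 0 ≤ s.frac ∧ s.frac < 1 ∧ (s.idx : ℝ) + s.frac ≤ b

/-- `s` lies on the path. -/
def OnPath (s : PathPoint) : Prop := OnSubpath 0 (N.n - 1) s

open Classical in
/-- The evacuees on the vertices `v_a, v_{a+1}, …` to the left of `s` can be evacuated to `s` within
time `t`, along the path from left to right. -/
noncomputable def EvacLeft (a : ℕ) (s : PathPoint) (t : ℝ) : Prop :=
  LineEvacuation (s.idx + (if 0 < s.frac then 1 else 0) - a)
    (fun j => N.w (a + j))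
    (fun j => N.c (a + j))
    (fun j => N.τ * (if a + j = s.idx then s.frac * N.l (a + j) else N.l (a + j))) t

/-- The evacuees on the vertices `v_b, v_{b-1}, …` to the right of `s` can be evacuated to `s`
within time `t`, along the path from right to left. -/
noncomputable def EvacRight (b : ℕ) (s : PathPoint) (t : ℝ) : Prop :=
  LineEvacuation (b - s.idx)
    (fun j => N.w (b - j))
    (fun j => N.c (b - j - 1))
    (fun j => N.τ * (if b - j - 1 = s.idx then (1 - s.frac) * N.l (b - j - 1)
      else N.l (b - j - 1))) t

/-- All evacuees on the subpath `P[v_a, v_b]` can reach the sink `s` on this subpath within time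
`t`. The sink has infinite capacity, so the evacuees from its left and from its right do not
interfere, and those on a vertex where the sink is placed are evacuated at time `0`. -/
def CanEvacuate (a b : ℕ) (s : PathPoint) (t : ℝ) : Prop :=
  OnSubpath a b s ∧ 0 ≤ t ∧ N.EvacLeft a s t ∧ N.EvacRight b s t

/-- With the sinks `s 0, …, s (m-1)` on the path, every evacuee can reach a sink within time `t`:
the path is divided into consecutive (possibly empty) subpaths, the `j`-th one consisting of the
vertices `v_i` with `d j ≤ i < d (j+1)`, and all evacuees on the `j`-th one evacuate to `s j`,
which lies on it. -/
def Feasible {m : ℕ} (s : Fin m → PathPoint) (t : ℝ) : Prop :=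
  (∀ j, N.OnPath (s j)) ∧
  ∃ d : Fin (m + 1) → ℕ, Monotone d ∧ d 0 = 0 ∧ d (Fin.last m) = N.n ∧
    ∀ j : Fin m, d j.castSucc < d j.succ → N.CanEvacuate (d j.castSucc) (d j.succ - 1) (s j) t

/-- The sinks `s` achieve the least evacuation time that is possible with `k` sinks. -/
def OptimalSinks (k : ℕ) {m : ℕ} (s : Fin m → PathPoint) : Prop :=
  ∃ t, N.Feasible s t ∧ ∀ (s' : Fin k → PathPoint) (t' : ℝ), N.Feasible s' t' → t ≤ t'

end DynamicPath

/-! ## Real RAM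

A real RAM with registers and arrays for natural numbers (used as counters and indices) and
registers and arrays for real numbers. A program names finitely many registers and arrays. The
operations are addition, truncated subtraction and halving of natural numbers, the four field
operations on real numbers, comparisons, and array accesses at computed indices; each costs one
step. There is no conversion between the two sorts and no rounding, and the only constants are
natural numbers. -/

namespace RealRAM

/-- The memory: registers and arrays, named by natural numbers. -/
structure Mem where
  nreg : ℕ → ℕ
  rreg : ℕ → ℝ
  narr : ℕ → ℕ → ℕ
  rarr : ℕ → ℕ → ℝ

/-- Expressions for natural numbers. -/
inductive NExp where
  | const (v : ℕ)
  | reg (x : ℕ)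
  | arr (A : ℕ) (i : NExp)
  | add (e f : NExp)
  | sub (e f : NExp)
  | half (e : NExp)

/-- Expressions for real numbers. -/
inductive RExp where
  | const (v : ℕ)
  | reg (x : ℕ)
  | arr (A : ℕ) (i : NExp)
  | add (e f : RExp)
  | sub (e f : RExp)
  | mul (e f : RExp)
  | div (e f : RExp)

/-- Tests. -/
inductive BExp where
  | nle (e f : NExp)
  | rle (e f : RExp)
  | not (b : BExp)
  | and (b b' : BExp)

/-- Programs. -/
inductive Cmd where
  | skip
  | nset (x : ℕ) (e : NExp)
  | rset (x : ℕ) (e : RExp)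
  | nstore (A : ℕ) (i e : NExp)
  | rstore (A : ℕ) (i : NExp) (e : RExp)
  | seq (p q : Cmd)
  | ite (b : BExp) (p q : Cmd)
  | loop (b : BExp) (p : Cmd)

def NExp.eval (σ : Mem) : NExp → ℕ
  | .const v => v
  | .reg x => σ.nreg x
  | .arr A i => σ.narr A (i.eval σ)
  | .add e f => e.eval σ + f.eval σ
  | .sub e f => e.eval σ - f.eval σ
  | .half e => e.eval σ / 2

noncomputable def RExp.eval (σ : Mem) : RExp → ℝ
  | .const v => v
  | .reg x => σ.rreg x
  | .arr A i => σ.rarr A (i.eval σ)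
  | .add e f => e.eval σ + f.eval σ
  | .sub e f => e.eval σ - f.eval σ
  | .mul e f => e.eval σ * f.eval σ
  | .div e f => e.eval σ / f.eval σ

def BExp.eval (σ : Mem) : BExp → Prop
  | .nle e f => e.eval σ ≤ f.eval σ
  | .rle e f => e.eval σ ≤ f.eval σ
  | .not b => ¬ b.eval σ
  | .and b b' => b.eval σ ∧ b'.eval σ

/-- The number of steps for evaluating an expression: one for each operation, memory access and
constant. -/
def NExp.cost : NExp → ℕ
  | .const _ => 1
  | .reg _ => 1
  | .arr _ i => i.cost + 1
  | .add e f => e.cost + f.cost + 1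
  | .sub e f => e.cost + f.cost + 1
  | .half e => e.cost + 1

def RExp.cost : RExp → ℕ
  | .const _ => 1
  | .reg _ => 1
  | .arr _ i => i.cost + 1
  | .add e f => e.cost + f.cost + 1
  | .sub e f => e.cost + f.cost + 1
  | .mul e f => e.cost + f.cost + 1
  | .div e f => e.cost + f.cost + 1

def BExp.cost : BExp → ℕ
  | .nle e f => e.cost + f.cost + 1
  | .rle e f => e.cost + f.cost + 1
  | .not b => b.cost + 1
  | .and b b' => b.cost + b'.cost + 1

/-- `Run p σ T σ'`: the program `p`, started in the memory `σ`, halts after exactly `T` steps, with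
the memory `σ'`. -/
inductive Run : Cmd → Mem → ℕ → Mem → Prop where
  | skip (σ : Mem) : Run .skip σ 1 σ
  | nset (x : ℕ) (e : NExp) (σ : Mem) :
      Run (.nset x e) σ (e.cost + 1) { σ with nreg := Function.update σ.nreg x (e.eval σ) }
  | rset (x : ℕ) (e : RExp) (σ : Mem) :
      Run (.rset x e) σ (e.cost + 1) { σ with rreg := Function.update σ.rreg x (e.eval σ) }
  | nstore (A : ℕ) (i e : NExp) (σ : Mem) :
      Run (.nstore A i e) σ (i.cost + e.cost + 1)
        { σ with
          narr := Function.update σ.narr A (Function.update (σ.narr A) (i.eval σ) (e.eval σ)) }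
  | rstore (A : ℕ) (i : NExp) (e : RExp) (σ : Mem) :
      Run (.rstore A i e) σ (i.cost + e.cost + 1)
        { σ with
          rarr := Function.update σ.rarr A (Function.update (σ.rarr A) (i.eval σ) (e.eval σ)) }
  | seq {p q : Cmd} {σ σ' σ'' : Mem} {T T' : ℕ} :
      Run p σ T σ' → Run q σ' T' σ'' → Run (.seq p q) σ (T + T') σ''
  | ite_true {b : BExp} {p q : Cmd} {σ σ' : Mem} {T : ℕ} :
      b.eval σ → Run p σ T σ' → Run (.ite b p q) σ (b.cost + 1 + T) σ'
  | ite_false {b : BExp} {p q : Cmd} {σ σ' : Mem} {T : ℕ} :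
      ¬ b.eval σ → Run q σ T σ' → Run (.ite b p q) σ (b.cost + 1 + T) σ'
  | loop_true {b : BExp} {p : Cmd} {σ σ' σ'' : Mem} {T T' : ℕ} :
      b.eval σ → Run p σ T σ' → Run (.loop b p) σ' T' σ'' →
        Run (.loop b p) σ (b.cost + 1 + T + T') σ''
  | loop_false {b : BExp} {p : Cmd} {σ : Mem} :
      ¬ b.eval σ → Run (.loop b p) σ (b.cost + 1) σ

/-- The initial memory for the network `N` and the number `k` of sinks: the natural-number registers
`0` and `1` contain `n` and `k`, the real register `0` contains `τ`, and the real arrays `0`, `1`,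
`2` contain the weights, the lengths and the capacities. Everything else is zero. -/
noncomputable def input (N : DynamicPath) (k : ℕ) : Mem where
  nreg x := if x = 0 then N.n else if x = 1 then k else 0
  rreg x := if x = 0 then N.τ else 0
  narr _ _ := 0
  rarr A i := if A = 0 then N.w i else if A = 1 then N.l i else if A = 2 then N.c i else 0

/-- The first `m` sinks that are written in the memory: the `j`-th entries of the natural-number
array `0` and of the real array `3` are the index and the fraction of the `j`-th sink. -/
def output (σ : Mem) (m : ℕ) (j : Fin m) : PathPoint := ⟨σ.narr 0 j, σ.rarr 3 j⟩

end RealRAM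

/-! The least time is found by a search among critical times that are never listed explicitly.

A line empties within time `t` iff for every link `j` and every place `i ≤ j` the fluid from the
places up to `i` fits through `j` at full rate in the time `t` minus the travel time from `i` to the
sink (`lineEvacuation_iff`). Hence the vertices from `a` on need the time `Profile.cost a x` to
reach `x`, the maximum of `D x - D i + (W (i + 1) - W a) * γ j` over `a ≤ i ≤ j < x`. Appending the
mirror image to the path turns evacuation from the right into the same function.

Let `x` be the last vertex that the evacuees from `a` on can reach within `t`. The block from `a` to
`b` can be evacuated iff `edgeCost a x b ≤ t` (`blockOK_iff`). This value increases with `b`, so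
longest blocks, chosen greedily, decide feasibility (`greedy_step`) with `O(n)` evaluations of
`cost`.

One evaluation takes `O(log² n)` steps. For `i` in a dyadic block of links, the best `j` inside the
block gives a line in `-W a`, and the best `j` to the right of it gives a line in the largest
inverse capacity there (`Profile.Partial.step`). The slopes arise in sorted order, so the upper
envelopes of all blocks are built in `O(n log n)` steps; each is queried by binary search, and an
interval consists of `O(log n)` blocks. A feasibility test thus costs `O(n log² n)` steps.

The critical times form rows that increase: first `cost a c`, then `edgeCost a (X a) b`, where the
first search has fixed the last reachable vertices `X a`. Each round tests a weighted median of the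
middle entries of the rows and so discards a quarter of the remaining entries
(`remaining_decrease`). After `O(log n)` rounds there are an infeasible `lo` and a feasible `hi`
with no critical time strictly between them, and `hi` is optimal (`not_feasK_of_resolved`). A round
consists of a sort, a test and at most `n` evaluations of entries, so the total is `O(n log³ n)`.

Running times are verified together with correctness, by preconditions that count time credits. -/

namespace RealRAM

/-! ## Commands with time credits -/

instance : Add NExp := ⟨.add⟩
instance : Sub NExp := ⟨.sub⟩
instance (v : ℕ) : OfNat NExp v := ⟨.const v⟩
instance : Add RExp := ⟨.add⟩
instance : Sub RExp := ⟨.sub⟩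
instance : Mul RExp := ⟨.mul⟩
instance : Div RExp := ⟨.div⟩
instance (v : ℕ) : OfNat RExp v := ⟨.const v⟩

/-- The test `e < f` on natural numbers. -/
def BExp.nlt (e f : NExp) : BExp := .nle (e + 1) f

/-- The test `e < f` on real numbers. -/
def BExp.rlt (e f : RExp) : BExp := .not (.rle f e)

infixr:60 " ;; " => Cmd.seq

section Simp

variable (σ : Mem)

@[simp] theorem NExp.eval_const (v : ℕ) : (NExp.const v).eval σ = v := rfl
@[simp] theorem NExp.eval_zero : (0 : NExp).eval σ = 0 := rfl
@[simp] theorem NExp.eval_one : (1 : NExp).eval σ = 1 := rfl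
@[simp] theorem NExp.eval_two : (2 : NExp).eval σ = 2 := rfl
@[simp] theorem NExp.eval_reg (x : ℕ) : (NExp.reg x).eval σ = σ.nreg x := rfl
@[simp] theorem NExp.eval_arr (A : ℕ) (i : NExp) :
    (NExp.arr A i).eval σ = σ.narr A (i.eval σ) := rfl
@[simp] theorem NExp.eval_add (e f : NExp) : (e + f).eval σ = e.eval σ + f.eval σ := rfl
@[simp] theorem NExp.eval_sub (e f : NExp) : (e - f).eval σ = e.eval σ - f.eval σ := rfl
@[simp] theorem NExp.eval_half (e : NExp) : (NExp.half e).eval σ = e.eval σ / 2 := rfl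

@[simp] theorem RExp.eval_const (v : ℕ) : (RExp.const v).eval σ = v := rfl
@[simp] theorem RExp.eval_zero : (0 : RExp).eval σ = 0 := Nat.cast_zero
@[simp] theorem RExp.eval_one : (1 : RExp).eval σ = 1 := Nat.cast_one
@[simp] theorem RExp.eval_two : (2 : RExp).eval σ = 2 := Nat.cast_ofNat
@[simp] theorem RExp.eval_reg (x : ℕ) : (RExp.reg x).eval σ = σ.rreg x := rfl
@[simp] theorem RExp.eval_arr (A : ℕ) (i : NExp) :
    (RExp.arr A i).eval σ = σ.rarr A (i.eval σ) := rfl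
@[simp] theorem RExp.eval_add (e f : RExp) : (e + f).eval σ = e.eval σ + f.eval σ := rfl
@[simp] theorem RExp.eval_sub (e f : RExp) : (e - f).eval σ = e.eval σ - f.eval σ := rfl
@[simp] theorem RExp.eval_mul (e f : RExp) : (e * f).eval σ = e.eval σ * f.eval σ := rfl
@[simp] theorem RExp.eval_div (e f : RExp) : (e / f).eval σ = e.eval σ / f.eval σ := rfl

@[simp] theorem BExp.eval_nle (e f : NExp) :
    (BExp.nle e f).eval σ ↔ e.eval σ ≤ f.eval σ := Iff.rfl
@[simp] theorem BExp.eval_rle (e f : RExp) :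
    (BExp.rle e f).eval σ ↔ e.eval σ ≤ f.eval σ := Iff.rfl
@[simp] theorem BExp.eval_not (b : BExp) : (BExp.not b).eval σ ↔ ¬ b.eval σ := Iff.rfl
@[simp] theorem BExp.eval_and (b b' : BExp) :
    (BExp.and b b').eval σ ↔ b.eval σ ∧ b'.eval σ := Iff.rfl
@[simp] theorem BExp.eval_nlt (e f : NExp) :
    (BExp.nlt e f).eval σ ↔ e.eval σ < f.eval σ := Iff.rfl
@[simp] theorem BExp.eval_rlt (e f : RExp) :
    (BExp.rlt e f).eval σ ↔ e.eval σ < f.eval σ := not_le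

end Simp

@[simp] theorem NExp.cost_const (v : ℕ) : (NExp.const v).cost = 1 := rfl
@[simp] theorem NExp.cost_zero : (0 : NExp).cost = 1 := rfl
@[simp] theorem NExp.cost_one : (1 : NExp).cost = 1 := rfl
@[simp] theorem NExp.cost_two : (2 : NExp).cost = 1 := rfl
@[simp] theorem NExp.cost_reg (x : ℕ) : (NExp.reg x).cost = 1 := rfl
@[simp] theorem NExp.cost_arr (A : ℕ) (i : NExp) : (NExp.arr A i).cost = i.cost + 1 := rfl
@[simp] theorem NExp.cost_add (e f : NExp) : (e + f).cost = e.cost + f.cost + 1 := rfl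
@[simp] theorem NExp.cost_sub (e f : NExp) : (e - f).cost = e.cost + f.cost + 1 := rfl
@[simp] theorem NExp.cost_half (e : NExp) : (NExp.half e).cost = e.cost + 1 := rfl
@[simp] theorem RExp.cost_const (v : ℕ) : (RExp.const v).cost = 1 := rfl
@[simp] theorem RExp.cost_zero : (0 : RExp).cost = 1 := rfl
@[simp] theorem RExp.cost_one : (1 : RExp).cost = 1 := rfl
@[simp] theorem RExp.cost_two : (2 : RExp).cost = 1 := rfl
@[simp] theorem RExp.cost_reg (x : ℕ) : (RExp.reg x).cost = 1 := rfl
@[simp] theorem RExp.cost_arr (A : ℕ) (i : NExp) : (RExp.arr A i).cost = i.cost + 1 := rfl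
@[simp] theorem RExp.cost_add (e f : RExp) : (e + f).cost = e.cost + f.cost + 1 := rfl
@[simp] theorem RExp.cost_sub (e f : RExp) : (e - f).cost = e.cost + f.cost + 1 := rfl
@[simp] theorem RExp.cost_mul (e f : RExp) : (e * f).cost = e.cost + f.cost + 1 := rfl
@[simp] theorem RExp.cost_div (e f : RExp) : (e / f).cost = e.cost + f.cost + 1 := rfl
@[simp] theorem BExp.cost_nle (e f : NExp) : (BExp.nle e f).cost = e.cost + f.cost + 1 := rfl
@[simp] theorem BExp.cost_rle (e f : RExp) : (BExp.rle e f).cost = e.cost + f.cost + 1 := rfl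
@[simp] theorem BExp.cost_not (b : BExp) : (BExp.not b).cost = b.cost + 1 := rfl
@[simp] theorem BExp.cost_and (b b' : BExp) : (BExp.and b b').cost = b.cost + b'.cost + 1 := rfl
@[simp] theorem BExp.cost_nlt (e f : NExp) : (BExp.nlt e f).cost = e.cost + f.cost + 3 := by
  change e.cost + 1 + 1 + f.cost + 1 = _
  omega
@[simp] theorem BExp.cost_rlt (e f : RExp) : (BExp.rlt e f).cost = e.cost + f.cost + 2 := by
  change f.cost + e.cost + 1 + 1 = _
  omega

/-! ### Memory updates -/

namespace Mem

variable (σ : Mem)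

/-- Set a natural-number register. -/
def setN (x v : ℕ) : Mem := { σ with nreg := Function.update σ.nreg x v }

/-- Set a real register. -/
def setR (x : ℕ) (v : ℝ) : Mem := { σ with rreg := Function.update σ.rreg x v }

/-- Store into a natural-number array. -/
def stN (A i v : ℕ) : Mem :=
  { σ with narr := Function.update σ.narr A (Function.update (σ.narr A) i v) }

/-- Store into a real array. -/
def stR (A i : ℕ) (v : ℝ) : Mem :=
  { σ with rarr := Function.update σ.rarr A (Function.update (σ.rarr A) i v) }

@[simp] theorem setN_nreg (x v y : ℕ) :
    (σ.setN x v).nreg y = if y = x then v else σ.nreg y := Function.update_apply _ _ _ _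
@[simp] theorem setN_rreg (x v : ℕ) : (σ.setN x v).rreg = σ.rreg := rfl
@[simp] theorem setN_narr (x v : ℕ) : (σ.setN x v).narr = σ.narr := rfl
@[simp] theorem setN_rarr (x v : ℕ) : (σ.setN x v).rarr = σ.rarr := rfl
@[simp] theorem setR_nreg (x : ℕ) (v : ℝ) : (σ.setR x v).nreg = σ.nreg := rfl
@[simp] theorem setR_rreg (x : ℕ) (v : ℝ) (y : ℕ) :
    (σ.setR x v).rreg y = if y = x then v else σ.rreg y := Function.update_apply _ _ _ _
@[simp] theorem setR_narr (x : ℕ) (v : ℝ) : (σ.setR x v).narr = σ.narr := rfl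
@[simp] theorem setR_rarr (x : ℕ) (v : ℝ) : (σ.setR x v).rarr = σ.rarr := rfl
@[simp] theorem stN_nreg (A i v : ℕ) : (σ.stN A i v).nreg = σ.nreg := rfl
@[simp] theorem stN_rreg (A i v : ℕ) : (σ.stN A i v).rreg = σ.rreg := rfl
@[simp] theorem stN_narr (A i v B : ℕ) : (σ.stN A i v).narr B =
    if B = A then Function.update (σ.narr A) i v else σ.narr B := Function.update_apply _ _ _ _
@[simp] theorem stN_rarr (A i v : ℕ) : (σ.stN A i v).rarr = σ.rarr := rfl
@[simp] theorem stR_nreg (A i : ℕ) (v : ℝ) : (σ.stR A i v).nreg = σ.nreg := rfl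
@[simp] theorem stR_rreg (A i : ℕ) (v : ℝ) : (σ.stR A i v).rreg = σ.rreg := rfl
@[simp] theorem stR_narr (A i : ℕ) (v : ℝ) : (σ.stR A i v).narr = σ.narr := rfl
@[simp] theorem stR_rarr (A i : ℕ) (v : ℝ) (B : ℕ) : (σ.stR A i v).rarr B =
    if B = A then Function.update (σ.rarr A) i v else σ.rarr B := Function.update_apply _ _ _ _

end Mem

/-! ### Weakest preconditions -/

/-- Started in `σ` with `T` time credits, the program `c` halts without exhausting them, and the
final memory and the remaining credits satisfy `Q`. -/
def WP (c : Cmd) (σ : Mem) (T : ℕ) (Q : Mem → ℕ → Prop) : Prop :=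
  ∃ T' σ', Run c σ T' σ' ∧ T' ≤ T ∧ Q σ' (T - T')

/-- Started in `σ`, the program `c` halts within `B` steps in a memory that satisfies `Q`. -/
def Halts (c : Cmd) (σ : Mem) (B : ℕ) (Q : Mem → Prop) : Prop :=
  WP c σ B fun σ' _ => Q σ'

section WP

variable {c p q : Cmd} {σ : Mem} {T : ℕ} {Q : Mem → ℕ → Prop}

@[simp] theorem wp_skip : WP .skip σ T Q ↔ 1 ≤ T ∧ Q σ (T - 1) := by
  constructor
  · rintro ⟨_, _, h, h1, h2⟩; cases h; exact ⟨h1, h2⟩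
  · rintro ⟨h1, h2⟩; exact ⟨_, _, .skip σ, h1, h2⟩

@[simp] theorem wp_nset {x : ℕ} {e : NExp} : WP (.nset x e) σ T Q ↔
    e.cost + 1 ≤ T ∧ Q (σ.setN x (e.eval σ)) (T - (e.cost + 1)) := by
  constructor
  · rintro ⟨_, _, h, h1, h2⟩; cases h; exact ⟨h1, h2⟩
  · rintro ⟨h1, h2⟩; exact ⟨_, _, .nset x e σ, h1, h2⟩

@[simp] theorem wp_rset {x : ℕ} {e : RExp} : WP (.rset x e) σ T Q ↔
    e.cost + 1 ≤ T ∧ Q (σ.setR x (e.eval σ)) (T - (e.cost + 1)) := by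
  constructor
  · rintro ⟨_, _, h, h1, h2⟩; cases h; exact ⟨h1, h2⟩
  · rintro ⟨h1, h2⟩; exact ⟨_, _, .rset x e σ, h1, h2⟩

@[simp] theorem wp_nstore {A : ℕ} {i e : NExp} : WP (.nstore A i e) σ T Q ↔
    i.cost + e.cost + 1 ≤ T ∧
      Q (σ.stN A (i.eval σ) (e.eval σ)) (T - (i.cost + e.cost + 1)) := by
  constructor
  · rintro ⟨_, _, h, h1, h2⟩; cases h; exact ⟨h1, h2⟩
  · rintro ⟨h1, h2⟩; exact ⟨_, _, .nstore A i e σ, h1, h2⟩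

@[simp] theorem wp_rstore {A : ℕ} {i : NExp} {e : RExp} : WP (.rstore A i e) σ T Q ↔
    i.cost + e.cost + 1 ≤ T ∧
      Q (σ.stR A (i.eval σ) (e.eval σ)) (T - (i.cost + e.cost + 1)) := by
  constructor
  · rintro ⟨_, _, h, h1, h2⟩; cases h; exact ⟨h1, h2⟩
  · rintro ⟨h1, h2⟩; exact ⟨_, _, .rstore A i e σ, h1, h2⟩

@[simp] theorem wp_seq : WP (p ;; q) σ T Q ↔ WP p σ T fun σ' T' => WP q σ' T' Q := by
  constructor
  · rintro ⟨_, _, h, h1, h2⟩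
    cases h with
    | seq r r' =>
      rename_i T1 T2
      refine ⟨_, _, r, by omega, _, _, r', by omega, ?_⟩
      rwa [Nat.sub_sub]
  · rintro ⟨T1, _, r, h1, T2, _, r', h2, h⟩
    refine ⟨_, _, .seq r r', by omega, ?_⟩
    rwa [← Nat.sub_sub]

@[simp] theorem wp_ite {b : BExp} : WP (.ite b p q) σ T Q ↔ b.cost + 1 ≤ T ∧
    (b.eval σ → WP p σ (T - (b.cost + 1)) Q) ∧ (¬ b.eval σ → WP q σ (T - (b.cost + 1)) Q) := by
  constructor
  · rintro ⟨_, _, h, h1, h2⟩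
    cases h with
    | ite_true hb r =>
      refine ⟨by omega, fun _ => ⟨_, _, r, by omega, ?_⟩, fun h => absurd hb h⟩
      rwa [Nat.sub_sub]
    | ite_false hb r =>
      refine ⟨by omega, fun h => absurd h hb, fun _ => ⟨_, _, r, by omega, ?_⟩⟩
      rwa [Nat.sub_sub]
  · rintro ⟨h, h1, h2⟩
    by_cases hb : b.eval σ
    · obtain ⟨T', σ', r, h3, h4⟩ := h1 hb
      refine ⟨_, _, .ite_true hb r, by omega, ?_⟩
      rwa [← Nat.sub_sub]
    · obtain ⟨T', σ', r, h3, h4⟩ := h2 hb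
      refine ⟨_, _, .ite_false hb r, by omega, ?_⟩
      rwa [← Nat.sub_sub]

/-- The loop rule: the invariant speaks about the remaining credits, so it also yields
termination. -/
theorem WP.loop {b : BExp} (I : Mem → ℕ → Prop) (hI : I σ T)
    (h : ∀ σ T, I σ T → b.cost + 1 ≤ T ∧ (b.eval σ → WP p σ (T - (b.cost + 1)) I) ∧
      (¬ b.eval σ → Q σ (T - (b.cost + 1)))) :
    WP (.loop b p) σ T Q := by
  -- Each iteration pays for its test, so the credits strictly decrease and serve as the termination
  -- measure.
  induction T using Nat.strong_induction_on generalizing σ with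
  | _ T ih =>
    obtain ⟨h0, h1, h2⟩ := h σ T hI
    by_cases hb : b.eval σ
    · obtain ⟨T', σ', r, h3, h4⟩ := h1 hb
      obtain ⟨T'', σ'', r', h5, h6⟩ := ih _ (by omega) h4
      refine ⟨_, _, .loop_true hb r r', by omega, ?_⟩
      rwa [← Nat.sub_sub, ← Nat.sub_sub]
    · exact ⟨_, _, .loop_false hb, h0, h2 hb⟩

end WP

/-- Replace the real register `x` by its maximum with `e`. -/
def maxInto (x : ℕ) (e : RExp) : Cmd := .ite (.rlt (.reg x) e) (.rset x e) .skip

/-- The branches differ in cost, so the postcondition is asked for every remainder that the worst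
case allows. When nothing is stored, the maximum is the old value and the update is the identity. -/
theorem WP.maxInto {x : ℕ} {e : RExp} {σ : Mem} {T : ℕ} {Q : Mem → ℕ → Prop}
    (hT : 2 * e.cost + 10 ≤ T) (hQ : ∀ T', T ≤ T' + (2 * e.cost + 10) →
      Q (σ.setR x (max (σ.rreg x) (e.eval σ))) T') : WP (maxInto x e) σ T Q := by
  simp only [RealRAM.maxInto, wp_ite, wp_rset, wp_skip, BExp.cost_rlt, RExp.cost_reg,
    BExp.eval_rlt, RExp.eval_reg]
  refine ⟨by omega, fun h => ⟨by omega, ?_⟩, fun h => ⟨by omega, ?_⟩⟩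
  · have := hQ (T - (1 + e.cost + 2 + 1) - (e.cost + 1)) (by omega)
    rwa [max_eq_right h.le] at this
  · have := hQ (T - (1 + e.cost + 2 + 1) - 1) (by omega)
    rwa [max_eq_left (not_lt.1 h), Mem.setR, Function.update_eq_self] at this

/-! ### Frames -/

/-- Whether the program may write the natural-number register `x`. -/
def Cmd.wN (x : ℕ) : Cmd → Bool
  | .nset y _ => x == y
  | .seq p q => p.wN x || q.wN x
  | .ite _ p q => p.wN x || q.wN x
  | .loop _ p => p.wN x
  | _ => false

/-- Whether the program may write the real register `x`. -/
def Cmd.wR (x : ℕ) : Cmd → Bool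
  | .rset y _ => x == y
  | .seq p q => p.wR x || q.wR x
  | .ite _ p q => p.wR x || q.wR x
  | .loop _ p => p.wR x
  | _ => false

/-- Whether the program may write the natural-number array `A`. -/
def Cmd.wNA (A : ℕ) : Cmd → Bool
  | .nstore B _ _ => A == B
  | .seq p q => p.wNA A || q.wNA A
  | .ite _ p q => p.wNA A || q.wNA A
  | .loop _ p => p.wNA A
  | _ => false

/-- Whether the program may write the real array `A`. -/
def Cmd.wRA (A : ℕ) : Cmd → Bool
  | .rstore B _ _ => A == B
  | .seq p q => p.wRA A || q.wRA A
  | .ite _ p q => p.wRA A || q.wRA A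
  | .loop _ p => p.wRA A
  | _ => false

/-- `σ` and `σ'` agree on everything that `c` does not write. -/
structure Same (c : Cmd) (σ σ' : Mem) : Prop where
  n : ∀ x, c.wN x = false → σ'.nreg x = σ.nreg x
  r : ∀ x, c.wR x = false → σ'.rreg x = σ.rreg x
  na : ∀ A, c.wNA A = false → σ'.narr A = σ.narr A
  ra : ∀ A, c.wRA A = false → σ'.rarr A = σ.rarr A

/-- The sets of written locations are computed from the program text. For a concrete program a frame
condition such as `c.wN x = false` is therefore closed by `rfl`. -/
theorem Run.same {c : Cmd} {σ σ' : Mem} {T : ℕ} (h : Run c σ T σ') : Same c σ σ' := by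
  induction h with
  | skip => exact ⟨fun _ _ => rfl, fun _ _ => rfl, fun _ _ => rfl, fun _ _ => rfl⟩
  | nset y e σ =>
    refine ⟨fun x hx => ?_, fun _ _ => rfl, fun _ _ => rfl, fun _ _ => rfl⟩
    exact Function.update_of_ne (by simpa [Cmd.wN] using hx) _ _
  | rset y e σ =>
    refine ⟨fun _ _ => rfl, fun x hx => ?_, fun _ _ => rfl, fun _ _ => rfl⟩
    exact Function.update_of_ne (by simpa [Cmd.wR] using hx) _ _
  | nstore y e σ =>
    refine ⟨fun _ _ => rfl, fun _ _ => rfl, fun x hx => ?_, fun _ _ => rfl⟩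
    exact Function.update_of_ne (by simpa [Cmd.wNA] using hx) _ _
  | rstore y e σ =>
    refine ⟨fun _ _ => rfl, fun _ _ => rfl, fun _ _ => rfl, fun x hx => ?_⟩
    exact Function.update_of_ne (by simpa [Cmd.wRA] using hx) _ _
  | seq _ _ ih1 ih2 =>
    refine ⟨fun x hx => ?_, fun x hx => ?_, fun x hx => ?_, fun x hx => ?_⟩ <;>
      simp only [Cmd.wN, Cmd.wR, Cmd.wNA, Cmd.wRA, Bool.or_eq_false_iff] at hx
    · rw [ih2.n x hx.2, ih1.n x hx.1]
    · rw [ih2.r x hx.2, ih1.r x hx.1]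
    · rw [ih2.na x hx.2, ih1.na x hx.1]
    · rw [ih2.ra x hx.2, ih1.ra x hx.1]
  | ite_true _ _ ih =>
    refine ⟨fun x hx => ?_, fun x hx => ?_, fun x hx => ?_, fun x hx => ?_⟩ <;>
      simp only [Cmd.wN, Cmd.wR, Cmd.wNA, Cmd.wRA, Bool.or_eq_false_iff] at hx
    exacts [ih.n x hx.1, ih.r x hx.1, ih.na x hx.1, ih.ra x hx.1]
  | ite_false _ _ ih =>
    refine ⟨fun x hx => ?_, fun x hx => ?_, fun x hx => ?_, fun x hx => ?_⟩ <;>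
      simp only [Cmd.wN, Cmd.wR, Cmd.wNA, Cmd.wRA, Bool.or_eq_false_iff] at hx
    exacts [ih.n x hx.2, ih.r x hx.2, ih.na x hx.2, ih.ra x hx.2]
  | loop_true _ _ _ ih1 ih2 =>
    refine ⟨fun x hx => ?_, fun x hx => ?_, fun x hx => ?_, fun x hx => ?_⟩
    · rw [ih2.n x hx, ih1.n x hx]
    · rw [ih2.r x hx, ih1.r x hx]
    · rw [ih2.na x hx, ih1.na x hx]
    · rw [ih2.ra x hx, ih1.ra x hx]
  | loop_false => exact ⟨fun _ _ => rfl, fun _ _ => rfl, fun _ _ => rfl, fun _ _ => rfl⟩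

/-- The rule for a subprogram with a known specification. -/
theorem Halts.wp {c : Cmd} {σ : Mem} {T B : ℕ} {P : Mem → Prop} {Q : Mem → ℕ → Prop}
    (h : Halts c σ B P) (hB : B ≤ T)
    (hQ : ∀ σ' T', Same c σ σ' → P σ' → T ≤ T' + B → Q σ' T') : WP c σ T Q := by
  obtain ⟨T', σ', r, h1, h2⟩ := h
  exact ⟨T', σ', r, by omega, hQ _ _ r.same h2 (by omega)⟩

end RealRAM

/-! ### Fluid evacuation along a line -/

open Finset in
/-- A line can be evacuated within time `t` iff for every link `j` and every place `i` before it,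
the fluid from the places up to `i` can pass the link in the time that remains for it. -/
theorem lineEvacuation_iff {m : ℕ} {p q r : ℕ → ℝ} {t : ℝ} (hp : ∀ j < m, 0 < p j)
    (hq : ∀ j < m, 0 < q j) (hr : ∀ j < m, 0 ≤ r j) :
    LineEvacuation m p q r t ↔ ∀ i j, i ≤ j → j < m →
      ∑ k ∈ range (i + 1), p k ≤ q j * (t - ∑ k ∈ Ico i m, r k) := by
  constructor
  · rintro ⟨D, hD0, hDm, hDq, -, hDr, hDe⟩
    -- Conservation unrolled from link `i + d` back to link `i`: what has entered the later link was
    -- initially between the two, or entered link `i` earlier by the travel time.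
    have key : ∀ i d, i + d < m → ∀ x, D (i + d) x ≤
        ∑ k ∈ range (i + d + 1), p k - ∑ k ∈ range (i + 1), p k +
          D i (x - ∑ k ∈ Ico i (i + d), r k) := by
      intro i d
      induction d with
      | zero => intro _ x; simp
      | succ d ih =>
        intro hd x
        have h1 := hDr (i + d) (by omega) x
        have h2 := ih (by omega) (x - r (i + d))
        rw [← add_assoc, sum_range_succ _ (i + d + 1), sum_Ico_succ_top (by omega)]
        rw [sub_sub, add_comm (r _)] at h2
        linarith
    intro i j hij hjm
    have hP : 0 < ∑ k ∈ range (i + 1), p k :=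
      sum_pos (fun k hk => hp k (by rw [mem_range] at hk; omega)) (by simp)
    -- At the last useful moment for link `j`, all fluid from the places up to `j` has entered it.
    have h1 : ∑ k ∈ range (j + 1), p k ≤ D j (t - ∑ k ∈ Ico j m, r k) := by
      obtain ⟨d, rfl⟩ : ∃ d, m = j + d + 1 := ⟨m - j - 1, by omega⟩
      have h2 := key j d (by omega) (t - r (j + d))
      rw [hDe (j + d) rfl, sub_sub, add_comm (r _), ← sum_Ico_succ_top (by omega)] at h2
      linarith
    -- Nothing that passes link `i` can have entered link `j` before this moment, since `D i`
    -- vanishes at time zero.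
    have h2 : D j (∑ k ∈ Ico i j, r k) ≤
        ∑ k ∈ range (j + 1), p k - ∑ k ∈ range (i + 1), p k := by
      obtain ⟨d, rfl⟩ := Nat.exists_eq_add_of_le hij
      have h3 := key i d hjm (∑ k ∈ Ico i (i + d), r k)
      rw [sub_self, hD0 i (by omega) 0 le_rfl] at h3
      linarith
    have h3 : ∑ k ∈ Ico i m, r k = ∑ k ∈ Ico i j, r k + ∑ k ∈ Ico j m, r k :=
      (sum_Ico_consecutive _ hij hjm.le).symm
    -- Between the two moments the fluid of the places up to `i` must enter link `j`. If they are in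
    -- the wrong order, monotonicity of `D j` contradicts the positivity of that amount.
    rcases le_or_gt (∑ k ∈ Ico i j, r k) (t - ∑ k ∈ Ico j m, r k) with h | h
    · have h4 := hDq j hjm _ _ h
      rw [h3, add_comm (∑ k ∈ Ico i j, r k), ← sub_sub]
      linarith
    · have h4 := hDm j hjm h.le
      linarith
  · intro H
    -- `g j` is the bottleneck among the links from `j` on.
    have hmin : ∀ j, ∃ i, j < m → i ∈ Ico j m ∧ ∀ i' ∈ Ico j m, q i ≤ q i' := by
      intro j
      by_cases hj : j < m
      · obtain ⟨i, hi, h⟩ := exists_min_image (Ico j m) q ⟨j, by simp [hj]⟩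
        exact ⟨i, fun _ => ⟨hi, h⟩⟩
      · exact ⟨0, fun h => absurd h hj⟩
    choose g hg using hmin
    have hg0 : ∀ j < m, 0 < q (g j) := fun j hj => hq _ (mem_Ico.1 (hg j hj).1).2
    have hgq : ∀ j < m, q (g j) ≤ q j := fun j hj => (hg j hj).2 j (by simp [hj])
    have hP : ∀ j < m, 0 ≤ ∑ k ∈ range (j + 1), p k := fun j hj =>
      sum_nonneg fun k hk => (hp k (by rw [mem_range] at hk; omega)).le
    have hR : ∀ j < m, ∑ k ∈ Ico j m, r k = r j + ∑ k ∈ Ico (j + 1) m, r k := fun j hj =>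
      sum_eq_sum_Ico_succ_bot hj _
    -- The latest flow: link `j` is entered at the constant rate `q (g j)`, finishing exactly when
    -- the last fluid must leave. The hypothesis for the pair `j`, `g j` says that this does not
    -- begin before time zero. Supply suffices because `q (g j) ≤ q (g (j + 1))`.
    refine ⟨fun j x => max 0 (∑ k ∈ range (j + 1), p k -
      q (g j) * max 0 (t - ∑ k ∈ Ico j m, r k - x)), ?_, ?_, ?_, ?_, ?_, ?_⟩
    · intro j hj x hx
      have h1 := H j (g j) (mem_Ico.1 (hg j hj).1).1 (mem_Ico.1 (hg j hj).1).2
      have h2 : t - ∑ k ∈ Ico j m, r k ≤ max 0 (t - ∑ k ∈ Ico j m, r k - x) :=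
        le_max_of_le_right (by linarith)
      have h3 := mul_le_mul_of_nonneg_left h2 (hg0 j hj).le
      exact max_eq_left (by linarith)
    · intro j hj x y hxy
      have h2 : max 0 (t - ∑ k ∈ Ico j m, r k - y) ≤ max 0 (t - ∑ k ∈ Ico j m, r k - x) :=
        max_le_max_left _ (by linarith)
      have h3 := mul_le_mul_of_nonneg_left h2 (hg0 j hj).le
      exact max_le_max_left _ (by linarith)
    · intro j hj x y hxy
      dsimp only
      have h2 : max 0 (t - ∑ k ∈ Ico j m, r k - x) ≤
          max 0 (t - ∑ k ∈ Ico j m, r k - y) + (y - x) := by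
        refine max_le ?_ ?_
        · have := le_max_left 0 (t - ∑ k ∈ Ico j m, r k - y)
          linarith
        · have := le_max_right 0 (t - ∑ k ∈ Ico j m, r k - y)
          linarith
      have h3 := mul_le_mul_of_nonneg_left h2 (hg0 j hj).le
      have h4 := mul_le_mul_of_nonneg_right (hgq j hj) (sub_nonneg.2 hxy)
      have h5 := le_max_left 0 (∑ k ∈ range (j + 1), p k -
        q (g j) * max 0 (t - ∑ k ∈ Ico j m, r k - x))
      have h6 := le_max_right 0 (∑ k ∈ range (j + 1), p k -
        q (g j) * max 0 (t - ∑ k ∈ Ico j m, r k - x))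
      have h7 : 0 ≤ q (g j) * (y - x) := mul_nonneg (hg0 j hj).le (sub_nonneg.2 hxy)
      rw [sub_le_iff_le_add]
      refine max_le ?_ ?_ <;> linarith
    · intro hm x
      have h1 : 0 ≤ q (g 0) * max 0 (t - ∑ k ∈ Ico 0 m, r k - x) :=
        mul_nonneg (hg0 0 hm).le (le_max_left _ _)
      refine max_le (hp 0 hm).le ?_
      rw [zero_add, sum_range_one]
      linarith
    · intro j hj x
      dsimp only
      have h1 : t - ∑ k ∈ Ico j m, r k - (x - r j) = t - ∑ k ∈ Ico (j + 1) m, r k - x := by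
        rw [hR j (by omega)]; ring
      rw [h1, sum_range_succ _ (j + 1)]
      have h2 : q (g j) ≤ q (g (j + 1)) :=
        (hg j (by omega)).2 _ (by
          have := mem_Ico.1 (hg (j + 1) hj).1
          rw [mem_Ico]; omega)
      have h3 := mul_le_mul_of_nonneg_right h2
        (le_max_left 0 (t - ∑ k ∈ Ico (j + 1) m, r k - x))
      have h5 := le_max_left 0 (∑ k ∈ range (j + 1), p k -
        q (g j) * max 0 (t - ∑ k ∈ Ico (j + 1) m, r k - x))
      have h6 := le_max_right 0 (∑ k ∈ range (j + 1), p k -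
        q (g j) * max 0 (t - ∑ k ∈ Ico (j + 1) m, r k - x))
      have h7 := hp (j + 1) hj
      refine max_le ?_ ?_ <;> linarith
    · intro j hj
      have h1 : ∑ k ∈ Ico j m, r k = r j := by subst hj; simp
      have h2 := hP j (by omega)
      subst hj
      simp [h2]

/-! ### Evacuation times as maxima over pairs of a place and a link -/

/-- Prefix sums of travel times (`D`) and of weights (`W`), and inverse capacities (`γ`) along a
path. -/
structure Profile where
  D : ℕ → ℝ
  W : ℕ → ℝ
  γ : ℕ → ℝ
  D_mono : Monotone D
  W_mono : StrictMono W
  W_nonneg : ∀ i, 0 ≤ W i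
  γ_pos : ∀ i, 0 < γ i

namespace Profile

variable (P : Profile)

open Finset in
/-- The time for evacuating the vertices `a, …, x - 1` to the vertex `x`. -/
noncomputable def cost (a x : ℕ) : ℝ :=
  ((range x ×ˢ range x).filter fun q => a ≤ q.1 ∧ q.1 ≤ q.2).fold max 0
    fun q => P.D x - P.D q.1 + (P.W (q.1 + 1) - P.W a) * P.γ q.2

variable {P} {a a' b x y i j : ℕ} {u : ℝ}

theorem cost_le_iff : P.cost a x ≤ u ↔ 0 ≤ u ∧ ∀ i j, a ≤ i → i ≤ j → j < x →
    P.D x - P.D i + (P.W (i + 1) - P.W a) * P.γ j ≤ u := by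
  rw [cost, Finset.fold_max_le]
  refine and_congr_right fun _ => ⟨fun h i j h1 h2 h3 => ?_, fun h q hq => ?_⟩
  · refine h (i, j) ?_
    simp only [Finset.mem_filter, Finset.mem_product, Finset.mem_range]
    omega
  · simp only [Finset.mem_filter, Finset.mem_product, Finset.mem_range] at hq
    exact h _ _ hq.2.1 hq.2.2 hq.1.2

theorem cost_nonneg : 0 ≤ P.cost a x := (cost_le_iff.1 le_rfl).1

theorem le_cost (h1 : a ≤ i) (h2 : i ≤ j) (h3 : j < x) :
    P.D x - P.D i + (P.W (i + 1) - P.W a) * P.γ j ≤ P.cost a x :=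
  (cost_le_iff.1 le_rfl).2 i j h1 h2 h3

theorem cost_of_le (h : x ≤ a) : P.cost a x = 0 :=
  le_antisymm (cost_le_iff.2 ⟨le_rfl, fun _ _ _ _ _ => by omega⟩) cost_nonneg

theorem weight_pos (h : a ≤ i) : 0 < P.W (i + 1) - P.W a :=
  sub_pos.2 (P.W_mono (by omega))

/-- Every term of the maximum grows by the travel time of the additional edge; the new term with `i
= j = x` takes care of the bottom value `0`. -/
theorem cost_succ (h : a ≤ x) : P.cost a x + (P.D (x + 1) - P.D x) ≤ P.cost a (x + 1) := by
  rw [← le_sub_iff_add_le, cost_le_iff]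
  constructor
  · have h1 := le_cost (P := P) h le_rfl (Nat.lt_succ_self x)
    have h2 := mul_pos (weight_pos (P := P) h) (P.γ_pos x)
    linarith
  · intro i j h1 h2 h3
    have := le_cost (P := P) h1 h2 (h3.trans (Nat.lt_succ_self x))
    linarith

theorem cost_mono (h : x ≤ y) : P.cost a x ≤ P.cost a y := by
  induction y, h using Nat.le_induction with
  | base => exact le_rfl
  | succ y h ih =>
    rcases le_or_gt a y with h1 | h1
    · have := P.D_mono (Nat.le_succ y)
      have := cost_succ (P := P) h1
      exact ih.trans (by simp only [Nat.succ_eq_add_one] at *; linarith)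
    · rw [cost_of_le (by omega : x ≤ a)]
      exact cost_nonneg

theorem cost_anti (h : a ≤ a') : P.cost a' x ≤ P.cost a x := by
  refine cost_le_iff.2 ⟨cost_nonneg, fun i j h1 h2 h3 => ?_⟩
  have h4 := le_cost (P := P) (h.trans h1) h2 h3
  have h5 := mul_le_mul_of_nonneg_right (P.W_mono.monotone h) (P.γ_pos j).le
  nlinarith

open Finset in
/-- The evacuation of a line which is a part of the path, up to a point that is by `δ` before the
vertex `a + m`. -/
theorem lineEvacuation_iff_cost {m : ℕ} {p q r : ℕ → ℝ} {t δ : ℝ}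
    (hp : ∀ k < m, p k = P.W (a + k + 1) - P.W (a + k))
    (hq : ∀ k < m, 0 < q k ∧ P.γ (a + k) = 1 / q k)
    (hr0 : ∀ k < m, 0 ≤ r k)
    (hr : ∀ k, k + 1 < m → r k = P.D (a + k + 1) - P.D (a + k))
    (hrl : ∀ k, k + 1 = m → r k = P.D (a + k + 1) - P.D (a + k) - δ) (ht : 0 ≤ t + δ) :
    LineEvacuation m p q r t ↔ P.cost a (a + m) ≤ t + δ := by
  have hS : ∀ i < m, ∑ k ∈ range (i + 1), p k = P.W (a + i + 1) - P.W a := by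
    intro i hi
    rw [sum_congr rfl fun k hk => hp k (by rw [mem_range] at hk; omega)]
    exact sum_range_sub (fun k => P.W (a + k)) (i + 1)
  -- All fluid uses the last link, so cutting `δ` off its travel time shifts every condition by the
  -- same amount. Thus the cost to a vertex also serves for sinks inside an edge.
  have hR : ∀ i < m, ∑ k ∈ Ico i m, r k = P.D (a + m) - P.D (a + i) - δ := by
    intro i hi
    obtain ⟨m, rfl⟩ : ∃ m', m = m' + 1 := ⟨m - 1, by omega⟩
    rw [sum_Ico_succ_top (by omega), hrl m rfl,
      sum_congr rfl fun k hk => hr k (by rw [mem_Ico] at hk; omega)]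
    have := sum_Ico_sub (fun k => P.D (a + k)) (show i ≤ m by omega)
    simp only [← add_assoc] at this ⊢
    rw [this]
    ring
  rw [lineEvacuation_iff (fun j hj => by rw [hp j hj]; exact weight_pos le_rfl)
    (fun j hj => (hq j hj).1) hr0, cost_le_iff]
  have key : ∀ i j, i ≤ j → j < m →
      (∑ k ∈ range (i + 1), p k ≤ q j * (t - ∑ k ∈ Ico i m, r k) ↔
      P.D (a + m) - P.D (a + i) + (P.W (a + i + 1) - P.W a) * P.γ (a + j) ≤ t + δ) := by
    intro i j h1 h2
    rw [hS i (by omega), hR i (by omega), (hq j h2).2, mul_one_div, ← le_sub_iff_add_le',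
      div_le_iff₀' (hq j h2).1]
    ring_nf
  constructor
  · intro h
    refine ⟨ht, fun i j h1 h2 h3 => ?_⟩
    obtain ⟨i, rfl⟩ := Nat.exists_eq_add_of_le h1
    obtain ⟨j, rfl⟩ := Nat.exists_eq_add_of_le (h1.trans h2)
    exact (key i j (by omega) (by omega)).1 (h i j (by omega) (by omega))
  · rintro ⟨-, h⟩ i j h1 h2
    exact (key i j h1 h2).2 (h _ _ (by omega) (by omega) (by omega))

end Profile

/-! ### The doubled path: evacuation from both sides as one cost function -/

namespace DynamicPath

variable (N : DynamicPath)

theorem w_pos {i : ℕ} (h : i < N.n) : 0 < N.w i := by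
  rw [w, dif_pos h]; exact_mod_cast N.weight_pos _

theorem l_nonneg (i : ℕ) : 0 ≤ N.l i := by
  rw [l]; split_ifs
  exacts [N.length_nonneg _, le_rfl]

theorem c_pos {i : ℕ} (h : i + 1 < N.n) : 0 < N.c i := by
  rw [c, dif_pos (by omega)]; exact N.capacity_pos _

/-- The vertex of the network at position `i` of the doubled path, which consists of the network
and, to the right of it, its mirror image. -/
def dv (i : ℕ) : ℕ := if i < N.n then i else N.n + N.n - 1 - i

/-- The edge of the network at position `i` of the doubled path. -/
def de (i : ℕ) : ℕ := if i < N.n then i else N.n + N.n - 2 - i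

/-- The profile of the doubled path. -/
noncomputable def profile : Profile where
  D i := ∑ k ∈ Finset.range i, N.τ * N.l (N.de k)
  W i := ∑ k ∈ Finset.range i, N.w (N.dv k)
  -- The joint between the two halves has the edge number `n - 1`, which is no edge of the network
  -- and has capacity `0`. The default `1` keeps `γ` positive; no cost that is used crosses the
  -- joint.
  γ i := if 0 < N.c (N.de i) then 1 / N.c (N.de i) else 1
  D_mono := monotone_nat_of_le_succ fun i => by
    rw [Finset.sum_range_succ]
    exact le_add_of_nonneg_right (mul_nonneg N.τ_nonneg (N.l_nonneg _))
  W_mono := strictMono_nat_of_lt_succ fun i => by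
    rw [Finset.sum_range_succ]
    refine lt_add_of_pos_right _ (N.w_pos ?_)
    have := N.n_pos
    -- Past the end of the doubled path truncated subtraction yields vertex `0`, so every weight
    -- stays positive.
    unfold dv
    split_ifs <;> omega
  W_nonneg i := Finset.sum_nonneg fun k _ => by
    rw [w]
    split_ifs
    exacts [Nat.cast_nonneg _, le_rfl]
  γ_pos i := by
    split_ifs with h
    exacts [one_div_pos.2 h, one_pos]

theorem profile_W_succ (i : ℕ) : N.profile.W (i + 1) = N.profile.W i + N.w (N.dv i) :=
  Finset.sum_range_succ _ _

theorem profile_D_succ (i : ℕ) : N.profile.D (i + 1) = N.profile.D i + N.τ * N.l (N.de i) :=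
  Finset.sum_range_succ _ _

/-- The time for evacuating the vertices `x + 1, …, b` to the vertex `x`. -/
noncomputable def costR (b x : ℕ) : ℝ :=
  N.profile.cost (N.n + N.n - 1 - b) (N.n + N.n - 1 - x)

/-- The travel time on the edge `x`. -/
noncomputable def trav (x : ℕ) : ℝ := N.profile.D (x + 1) - N.profile.D x

theorem trav_eq {x : ℕ} (h : x < N.n) : N.trav x = N.τ * N.l x := by
  rw [trav, profile_D_succ, de, if_pos h]; ring

theorem trav_nonneg (x : ℕ) : 0 ≤ N.trav x := sub_nonneg.2 (N.profile.D_mono (Nat.le_succ x))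

variable {N}

theorem γ_eq {i : ℕ} (h : N.de i + 1 < N.n) : 0 < N.c (N.de i) ∧
    N.profile.γ i = 1 / N.c (N.de i) :=
  ⟨N.c_pos h, if_pos (N.c_pos h)⟩

theorem evacLeft_vertex {a x : ℕ} {t : ℝ} (ha : a ≤ x) (hx : x < N.n) (ht : 0 ≤ t) :
    N.EvacLeft a ⟨x, 0⟩ t ↔ N.profile.cost a x ≤ t := by
  have h := Profile.lineEvacuation_iff_cost (P := N.profile) (a := a) (m := x - a)
    (p := fun j => N.w (a + j)) (q := fun j => N.c (a + j))
    (r := fun j => N.τ * (if a + j = x then 0 * N.l (a + j) else N.l (a + j))) (t := t) (δ := 0)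
    ?_ ?_ ?_ ?_ ?_ (by linarith)
  · rw [Nat.add_sub_cancel' ha, add_zero] at h
    rw [← h, EvacLeft]
    simp
  · intro k hk
    rw [profile_W_succ, dv, if_pos (by omega)]; ring
  · intro k hk
    have h1 : N.de (a + k) = a + k := if_pos (by omega)
    have h2 := γ_eq (N := N) (i := a + k) (by omega)
    rwa [h1] at h2
  · intro k hk
    rw [if_neg (by omega)]
    exact mul_nonneg N.τ_nonneg (N.l_nonneg _)
  · intro k hk
    rw [if_neg (by omega), profile_D_succ, de, if_pos (by omega)]; ring
  · intro k hk
    rw [if_neg (by omega), profile_D_succ, de, if_pos (by omega)]; ring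

/-- The sink lies before the vertex `x + 1` by the travel time `trav x * (1 - f)`, which is saved on
the way to that vertex. -/
theorem evacLeft_edge {a x : ℕ} {t f : ℝ} (ha : a ≤ x) (hx : x + 1 < N.n) (ht : 0 ≤ t)
    (hf : 0 < f) (hf1 : f < 1) :
    N.EvacLeft a ⟨x, f⟩ t ↔ N.profile.cost a (x + 1) ≤ t + N.trav x * (1 - f) := by
  have h := Profile.lineEvacuation_iff_cost (P := N.profile) (a := a) (m := x + 1 - a)
    (p := fun j => N.w (a + j)) (q := fun j => N.c (a + j))
    (r := fun j => N.τ * (if a + j = x then f * N.l (a + j) else N.l (a + j))) (t := t)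
    (δ := N.trav x * (1 - f)) ?_ ?_ ?_ ?_ ?_
    (add_nonneg ht (mul_nonneg (N.trav_nonneg x) (by linarith)))
  · rw [Nat.add_sub_cancel' (by omega)] at h
    rw [← h, EvacLeft]
    simp [hf]
  · intro k hk
    rw [profile_W_succ, dv, if_pos (by omega)]; ring
  · intro k hk
    have h1 : N.de (a + k) = a + k := if_pos (by omega)
    have h2 := γ_eq (N := N) (i := a + k) (by omega)
    rwa [h1] at h2
  · intro k hk
    have := N.l_nonneg (a + k)
    refine mul_nonneg N.τ_nonneg ?_
    split_ifs
    exacts [mul_nonneg hf.le this, this]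
  · intro k hk
    rw [if_neg (by omega), profile_D_succ, de, if_pos (by omega)]; ring
  · intro k hk
    obtain rfl : x = a + k := by omega
    rw [if_pos rfl, N.trav_eq (by omega), profile_D_succ, de, if_pos (by omega)]; ring

/-- A sink is named by the vertex on its left, so the line on its right always ends with the edge
`x` if it is not empty. Hence a sink on a vertex is the case `f = 0` and needs no separate
treatment. -/
theorem evacRight_iff {b x : ℕ} {t f : ℝ} (hxb : x ≤ b) (hb : b < N.n) (ht : 0 ≤ t)
    (hf : 0 ≤ f) (hf1 : f < 1) :
    N.EvacRight b ⟨x, f⟩ t ↔ N.costR b x ≤ t + N.trav x * f := by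
  have h := Profile.lineEvacuation_iff_cost (P := N.profile) (a := N.n + N.n - 1 - b) (m := b - x)
    (p := fun j => N.w (b - j)) (q := fun j => N.c (b - j - 1))
    (r := fun j => N.τ * (if b - j - 1 = x then (1 - f) * N.l (b - j - 1) else N.l (b - j - 1)))
    (t := t) (δ := N.trav x * f) ?_ ?_ ?_ ?_ ?_
    (add_nonneg ht (mul_nonneg (N.trav_nonneg x) hf))
  · have h1 : N.n + N.n - 1 - b + (b - x) = N.n + N.n - 1 - x := by omega
    rw [h1] at h
    rw [costR, ← h, EvacRight]
  · intro k hk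
    rw [profile_W_succ, dv, if_neg (by omega)]
    have h1 : N.n + N.n - 1 - (N.n + N.n - 1 - b + k) = b - k := by omega
    rw [h1]; ring
  · intro k hk
    have h1 : N.de (N.n + N.n - 1 - b + k) = b - k - 1 := by
      rw [de, if_neg (by omega)]; omega
    have h2 := γ_eq (N := N) (i := N.n + N.n - 1 - b + k) (by omega)
    rwa [h1] at h2
  · intro k hk
    have := N.l_nonneg (b - k - 1)
    refine mul_nonneg N.τ_nonneg ?_
    split_ifs
    exacts [mul_nonneg (by linarith) this, this]
  · intro k hk
    have h1 : N.de (N.n + N.n - 1 - b + k) = b - k - 1 := by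
      rw [de, if_neg (by omega)]; omega
    rw [if_neg (by omega), profile_D_succ, h1]; ring
  · intro k hk
    have h1 : N.de (N.n + N.n - 1 - b + k) = b - k - 1 := by
      rw [de, if_neg (by omega)]; omega
    have h2 : b - k - 1 = x := by omega
    rw [if_pos h2, N.trav_eq (by omega), profile_D_succ, h1, h2]; ring

end DynamicPath

/-! ### Feasible blocks, divisions of the path and the greedy choice -/

namespace DynamicPath

variable {N : DynamicPath} {a b x y : ℕ} {t t' f : ℝ}

theorem costR_nonneg : 0 ≤ N.costR b x := Profile.cost_nonneg

theorem costR_of_le (h : b ≤ x) : N.costR b x = 0 := Profile.cost_of_le (by omega)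

theorem costR_succ (hb : b < N.n) (hx : x < b) : N.costR b (x + 1) + N.trav x ≤ N.costR b x := by
  have h := Profile.cost_succ (P := N.profile) (a := N.n + N.n - 1 - b)
    (x := N.n + N.n - 1 - (x + 1)) (by omega)
  have h1 : N.n + N.n - 1 - (x + 1) + 1 = N.n + N.n - 1 - x := by omega
  have h2 := N.profile_D_succ (N.n + N.n - 1 - (x + 1))
  have h3 : N.de (N.n + N.n - 1 - (x + 1)) = x := by
    rw [de, if_neg (by omega)]; omega
  rw [h1] at h h2
  rw [h3] at h2
  rw [N.trav_eq (by omega), costR, costR]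
  linarith

theorem costR_anti (h : x ≤ y) : N.costR b y ≤ N.costR b x := Profile.cost_mono (by omega)

theorem costR_mono {b' : ℕ} (h : b ≤ b') : N.costR b x ≤ N.costR b' x :=
  Profile.cost_anti (by omega)

theorem canEvacuate_iff (hb : b < N.n) (ht : 0 ≤ t) :
    N.CanEvacuate a b ⟨y, f⟩ t ↔ (a ≤ y ∧ 0 ≤ f ∧ f < 1 ∧ (y : ℝ) + f ≤ b) ∧
      (f = 0 → N.profile.cost a y ≤ t) ∧
      (0 < f → N.profile.cost a (y + 1) ≤ t + N.trav y * (1 - f)) ∧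
      N.costR b y ≤ t + N.trav y * f := by
  rw [CanEvacuate, OnSubpath]
  refine and_congr_right fun ⟨h1, h2, h3, h4⟩ => ?_
  dsimp only at h1 h2 h3 h4
  have hyb : y ≤ b := by
    have : (y : ℝ) ≤ b := by linarith
    exact_mod_cast this
  rw [evacRight_iff hyb hb ht h2 h3, ← and_assoc (a := f = 0 → _)]
  simp only [ht, true_and]
  refine and_congr_left fun _ => ?_
  rcases h2.eq_or_lt with h | h
  · subst h
    simp [evacLeft_vertex h1 (hyb.trans_lt hb) ht]
  · have h5 : y < b := by
      have : (y : ℝ) < b := by linarith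
      exact_mod_cast this
    rw [evacLeft_edge h1 (by omega) ht h h3]
    exact ⟨fun h6 => ⟨fun h7 => absurd h7 h.ne', fun _ => h6⟩, fun h6 => h6.2 h⟩

variable (N) in
/-- The subpath `P[v_a, v_b]` can be evacuated to some sink within time `t`. -/
def BlockOK (a b : ℕ) (t : ℝ) : Prop := ∃ s, N.CanEvacuate a b s t

variable (N) in
/-- The least time for evacuating `P[v_a, v_b]` to a sink on the edge `x` (without its right
end), if the evacuation time from the left to the vertex `x` is negligible. -/
noncomputable def edgeCost (a x b : ℕ) : ℝ :=
  min (N.costR b x) ((N.profile.cost a (x + 1) - N.trav x + N.costR b x) / 2)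

theorem edgeCost_nonneg (h : a ≤ x) : 0 ≤ N.edgeCost a x b := by
  have h1 := Profile.cost_succ (P := N.profile) h
  have h2 := Profile.cost_nonneg (P := N.profile) (a := a) (x := x)
  have h3 := costR_nonneg (N := N) (b := b) (x := x)
  refine le_min h3 ?_
  rw [trav]
  linarith

theorem edgeCost_mono {b' : ℕ} (h : b ≤ b') : N.edgeCost a x b ≤ N.edgeCost a x b' := by
  have := costR_mono (N := N) (x := x) h
  exact min_le_min this (by linarith)

/-- A sink for `P[v_a, v_b]` on the edge `x`. -/
theorem canEvacuate_sink (ht : 0 ≤ t) (hax : a ≤ x) (hxb : x ≤ b) (hb : b < N.n)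
    (h : N.profile.cost a x ≤ t) (h' : x < b → t < N.profile.cost a (x + 1))
    (hV : N.edgeCost a x b ≤ t) :
    N.CanEvacuate a b ⟨x, if N.costR b x ≤ t then 0 else
      (t - (N.profile.cost a (x + 1) - N.trav x)) / N.trav x⟩ t := by
  rw [canEvacuate_iff hb ht]
  split_ifs with h1
  · refine ⟨⟨hax, le_rfl, zero_lt_one, ?_⟩, fun _ => h, fun h => absurd h (lt_irrefl _), ?_⟩
    · rw [add_zero]; exact_mod_cast hxb
    · rwa [mul_zero, add_zero]
  · have hlt : x < b := by
      by_contra h2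
      exact h1 ((costR_of_le (not_lt.1 h2)).trans_le ht)
    have h2 := h' hlt
    have h3 : (N.profile.cost a (x + 1) - N.trav x + N.costR b x) / 2 ≤ t :=
      (min_le_iff.1 hV).resolve_left h1
    rw [not_le] at h1
    have h4 : 0 < N.trav x := by linarith
    have h5 : (t - (N.profile.cost a (x + 1) - N.trav x)) / N.trav x * N.trav x =
      t - (N.profile.cost a (x + 1) - N.trav x) := div_mul_cancel₀ _ h4.ne'
    -- The rightmost point that the evacuees from the left still reach in time. It lies properly
    -- inside the edge: the bound on the mean forces the left term below `t`, while the vertex `x +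
    -- 1` is out of reach.
    set g := (t - (N.profile.cost a (x + 1) - N.trav x)) / N.trav x
    have h6 : 0 < g := div_pos (by linarith) h4
    have h7 : g < 1 := (div_lt_one h4).2 (by linarith)
    refine ⟨⟨hax, h6.le, h7, ?_⟩, fun h => absurd h h6.ne', fun _ => ?_, ?_⟩
    · have : (x : ℝ) + 1 ≤ b := by exact_mod_cast hlt
      linarith
    · linarith
    · linarith

/-- Since `x` is the last vertex within reach from the left, a sink lies at `x`, on the edge `x`, or
to the left of `x`; the last kind is no better for the right side than `x` itself. At a point inside
the edge `x`, moving the sink shifts time between the two sides, and adding their conditions cancels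
the position: this is the mean in `edgeCost`. If the block ends at or before `x`, its last vertex
serves as the sink. -/
theorem blockOK_iff (ht : 0 ≤ t) (hax : a ≤ x) (hab : a ≤ b) (hb : b < N.n)
    (h : N.profile.cost a x ≤ t) (h' : x + 1 < N.n → t < N.profile.cost a (x + 1)) :
    N.BlockOK a b t ↔ N.edgeCost a x b ≤ t := by
  rcases le_or_gt b x with hbx | hbx
  · refine iff_of_true ⟨⟨b, 0⟩, ?_⟩ ((min_le_left _ _).trans ((costR_of_le hbx).trans_le ht))
    rw [canEvacuate_iff hb ht]
    refine ⟨⟨hab, le_rfl, zero_lt_one, (add_zero _).le⟩,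
      fun _ => (Profile.cost_mono hbx).trans h, fun h => absurd h (lt_irrefl _), ?_⟩
    rwa [mul_zero, add_zero, costR_of_le le_rfl]
  · refine ⟨?_, fun hV => ⟨_, canEvacuate_sink ht hax hbx.le hb h (fun _ => h' (by omega)) hV⟩⟩
    rintro ⟨⟨y, f⟩, hs⟩
    rw [canEvacuate_iff hb ht] at hs
    obtain ⟨⟨h1, h2, h3, h4⟩, h5, h6, h7⟩ := hs
    have hx' := h' (by omega)
    rcases h2.eq_or_lt with rfl | hf
    · rw [mul_zero, add_zero] at h7
      have hyx : y ≤ x := by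
        by_contra h8
        have := (Profile.cost_mono (P := N.profile) (a := a) (not_le.1 h8)).trans (h5 rfl)
        linarith
      exact (min_le_left _ _).trans ((costR_anti hyx).trans h7)
    · have h8 := h6 hf
      have h9 := Profile.cost_succ (P := N.profile) h1
      have h10 := N.trav_nonneg y
      have h11 := mul_nonneg h10 hf.le
      rw [← trav] at h9
      have hyx : y ≤ x := by
        by_contra h12
        have := (Profile.cost_mono (P := N.profile) (a := a) (not_le.1 h12))
        linarith
      rcases hyx.eq_or_lt with rfl | hyx
      · refine (min_le_right _ _).trans ?_
        linarith
      · have h12 := costR_succ (N := N) hb (hyx.trans hbx)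
        have h13 := mul_le_mul_of_nonneg_left h3.le h10
        have h14 := costR_anti (N := N) (b := b) (Nat.succ_le_of_lt hyx)
        refine (min_le_left _ _).trans ?_
        simp only [Nat.succ_eq_add_one] at h14
        linarith

/-- A sink to the right of the new left end is kept. Otherwise the new left end becomes the sink,
which is nearer to everything that remains. -/
theorem BlockOK.shrink {a' : ℕ} (h : N.BlockOK a b t) (ht : 0 ≤ t) (ha : a ≤ a') (hb : a' ≤ b)
    (hbn : b < N.n) : N.BlockOK a' b t := by
  obtain ⟨⟨y, f⟩, hs⟩ := h
  rw [canEvacuate_iff hbn ht] at hs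
  obtain ⟨⟨h1, h2, h3, h4⟩, h5, h6, h7⟩ := hs
  rcases le_or_gt a' y with hy | hy
  · refine ⟨⟨y, f⟩, (canEvacuate_iff hbn ht).2 ⟨⟨hy, h2, h3, h4⟩, fun h => ?_, fun h => ?_, h7⟩⟩
    · exact (Profile.cost_anti ha).trans (h5 h)
    · exact (Profile.cost_anti ha).trans (h6 h)
  · refine ⟨⟨a', 0⟩, (canEvacuate_iff hbn ht).2 ⟨⟨le_rfl, le_rfl, zero_lt_one, ?_⟩, fun _ => ?_,
      fun h => absurd h (lt_irrefl _), ?_⟩⟩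
    · rw [add_zero]; exact_mod_cast hb
    · rwa [Profile.cost_of_le le_rfl]
    · have h8 := costR_succ (N := N) hbn (hy.trans_le hb)
      have h9 := costR_anti (N := N) (b := b) (Nat.succ_le_of_lt hy)
      have h10 := mul_le_mul_of_nonneg_left h3.le (N.trav_nonneg y)
      simp only [Nat.succ_eq_add_one] at h9
      linarith

theorem BlockOK.mono (h : N.BlockOK a b t) (ht : 0 ≤ t) (htt : t ≤ t') (hbn : b < N.n) :
    N.BlockOK a b t' := by
  obtain ⟨⟨y, f⟩, hs⟩ := h
  refine ⟨⟨y, f⟩, ?_⟩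
  rw [canEvacuate_iff hbn ht] at hs
  rw [canEvacuate_iff hbn (ht.trans htt)]
  obtain ⟨h1, h5, h6, h7⟩ := hs
  exact ⟨h1, fun h => (h5 h).trans htt, fun h => (h6 h).trans (by linarith), by linarith⟩

variable (N) in
/-- Evacuation to some `k` sinks is possible within time `t`. -/
def FeasK (k : ℕ) (t : ℝ) : Prop := ∃ s : Fin k → PathPoint, N.Feasible s t

theorem CanEvacuate.onPath {s : PathPoint} (hb : b < N.n) (h : N.CanEvacuate a b s t) :
    N.OnPath s := by
  obtain ⟨⟨-, h2, h3, h4⟩, -⟩ := h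
  refine ⟨Nat.zero_le _, h2, h3, h4.trans ?_⟩
  exact_mod_cast (by omega : b ≤ N.n - 1)

theorem onPath_zero : N.OnPath ⟨0, 0⟩ :=
  ⟨le_rfl, le_rfl, zero_lt_one, by simp⟩

theorem feasible_of {m : ℕ} {s : ℕ → PathPoint} {d : ℕ → ℕ} (hs : ∀ j < m, N.OnPath (s j))
    (hd : Monotone d) (h0 : d 0 = 0) (hm : d m = N.n)
    (h : ∀ j < m, d j < d (j + 1) → N.CanEvacuate (d j) (d (j + 1) - 1) (s j) t) :
    N.Feasible (fun j : Fin m => s j) t :=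
  ⟨fun j => hs j j.2, fun j => d j, fun _ _ hij => hd hij, h0, hm, fun j => h j j.2⟩

/-- Cut points indexed by all natural numbers permit induction along the blocks. The sinks of empty
blocks are arbitrary points of the path. -/
theorem feasK_iff {k : ℕ} : N.FeasK k t ↔ ∃ d : ℕ → ℕ, Monotone d ∧ d 0 = 0 ∧ d k = N.n ∧
    ∀ j < k, d j < d (j + 1) → N.BlockOK (d j) (d (j + 1) - 1) t := by
  constructor
  · rintro ⟨s, -, d, hd, h0, hk, h⟩
    refine ⟨fun j => d ⟨min j k, by omega⟩, fun i j hij => hd ?_, ?_, ?_, fun j hj hlt => ?_⟩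
    · rw [Fin.mk_le_mk]; omega
    · simpa using h0
    · simp only [min_self]; exact hk
    · have h1 : (⟨min j k, by omega⟩ : Fin (k + 1)) = (⟨j, hj⟩ : Fin k).castSucc := by
        ext; simp; omega
      have h2 : (⟨min (j + 1) k, by omega⟩ : Fin (k + 1)) = (⟨j, hj⟩ : Fin k).succ := by
        ext; simp; omega
      dsimp only at hlt ⊢
      rw [h1, h2] at hlt ⊢
      exact ⟨_, h _ hlt⟩
  · rintro ⟨d, hd, h0, hk, h⟩
    have hs : ∀ j, ∃ s, N.OnPath s ∧ (j < k → d j < d (j + 1) →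
        N.CanEvacuate (d j) (d (j + 1) - 1) s t) := by
      intro j
      by_cases hj : j < k ∧ d j < d (j + 1)
      · obtain ⟨s, hs⟩ := h j hj.1 hj.2
        have h1 : d (j + 1) ≤ d k := hd hj.1
        exact ⟨s, hs.onPath (by omega), fun _ _ => hs⟩
      · exact ⟨⟨0, 0⟩, onPath_zero, fun h1 h2 => absurd ⟨h1, h2⟩ hj⟩
    choose s hs1 hs2 using hs
    exact ⟨_, feasible_of (fun j _ => hs1 j) hd h0 hk hs2⟩

theorem FeasK.nonneg {k : ℕ} (h : N.FeasK k t) : 0 ≤ t := by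
  obtain ⟨d, -, h0, hk, h⟩ := feasK_iff.1 h
  by_contra ht
  have h1 : ∀ j ≤ k, d j = 0 := by
    intro j
    induction j with
    | zero => exact fun _ => h0
    | succ j ih =>
      intro hj
      by_contra hne
      obtain ⟨s, hs⟩ := h j hj (by rw [ih (by omega)]; omega)
      exact ht hs.2.1
  have := N.n_pos
  have := h1 k le_rfl
  omega

theorem FeasK.mono {k : ℕ} (h : N.FeasK k t) (htt : t ≤ t') : N.FeasK k t' := by
  have ht := h.nonneg
  obtain ⟨d, hd, h0, hk, h⟩ := feasK_iff.1 h
  refine feasK_iff.2 ⟨d, hd, h0, hk, fun j hj hlt => (h j hj hlt).mono ht htt ?_⟩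
  have : d (j + 1) ≤ d k := hd hj
  omega

/-- A greedily chosen block ends at least as far to the right as the corresponding block of any
feasible division. -/
theorem greedy_step {d : ℕ → ℕ} {j : ℕ} (ht : 0 ≤ t)
    (h : d j < d (j + 1) → N.BlockOK (d j) (d (j + 1) - 1) t) (hn : d (j + 1) ≤ N.n)
    (hda : d j ≤ a) (hax : a ≤ x) (hab : a ≤ b) (hc : N.profile.cost a x ≤ t)
    (hc' : x + 1 < N.n → t < N.profile.cost a (x + 1))
    (hb : b + 1 < N.n → t < N.edgeCost a x (b + 1)) : d (j + 1) ≤ b + 1 := by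
  by_contra hlt
  -- A block reaching beyond `b + 1` could be shortened on its left to begin at `a`, and would then
  -- contradict the maximality of `b`.
  have h1 := (h (by omega)).shrink ht hda (by omega) (by omega)
  rw [blockOK_iff ht hax (by omega) (by omega) hc hc'] at h1
  have h2 := edgeCost_mono (N := N) (a := a) (x := x) (show b + 1 ≤ d (j + 1) - 1 by omega)
  have := hb (by omega)
  linarith

/-- If no critical value lies strictly between `lo` and `hi`, and `lo` is infeasible, then
everything below `hi` is infeasible. -/
theorem not_feasK_of_resolved {k : ℕ} {lo hi : ℝ} {X : ℕ → ℕ} (hlo0 : 0 ≤ lo)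
    (hlo : ¬ N.FeasK k lo) (hX : ∀ a < N.n, a ≤ X a ∧ X a < N.n)
    (h1 : ∀ a < N.n, N.profile.cost a (X a) ≤ lo)
    (h2 : ∀ a < N.n, X a + 1 < N.n → hi ≤ N.profile.cost a (X a + 1))
    (h3 : ∀ a < N.n, ∀ b, X a < b → b < N.n →
      N.edgeCost a (X a) b ≤ lo ∨ hi ≤ N.edgeCost a (X a) b)
    (ht : t < hi) : ¬ N.FeasK k t := by
  intro hF
  rcases le_or_gt t lo with hle | hgt
  · exact hlo (hF.mono hle)
  have ht0 := hF.nonneg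
  obtain ⟨d, hd, hd0, hk, h⟩ := feasK_iff.1 hF
  -- Between `lo` and `hi` the last reachable vertex of every block and the comparison with its
  -- `edgeCost` are constant, so the division that works for `t` would also work for `lo`.
  refine hlo (feasK_iff.2 ⟨d, hd, hd0, hk, fun j hj hlt => ?_⟩)
  have h4 : d (j + 1) ≤ d k := hd hj
  have ha : d j < N.n := by omega
  have h5 := (blockOK_iff ht0 (hX _ ha).1 (by omega) (by omega) ((h1 _ ha).trans hgt.le)
    fun h => ht.trans_le (h2 _ ha h)).1 (h j hj hlt)
  refine (blockOK_iff hlo0 (hX _ ha).1 (by omega) (by omega) (h1 _ ha)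
    fun h => (hgt.trans ht).trans_le (h2 _ ha h)).2 ?_
  rcases le_or_gt (d (j + 1) - 1) (X (d j)) with h6 | h6
  · exact (min_le_left _ _).trans ((costR_of_le h6).trans_le hlo0)
  · refine (h3 _ ha _ h6 (by omega)).resolve_right fun h7 => ?_
    linarith

end DynamicPath

/-! ### Upper envelopes of lines -/

/-- The lines `m k * y + b k` for `o ≤ k ≤ o + s` are sorted by their slopes, and consecutive
breakpoints of their upper envelope increase. -/
structure IsHull (m b : ℕ → ℝ) (o s : ℕ) : Prop where
  slope : ∀ k < s, m (o + k) ≤ m (o + k + 1)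
  first : 0 < s → m o < m (o + 1)
  conc : ∀ k, k + 2 ≤ s → (b (o + k) - b (o + k + 1)) * (m (o + k + 2) - m (o + k + 1)) <
    (b (o + k + 1) - b (o + k + 2)) * (m (o + k + 1) - m (o + k))

namespace IsHull

variable {m b m' b' : ℕ → ℝ} {o s k j : ℕ} {y : ℝ}

theorem congr (h : IsHull m b o s) (hm : ∀ k, o ≤ k → k ≤ o + s → m' k = m k)
    (hb : ∀ k, o ≤ k → k ≤ o + s → b' k = b k) : IsHull m' b' o s := by
  refine ⟨fun k hk => ?_, fun hs => ?_, fun k hk => ?_⟩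
  · rw [hm _ (by omega) (by omega), hm _ (by omega) (by omega)]
    exact h.slope k hk
  · rw [hm _ (by omega) (by omega), hm _ (by omega) (by omega)]
    exact h.first hs
  · rw [hm _ (by omega) (by omega), hm _ (by omega) (by omega), hm _ (by omega) (by omega),
      hb _ (by omega) (by omega), hb _ (by omega) (by omega), hb _ (by omega) (by omega)]
    exact h.conc k hk

/-- The breakpoint condition is cross-multiplied and so tolerates equal slopes. In that case it
forces the later of the two parallel lines to be the lower one. -/
theorem adjacent (h : IsHull m b o s) (hk : k < s) :
    m (o + k) < m (o + k + 1) ∨ b (o + k + 1) ≤ b (o + k) := by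
  rcases k with _ | k
  · exact Or.inl (h.first hk)
  · have h1 := h.conc k hk
    have h2 := h.slope k (by omega)
    rcases (h.slope (k + 1) hk).lt_or_eq with h3 | h3
    · exact Or.inl h3
    · refine Or.inr ?_
      simp only [← add_assoc] at h3 ⊢
      have h4 : m (o + k + 2) = m (o + k + 1) := h3.symm
      rw [h4, sub_self, mul_zero] at h1
      have h5 := pos_of_mul_pos_left h1 (sub_nonneg.2 h2)
      exact (sub_pos.1 h5).le

/-- The values of the lines at a fixed `y` are unimodal: since breakpoints increase along the
envelope, a step that does not ascend is followed only by such steps. -/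
theorem descend (h : IsHull m b o s)
    (hy : m (o + k + 1) * y + b (o + k + 1) ≤ m (o + k) * y + b (o + k)) (hkj : k ≤ j)
    (hj : j < s) : m (o + j + 1) * y + b (o + j + 1) ≤ m (o + j) * y + b (o + j) := by
  induction j, hkj using Nat.le_induction with
  | base => exact hy
  | succ j hkj ih =>
    have h1 := ih (by omega)
    have h2 := h.conc j hj
    have h3 := sub_nonneg.2 (h.slope j (by omega))
    have h4 := sub_nonneg.2 (h.slope (j + 1) hj)
    simp only [← add_assoc] at h4 ⊢
    change 0 ≤ m (o + j + 2) - _ at h4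
    change m (o + j + 2) * y + b (o + j + 2) ≤ _
    by_contra hlt
    rw [not_le] at hlt
    nlinarith [mul_le_mul_of_nonneg_right (sub_nonneg.2 h1) h4]

theorem le_of_descent (h : IsHull m b o s)
    (hy : m (o + k + 1) * y + b (o + k + 1) ≤ m (o + k) * y + b (o + k)) (hkj : k ≤ j)
    (hj : j ≤ s) : m (o + j) * y + b (o + j) ≤ m (o + k) * y + b (o + k) := by
  induction j, hkj using Nat.le_induction with
  | base => exact le_rfl
  | succ j hkj ih => exact (h.descend hy hkj hj).trans (ih (by omega))

theorem le_of_ascent (h : IsHull m b o s) (hk : k < s)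
    (hy : m (o + k) * y + b (o + k) < m (o + k + 1) * y + b (o + k + 1)) (hj : j ≤ k) :
    m (o + j) * y + b (o + j) ≤ m (o + k + 1) * y + b (o + k + 1) := by
  have h1 : ∀ i ≤ k, m (o + i) * y + b (o + i) < m (o + i + 1) * y + b (o + i + 1) := by
    intro i hi
    by_contra hlt
    exact absurd (h.descend (not_lt.1 hlt) hi hk) (not_le.2 hy)
  induction k, hj using Nat.le_induction with
  | base => exact hy.le
  | succ k hj ih =>
    exact (ih (by omega) (h1 k (by omega)) fun i hi => h1 i (by omega)).trans hy.le

end IsHull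

/-- A line below the intersection of its neighbours does not contribute to the envelope. -/
theorem line_le_max {m₁ m₂ m₃ b₁ b₂ b₃ u : ℝ} (h12 : m₁ ≤ m₂) (h23 : m₂ ≤ m₃)
    (h : m₁ < m₂ ∨ b₂ ≤ b₁) (hc : (b₂ - b₃) * (m₂ - m₁) ≤ (b₁ - b₂) * (m₃ - m₂)) {y : ℝ}
    (h1 : m₁ * y + b₁ ≤ u) (h3 : m₃ * y + b₃ ≤ u) : m₂ * y + b₂ ≤ u := by
  rcases h12.eq_or_lt with rfl | hlt
  · rcases h with h | h
    · exact absurd h (lt_irrefl _)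
    · linarith
  · by_contra h2
    rw [not_le] at h2
    have h4 := mul_lt_mul_of_pos_right (show m₃ * y + b₃ < m₂ * y + b₂ by linarith)
      (sub_pos.2 hlt)
    have h5 := mul_le_mul_of_nonneg_right (show m₁ * y + b₁ ≤ m₂ * y + b₂ by linarith)
      (sub_nonneg.2 h23)
    nlinarith

/-! ### Querying and extending an upper envelope on the machine -/

namespace RealRAM

/-- The value at `rreg 22` of the line number `i` in the arrays `A`, `B`. -/
def lineVal (A B : ℕ) (i : NExp) : RExp := .arr A i * .reg 22 + .arr B i

/-- Binary search for the maximum at `rreg 22` of the lines with the numbers `nreg 26`, …,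
`nreg 26 + nreg 28`, which form an upper envelope. -/
def query (A B : ℕ) : Cmd :=
  .nset 27 0 ;;
  .loop (.nlt (.reg 27) (.reg 28))
    (.nset 29 (.half (.reg 27 + .reg 28)) ;;
     .ite (.rlt (lineVal A B (.reg 26 + .reg 29)) (lineVal A B (.reg 26 + .reg 29 + 1)))
      (.nset 27 (.reg 29 + 1)) (.nset 28 (.reg 29))) ;;
  .rset 23 (lineVal A B (.reg 26 + .reg 27))

/-- By unimodality, comparing two neighbouring lines in the middle tells on which side the maximum
lies. The result is specified through its upper bounds, the form in which maxima over several blocks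
are combined. -/
theorem query_halts (A B : ℕ) {σ : Mem} {o s L : ℕ} {y : ℝ} (ho : σ.nreg 26 = o)
    (hs : σ.nreg 28 = s) (hy : σ.rreg 22 = y) (hL : s < 2 ^ L)
    (h : IsHull (σ.rarr A) (σ.rarr B) o s) :
    Halts (query A B) σ (50 * L + 50) fun σ' => ∀ u, σ'.rreg 23 ≤ u ↔
      ∀ k ≤ s, σ.rarr A (o + k) * y + σ.rarr B (o + k) ≤ u := by
  unfold query Halts
  set a := σ.rarr A with ha
  set b := σ.rarr B with hb
  simp only [wp_seq, wp_nset]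
  refine ⟨by simp, ?_⟩
  -- Lines before `lo` are dominated by the line `lo`, and lines after `hi` by the line `hi`. The
  -- exponent `e` bounds the number of halvings still to be paid.
  refine WP.loop (fun σ' T => ∃ e lo hi, σ'.nreg 26 = o ∧ σ'.nreg 27 = lo ∧ σ'.nreg 28 = hi ∧
    σ'.rreg 22 = y ∧ σ'.rarr A = a ∧ σ'.rarr B = b ∧ lo ≤ hi ∧ hi ≤ s ∧ hi - lo < 2 ^ e ∧
    50 * e + 40 ≤ T ∧ (∀ j < lo, a (o + j) * y + b (o + j) ≤ a (o + lo) * y + b (o + lo)) ∧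
    ∀ j, hi ≤ j → j ≤ s → a (o + j) * y + b (o + j) ≤ a (o + hi) * y + b (o + hi)) ?_ ?_
  · refine ⟨L, 0, s, by simp [ho], by simp, by simp [hs], by simp [hy], by simp [ha], by simp [hb],
      Nat.zero_le _, le_rfl, by omega, by simp, fun j hj => by omega, fun j h1 h2 => ?_⟩
    obtain rfl : j = s := le_antisymm h2 h1
    exact le_rfl
  · rintro σ' T ⟨e, lo, hi, h26, h27, h28, h22, hA, hB, hlh, hhs, he, hT, hl, hr⟩
    refine ⟨by simp; omega, fun hlt => ?_, fun hlt => ?_⟩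
    · simp only [BExp.eval_nlt, NExp.eval_reg, h27, h28] at hlt
      obtain ⟨e, rfl⟩ : ∃ e', e = e' + 1 := by
        refine ⟨e - 1, ?_⟩
        have : e ≠ 0 := by rintro rfl; simp at he; omega
        omega
      rw [pow_succ] at he
      have hmid : (lo + hi) / 2 < s := by omega
      simp [lineVal, h26, h27, h28, h22, hA, hB]
      refine ⟨by omega, by omega, fun hv => ⟨by omega, by omega, hhs, e, by omega, by omega,
        fun j hj => ?_, hr⟩, fun hv => ⟨by omega, by omega, by omega, e, by omega, by omega, hl,
        fun j h1 h2 => ?_⟩⟩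
      · exact h.le_of_ascent hmid hv (by omega)
      · exact h.le_of_descent hv h1 h2
    · simp only [BExp.eval_nlt, NExp.eval_reg, h27, h28] at hlt
      obtain rfl : lo = hi := by omega
      simp [lineVal, h26, h27, h22, hA, hB]
      refine ⟨by omega, fun u => ⟨fun hu k hk => ?_, fun hu => hu lo hhs⟩⟩
      rcases lt_or_ge k lo with hk' | hk'
      · exact (hl k hk').trans hu
      · exact (hr k hk' hk).trans hu

/-- Push the line with slope `rreg 30` and intercept `rreg 31` on the upper envelope which consists
of the lines with the numbers `nreg 35`, …, `nreg 35 + nreg 34`. -/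
def push (A B : ℕ) : Cmd :=
  .loop (.and (.nle 1 (.reg 34)) (.rle
      ((.arr B (.reg 35 + .reg 34) - .reg 31) *
        (.arr A (.reg 35 + .reg 34) - .arr A (.reg 35 + .reg 34 - 1)))
      ((.arr B (.reg 35 + .reg 34 - 1) - .arr B (.reg 35 + .reg 34)) *
        (.reg 30 - .arr A (.reg 35 + .reg 34)))))
    (.nset 34 (.reg 34 - 1)) ;;
  .nset 34 (.reg 34 + 1) ;;
  .rstore A (.reg 35 + .reg 34) (.reg 30) ;;
  .rstore B (.reg 35 + .reg 34) (.reg 31)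

/-- The cost is amortized: each line on the stack carries 60 credits, which pay for its removal. A
removed line lies below the maximum of its predecessor and the new line by `line_le_max`, so the
envelope is unchanged. -/
theorem push_wp {A B : ℕ} {σ : Mem} {T o s : ℕ} {m b : ℝ} {Q : Mem → ℕ → Prop}
    (ho : σ.nreg 35 = o) (hs : σ.nreg 34 = s) (hm : σ.rreg 30 = m) (hb : σ.rreg 31 = b)
    (h : IsHull (σ.rarr A) (σ.rarr B) o s) (hms : σ.rarr A (o + s) ≤ m) (hm0 : σ.rarr A o < m)
    (hT : 60 * s + 80 ≤ T)
    (hQ : ∀ s' T', s' ≤ s → T + 60 * (s' + 1) ≤ T' + 60 * s + 120 →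
      IsHull (Function.update (σ.rarr A) (o + (s' + 1)) m)
        (Function.update (σ.rarr B) (o + (s' + 1)) b) o (s' + 1) →
      (∀ y u, ((∀ k ≤ s, σ.rarr A (o + k) * y + σ.rarr B (o + k) ≤ u) ∧ m * y + b ≤ u) ↔
        ∀ k ≤ s' + 1, Function.update (σ.rarr A) (o + (s' + 1)) m (o + k) * y +
          Function.update (σ.rarr B) (o + (s' + 1)) b (o + k) ≤ u) →
      Q (((σ.setN 34 (s' + 1)).stR A (o + (s' + 1)) m).stR B (o + (s' + 1)) b) T') :
    WP (push A B) σ T Q := by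
  unfold push
  set a := σ.rarr A with ha
  set c := σ.rarr B with hc
  rw [wp_seq]
  -- Overwriting register `34` on both sides expresses that the memory has changed in this register
  -- only.
  refine WP.loop (fun σ' T' => ∃ s', σ'.setN 34 0 = σ.setN 34 0 ∧ σ'.nreg 34 = s' ∧ s' ≤ s ∧
    a (o + s') ≤ m ∧ T + 60 * s' ≤ T' + 60 * s ∧ ∀ y u,
      ((∀ k ≤ s, a (o + k) * y + c (o + k) ≤ u) ∧ m * y + b ≤ u) ↔
      ((∀ k ≤ s', a (o + k) * y + c (o + k) ≤ u) ∧ m * y + b ≤ u)) ?_ ?_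
  · exact ⟨s, rfl, hs, le_rfl, hms, le_rfl, fun y u => Iff.rfl⟩
  · rintro σ' T' ⟨s', hσ, h34, hss, hms', hT', hiff⟩
    have hreg : ∀ x, x ≠ 34 → σ'.nreg x = σ.nreg x := fun x hx => by
      have := congrArg (fun τ => Mem.nreg τ x) hσ
      simpa [hx] using this
    have hrr : σ'.rreg = σ.rreg := by simpa using congrArg Mem.rreg hσ
    have hra : σ'.rarr = σ.rarr := by simpa using congrArg Mem.rarr hσ
    have h35 : σ'.nreg 35 = o := by rw [hreg _ (by decide), ho]
    refine ⟨by simp; omega, fun hcond => ?_, fun hcond => ?_⟩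
    · simp only [BExp.eval_and, BExp.eval_nle, BExp.eval_rle, RExp.eval_mul, RExp.eval_sub,
        RExp.eval_arr, RExp.eval_reg, NExp.eval_add, NExp.eval_sub, NExp.eval_reg,
        NExp.eval_one, h35, h34, hrr, hra, hm, hb, ← ha, ← hc] at hcond
      obtain ⟨h1, h2⟩ := hcond
      obtain ⟨s', rfl⟩ : ∃ r, s' = r + 1 := ⟨s' - 1, by omega⟩
      have e1 : o + (s' + 1) - 1 = o + s' := by omega
      rw [e1] at h2
      have h3 := h.slope s' (by omega)
      rw [wp_nset]
      refine ⟨by simp; omega, s', ?_, by simp [h34], by omega, h3.trans hms', by simp; omega,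
        fun y u => ?_⟩
      · rw [← hσ]; simp [Mem.setN]
      · rw [hiff]
        refine and_congr_left fun h4 => ⟨fun h5 k hk => h5 k (by omega), fun h5 k hk => ?_⟩
        rcases hk.lt_or_eq with hk | rfl
        · exact h5 k (by omega)
        · exact line_le_max h3 hms' (h.adjacent (by omega)) h2 (h5 s' le_rfl) h4
    · simp only [BExp.eval_and, BExp.eval_nle, BExp.eval_rle, RExp.eval_mul, RExp.eval_sub,
        RExp.eval_arr, RExp.eval_reg, NExp.eval_add, NExp.eval_sub, NExp.eval_reg,
        NExp.eval_one, h35, h34, hrr, hra, hm, hb, ← ha, ← hc, not_and, not_le] at hcond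
      have hσ' : σ'.setN 34 (s' + 1) = σ.setN 34 (s' + 1) := by
        have := congrArg (fun τ => Mem.setN τ 34 (s' + 1)) hσ
        simpa [Mem.setN] using this
      have hlt : ∀ k ≤ s', o + k ≠ o + (s' + 1) := fun k hk => by omega
      simp only [wp_seq, wp_nset, wp_rstore, NExp.eval_add, NExp.eval_reg, NExp.eval_one, h34,
        BExp.cost_and, BExp.cost_nle, BExp.cost_rle, RExp.cost_mul, RExp.cost_sub, RExp.cost_arr,
        NExp.cost_sub, hσ', Mem.setN_nreg, Mem.stR_nreg, RExp.eval_reg, Mem.setN_rreg, Mem.stR_rreg, ho, hm, hb,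
        if_pos, NExp.cost_add, NExp.cost_reg, NExp.cost_one, RExp.cost_reg]
      norm_num only [ho]
      refine ⟨by omega, by omega, by omega, hQ s' _ hss (by omega) ⟨fun k hk => ?_, fun _ => ?_,
        fun k hk => ?_⟩ fun y u => ?_⟩
      · rw [Function.update_of_ne (hlt k (by omega))]
        rcases (show k ≤ s' by omega).lt_or_eq with hk' | rfl
        · rw [Function.update_of_ne (by omega)]
          exact h.slope k (by omega)
        · rw [add_assoc o k 1, Function.update_self]
          exact hms'
      · rw [Function.update_of_ne (by omega)]
        rcases s'.eq_zero_or_pos with rfl | hpos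
        · rwa [zero_add, Function.update_self]
        · rw [Function.update_of_ne (by omega)]
          exact h.first (by omega)
      · have h1 : ∀ (f : ℕ → ℝ) v j, j ≤ o + s' → Function.update f (o + (s' + 1)) v j = f j :=
          fun f v j hj => Function.update_of_ne (by omega) _ _
        rw [h1 _ _ (o + k) (by omega), h1 _ _ (o + k) (by omega), h1 _ _ (o + k + 1) (by omega),
          h1 _ _ (o + k + 1) (by omega)]
        rcases (show k + 1 ≤ s' by omega).lt_or_eq with hk' | rfl
        · rw [h1 _ _ _ (by omega), h1 _ _ _ (by omega)]
          exact h.conc k (by omega)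
        · have e1 : o + k + 2 = o + (k + 1 + 1) := by omega
          rw [e1, Function.update_self, Function.update_self]
          -- The failed removal test is precisely the breakpoint condition for the new line.
          exact hcond (by omega)
      · rw [hiff]
        constructor
        · rintro ⟨h1, h2⟩ k hk
          rcases hk.lt_or_eq with hk | rfl
          · rw [Function.update_of_ne (hlt k (by omega)),
              Function.update_of_ne (hlt k (by omega))]
            exact h1 k (by omega)
          · rwa [Function.update_self, Function.update_self]
        · intro h1
          refine ⟨fun k hk => ?_, ?_⟩
          · have := h1 k (by omega)
            rwa [Function.update_of_ne (hlt k (by omega)),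
              Function.update_of_ne (hlt k (by omega))] at this
          · have := h1 _ le_rfl
            rwa [Function.update_self, Function.update_self] at this

end RealRAM

/-! ### Splitting the cost at a block of links -/

namespace Profile

variable {P : Profile} {a x i j p q : ℕ} {u z acc G v₁ v₂ : ℝ}

variable (P) in
/-- The largest inverse capacity on the links `i, …, q - 1`. -/
noncomputable def gmax (i q : ℕ) : ℝ := (Finset.Ico i q).fold max 0 P.γ

theorem gmax_le_iff : P.gmax i q ≤ u ↔ 0 ≤ u ∧ ∀ j, i ≤ j → j < q → P.γ j ≤ u := by
  simp [gmax, Finset.fold_max_le]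

theorem gmax_nonneg : 0 ≤ P.gmax i q := (gmax_le_iff.1 le_rfl).1

theorem le_gmax (h1 : i ≤ j) (h2 : j < q) : P.γ j ≤ P.gmax i q := (gmax_le_iff.1 le_rfl).2 j h1 h2

theorem gmax_self : P.gmax i i = 0 := by simp [gmax]

/-- The initial value `0` of the fold is never attained on a nonempty range, as inverse capacities
are positive. -/
theorem exists_eq_gmax (h : i < q) : ∃ j, i ≤ j ∧ j < q ∧ P.gmax i q = P.γ j := by
  by_contra hne
  push Not at hne
  have h1 : P.gmax i q ∈ (insert 0 ((Finset.Ico i q).image P.γ) : Finset ℝ) := by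
    unfold gmax
    induction Finset.Ico i q using Finset.induction_on with
    | empty => simp
    | insert k s hk ih =>
      rw [Finset.fold_insert hk]
      rcases max_choice (P.γ k) (s.fold max 0 P.γ) with h | h <;> rw [h]
      · simp
      · simp only [Finset.image_insert, Finset.mem_insert] at ih ⊢
        tauto
  rw [Finset.mem_insert, Finset.mem_image] at h1
  rcases h1 with h1 | ⟨j, hj, h1⟩
  · have := P.γ_pos i
    have := le_gmax (P := P) le_rfl h
    linarith
  · rw [Finset.mem_Ico] at hj
    exact hne j hj.1 hj.2 h1.symm

theorem gmax_union (h1 : i ≤ j) (h2 : j ≤ q) : P.gmax i q = max (P.gmax i j) (P.gmax j q) := by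
  refine le_antisymm (gmax_le_iff.2 ⟨le_max_of_le_left gmax_nonneg, fun k h3 h4 => ?_⟩)
    (max_le (gmax_le_iff.2 ⟨gmax_nonneg, fun k h3 h4 => le_gmax h3 (h4.trans_le h2)⟩)
      (gmax_le_iff.2 ⟨gmax_nonneg, fun k h3 h4 => le_gmax (h1.trans h3) h4⟩))
  rcases lt_or_ge k j with h5 | h5
  · exact le_max_of_le_left (le_gmax h3 h5)
  · exact le_max_of_le_right (le_gmax h5 h4)

theorem gmax_succ_left (h : i < q) : P.gmax i q = max (P.γ i) (P.gmax (i + 1) q) := by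
  rw [gmax_union (Nat.le_succ i) h]
  congr 1
  simp only [gmax, Nat.Ico_succ_singleton, Finset.fold_singleton]
  exact max_eq_left (P.γ_pos i).le

theorem gmax_pos (h : i < q) : 0 < P.gmax i q := (P.γ_pos i).trans_le (le_gmax le_rfl h)

variable (P) in
/-- The partial maximum `acc` and the inverse capacity `G` that are known after the links
`e, …, x - 1` have been taken into account for the cost from `a` to `x`. -/
structure Partial (a x e : ℕ) (acc G : ℝ) : Prop where
  acc_le_iff : ∀ u, acc ≤ u ↔ -P.D x ≤ u ∧ ∀ i j, e ≤ i → i ≤ j → j < x →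
    (P.W (i + 1) - P.W a) * P.γ j - P.D i ≤ u
  gmax_eq : G = P.gmax e x

theorem Partial.start : P.Partial a x x (-P.D x) 0 :=
  ⟨fun _ => ⟨fun h => ⟨h, fun _ _ _ _ _ => by omega⟩, fun h => h.1⟩, gmax_self.symm⟩

theorem Partial.cost_eq (h : P.Partial a x a acc G) : acc + P.D x = P.cost a x := by
  have key : ∀ u, acc + P.D x ≤ u ↔ P.cost a x ≤ u := by
    intro u
    rw [← le_sub_iff_add_le, h.acc_le_iff, cost_le_iff]
    refine and_congr (by constructor <;> intro h <;> linarith) ?_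
    refine forall₂_congr fun i j => forall₃_congr fun _ _ _ => ?_
    constructor <;> intro h <;> linarith
  exact le_antisymm ((key _).2 le_rfl) ((key _).1 le_rfl)

/-- For `i` in the block, a link `j` in the block matters only through `gmax i q`, which gives a
line evaluated at `-W a`; a link `j` beyond the block matters only through `G`, which gives a line
evaluated at `G` and shifted by `W a * G`. Both families of lines are independent of `a` and `x`.
The additional bound `z` is harmless because `-D x` already belongs to the maximum. -/
theorem Partial.step (h : P.Partial a x q acc G) (hz : z ≤ -P.D x) (hap : a ≤ p) (hpq : p ≤ q)
    (hqx : q ≤ x)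
    (h₁ : ∀ u, v₁ ≤ u ↔ z ≤ u ∧ ∀ i, p ≤ i → i < q →
      P.gmax i q * (0 - P.W a) + (P.W (i + 1) * P.gmax i q - P.D i) ≤ u)
    (h₂ : ∀ u, v₂ ≤ u ↔ z ≤ u ∧ ∀ i, p ≤ i → i < q → P.W (i + 1) * G + (0 - P.D i) ≤ u) :
    P.Partial a x p (max (max acc v₁) (v₂ - P.W a * G)) (max G (P.gmax p q)) := by
  have hG : 0 ≤ G := by rw [h.gmax_eq]; exact gmax_nonneg
  have hWG := mul_nonneg (P.W_nonneg a) hG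
  refine ⟨fun u => ?_, by rw [h.gmax_eq, gmax_union hpq hqx, max_comm]⟩
  rw [max_le_iff, max_le_iff, h.acc_le_iff, h₁, sub_le_iff_le_add, h₂]
  constructor
  · rintro ⟨⟨⟨h1, h2⟩, -, h3⟩, -, h4⟩
    refine ⟨h1, fun i j hi hij hj => ?_⟩
    rcases lt_or_ge i q with hiq | hiq
    · have hw := (weight_pos (P := P) (hap.trans hi)).le
      rcases lt_or_ge j q with hjq | hjq
      · have h5 := mul_le_mul_of_nonneg_left (le_gmax (P := P) hij hjq) hw
        have h6 := h3 i hi hiq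
        linarith
      · have h5 := mul_le_mul_of_nonneg_left (le_gmax (P := P) hjq hj) hw
        have h6 := h4 i hi hiq
        rw [← h.gmax_eq] at h5
        linarith
    · exact h2 i j hiq hij hj
  · rintro ⟨h1, h2⟩
    have h3 : ∀ i, p ≤ i → i < q → (P.W (i + 1) - P.W a) * P.gmax i q - P.D i ≤ u := by
      intro i hi hiq
      obtain ⟨j, hij, hjq, hj⟩ := exists_eq_gmax (P := P) hiq
      rw [hj]
      exact h2 i j hi hij (hjq.trans_le hqx)
    refine ⟨⟨⟨h1, fun i j hi => h2 i j (hpq.trans hi)⟩, hz.trans h1, fun i hi hiq => ?_⟩,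
      by linarith, fun i hi hiq => ?_⟩
    · linarith [h3 i hi hiq]
    -- If no link lies beyond the block, then `G = 0` and the second family only contributes `-D i`,
    -- which the first one dominates.
    · rcases hqx.eq_or_lt with rfl | hlt
      · have h4 := mul_nonneg (weight_pos (P := P) (hap.trans hi)).le
          (gmax_nonneg (P := P) (i := i) (q := q))
        rw [h.gmax_eq, gmax_self]
        linarith [h3 i hi hiq]
      · obtain ⟨j, hij, hjx, hj⟩ := exists_eq_gmax (P := P) hlt
        have := h2 i j hi (hiq.le.trans hij) hjx
        rw [h.gmax_eq, hj]
        linarith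

end Profile

/-! ### Evaluating a cost from the envelopes of dyadic blocks -/

namespace RealRAM

/-- The arrays `na`, `ra` contain, at the offset `o`, the two upper envelopes and the largest
inverse capacity for the links `p, …, q - 1`. -/
structure BlockAt (P : Profile) (z : ℝ) (na : ℕ → ℕ → ℕ) (ra : ℕ → ℕ → ℝ) (o p q : ℕ) :
    Prop where
  hull₁ : IsHull (ra 13) (ra 14) o (na 10 o)
  hull₂ : IsHull (ra 15) (ra 16) o (na 11 o)
  size₁ : na 10 o ≤ q - p
  size₂ : na 11 o ≤ q - p
  env₁ : ∀ y u, (∀ k ≤ na 10 o, ra 13 (o + k) * y + ra 14 (o + k) ≤ u) ↔ z ≤ u ∧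
    ∀ i, p ≤ i → i < q → P.gmax i q * y + (P.W (i + 1) * P.gmax i q - P.D i) ≤ u
  env₂ : ∀ y u, (∀ k ≤ na 11 o, ra 15 (o + k) * y + ra 16 (o + k) ≤ u) ↔ z ≤ u ∧
    ∀ i, p ≤ i → i < q → P.W (i + 1) * y + (0 - P.D i) ≤ u
  gmax : ra 17 o = P.gmax p q

/-- The arrays `na`, `ra` contain the profile `P` and the data for all dyadic blocks of links up to
`M`. -/
structure Tree (P : Profile) (M S : ℕ) (na : ℕ → ℕ → ℕ) (ra : ℕ → ℕ → ℝ) : Prop where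
  W : ∀ i ≤ M, ra 10 i = P.W i
  D : ∀ i ≤ M, ra 11 i = P.D i
  block : ∀ h r, (r + 1) * 2 ^ h ≤ M →
    BlockAt P (0 - P.D M) na ra (h * S + (r * 2 ^ h + r * 2 ^ h)) (r * 2 ^ h) ((r + 1) * 2 ^ h)

/-- Take the block at the offset `nreg 26` into account. -/
def useBlock : Cmd :=
  .nset 28 (.arr 10 (.reg 26)) ;;
  .rset 22 (0 - .arr 10 (.reg 20)) ;;
  query 13 14 ;;
  maxInto 20 (.reg 23) ;;
  .nset 28 (.arr 11 (.reg 26)) ;;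
  .rset 22 (.reg 21) ;;
  query 15 16 ;;
  maxInto 20 (.reg 23 - .arr 10 (.reg 20) * .reg 21) ;;
  maxInto 21 (.arr 17 (.reg 26))

/-- The two queries supply exactly the two maxima that `Profile.Partial.step` combines. The second
one must precede the update of register `21`, since it uses the capacities strictly to the right of
the block. -/
theorem useBlock_halts {P : Profile} {z : ℝ} {σ : Mem} {o p q a x L : ℕ}
    (hB : BlockAt P z σ.narr σ.rarr o p q) (ho : σ.nreg 26 = o) (ha : σ.nreg 20 = a)
    (hW : σ.rarr 10 a = P.W a) (hP : P.Partial a x q (σ.rreg 20) (σ.rreg 21))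
    (hz : z ≤ -P.D x) (hap : a ≤ p) (hpq : p ≤ q) (hqx : q ≤ x) (hL : q < 2 ^ L) :
    Halts useBlock σ (100 * L + 200) fun σ' => P.Partial a x p (σ'.rreg 20) (σ'.rreg 21) := by
  unfold useBlock Halts
  simp only [wp_seq, wp_nset, wp_rset]
  refine ⟨by simp, by simp, ?_⟩
  refine (query_halts 13 14 (o := o) (s := σ.narr 10 o) (y := 0 - P.W a) (L := L) (by simp [ho])
    (by simp [ho]) (by simp [ha, hW]) (by have := hB.size₁; omega)
    (by simpa using hB.hull₁)).wp (by simp; omega) ?_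
  intro σ₁ T₁ hs₁ hq₁ hT₁
  have n20 : σ₁.nreg 20 = a := by rw [hs₁.n _ rfl]; simp [ha]
  have n26 : σ₁.nreg 26 = o := by rw [hs₁.n _ rfl]; simp [ho]
  have r20 : σ₁.rreg 20 = σ.rreg 20 := by rw [hs₁.r _ rfl]; simp
  have r21 : σ₁.rreg 21 = σ.rreg 21 := by rw [hs₁.r _ rfl]; simp
  have na : σ₁.narr = σ.narr := by funext A; rw [hs₁.na A rfl]; rfl
  have ra : σ₁.rarr = σ.rarr := by funext A; rw [hs₁.ra A rfl]; rfl
  simp only [Mem.setR_rarr, Mem.setN_rarr, hB.env₁] at hq₁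
  simp only [NExp.cost_arr, NExp.cost_reg, RExp.cost_sub, RExp.cost_arr, RExp.cost_zero] at hT₁
  refine WP.maxInto (by simp; omega) fun T₂ hT₂ => ?_
  simp only [RExp.cost_reg] at hT₂
  simp only [RExp.eval_reg]
  refine ⟨by simp; omega, by simp; omega, ?_⟩
  refine (query_halts 15 16 (o := o) (s := σ.narr 11 o) (y := σ.rreg 21) (L := L)
    (by simp [n26]) (by simp [n26, na]) (by simp [r21]) (by have := hB.size₂; omega)
    (by simpa [ra] using hB.hull₂)).wp (by simp; omega) ?_
  intro σ₃ T₃ hs₃ hq₃ hT₃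
  have n20' : σ₃.nreg 20 = a := by rw [hs₃.n _ rfl]; simp [n20]
  have n26' : σ₃.nreg 26 = o := by rw [hs₃.n _ rfl]; simp [n26]
  have r20' : σ₃.rreg 20 = max (σ.rreg 20) (σ₁.rreg 23) := by rw [hs₃.r _ rfl]; simp [r20]
  have r21' : σ₃.rreg 21 = σ.rreg 21 := by rw [hs₃.r _ rfl]; simp [r21]
  have ra' : σ₃.rarr = σ.rarr := by funext A; rw [hs₃.ra A rfl]; simp [ra]
  simp only [Mem.setR_rarr, Mem.setN_rarr, ra, hB.env₂] at hq₃
  simp only [NExp.cost_arr, NExp.cost_reg, RExp.cost_reg] at hT₃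
  have hres := hP.step hz hap hpq hqx hq₁ hq₃
  rw [← hB.gmax] at hres
  refine WP.maxInto (by simp; omega) fun T₄ hT₄ => ?_
  simp only [RExp.cost_sub, RExp.cost_mul, RExp.cost_arr, NExp.cost_reg, RExp.cost_reg] at hT₄
  refine WP.maxInto (by simp; omega) fun T₅ hT₅ => ?_
  simpa [n20', n26', r20', r21', ra', hW] using hres

/-- Take the block of the length `nreg 24` that ends at `nreg 22` into account. -/
def takeBlock : Cmd :=
  .nset 22 (.reg 22 - .reg 24) ;;
  .nset 26 (.reg 25 + (.reg 22 + .reg 22)) ;;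
  useBlock

/-- Compute in `rreg 20` the time for evacuating the vertices `nreg 20`, …, `nreg 21 - 1` to the
vertex `nreg 21`. -/
def evalCost : Cmd :=
  .nset 22 (.reg 21) ;; .nset 23 (.reg 21) ;; .nset 24 1 ;; .nset 25 0 ;;
  .rset 20 (0 - .arr 11 (.reg 21)) ;; .rset 21 0 ;;
  .loop (.nle (.reg 20 + .reg 24) (.reg 22))
    (.ite (.nlt (.half (.reg 23) + .half (.reg 23)) (.reg 23)) takeBlock .skip ;;
     .nset 23 (.half (.reg 23)) ;; .nset 24 (.reg 24 + .reg 24) ;; .nset 25 (.reg 25 + .reg 4)) ;;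
  .loop (.nle 2 (.reg 24))
    (.nset 24 (.half (.reg 24)) ;; .nset 25 (.reg 25 - .reg 4) ;;
     .ite (.nle (.reg 20 + .reg 24) (.reg 22)) takeBlock .skip) ;;
  .rset 20 (.reg 20 + .arr 11 (.reg 21))

/-- The state of `evalCost` when the links from `e` on have been taken into account and the current
block length is `2 ^ h`. -/
structure EvalState (P : Profile) (S : ℕ) (na : ℕ → ℕ → ℕ) (ra : ℕ → ℕ → ℝ) (a x h e : ℕ)
    (σ : Mem) : Prop where
  n4 : σ.nreg 4 = S
  n20 : σ.nreg 20 = a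
  n21 : σ.nreg 21 = x
  n22 : σ.nreg 22 = e
  n24 : σ.nreg 24 = 2 ^ h
  n25 : σ.nreg 25 = h * S
  na : σ.narr = na
  ra : σ.rarr = ra
  acc : P.Partial a x e (σ.rreg 20) (σ.rreg 21)

theorem takeBlock_halts {P : Profile} {M S L : ℕ} {na : ℕ → ℕ → ℕ} {ra : ℕ → ℕ → ℝ}
    {a x h r : ℕ} {σ : Mem} (hT : Tree P M S na ra)
    (hσ : EvalState P S na ra a x h ((r + 1) * 2 ^ h) σ) (hax : a ≤ r * 2 ^ h)
    (he : (r + 1) * 2 ^ h ≤ x) (hxM : x ≤ M) (hL : M < 2 ^ L) :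
    Halts takeBlock σ (100 * L + 220) (EvalState P S na ra a x h (r * 2 ^ h)) := by
  obtain ⟨n4, n20, n21, n22, n24, n25, hna, hra, acc⟩ := hσ
  have e1 : (r + 1) * 2 ^ h - 2 ^ h = r * 2 ^ h := by rw [add_mul, one_mul, Nat.add_sub_cancel]
  have e2 : r * 2 ^ h ≤ (r + 1) * 2 ^ h := Nat.mul_le_mul_right _ (Nat.le_succ r)
  unfold takeBlock Halts
  simp only [wp_seq, wp_nset]
  refine ⟨by simp, by simp, ?_⟩
  have hB := hT.block h r (he.trans hxM)
  rw [← hna, ← hra] at hB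
  have hz : 0 - P.D M ≤ -P.D x := by have := P.D_mono hxM; linarith
  refine (useBlock_halts (P := P) (a := a) (x := x) (L := L) (by simpa using hB)
    (by simp [n22, n24, n25, e1]) (by simp [n20])
    (by simpa [hra] using hT.W a (hax.trans (e2.trans (he.trans hxM)))) (by simpa using acc)
    hz hax e2 he (by omega)).wp (by simp) ?_
  intro σ₁ T₁ hs hp _
  refine ⟨?_, ?_, ?_, ?_, ?_, ?_, ?_, ?_, hp⟩
  · rw [hs.n _ rfl]; simp [n4]
  · rw [hs.n _ rfl]; simp [n20]
  · rw [hs.n _ rfl]; simp [n21]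
  · rw [hs.n _ rfl]; simp [n22, n24, e1]
  · rw [hs.n _ rfl]; simp [n24]
  · rw [hs.n _ rfl]; simp [n25]
  · funext A; rw [hs.na A rfl]; simp [hna]
  · funext A; rw [hs.ra A rfl]; simp [hra]

/-- The interval is consumed from the right, because a block needs the bottleneck of all links after
it. Block lengths first grow, then shrink, so at most `2 * L` blocks are taken, each with two binary
searches. -/
theorem evalCost_halts {P : Profile} {M S L : ℕ} {σ : Mem} {a x : ℕ}
    (hT : Tree P M S σ.narr σ.rarr) (h4 : σ.nreg 4 = S) (h20 : σ.nreg 20 = a)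
    (h21 : σ.nreg 21 = x) (hax : a ≤ x) (hxM : x ≤ M) (hL : M < 2 ^ L) :
    Halts evalCost σ (2 * L * (100 * L + 300) + 100) fun σ' => σ'.rreg 20 = P.cost a x := by
  unfold evalCost Halts
  set na := σ.narr with hna
  set ra := σ.rarr with hra
  obtain ⟨K, hK⟩ : ∃ K, K = 100 * L + 300 := ⟨_, rfl⟩
  rw [← hK, show 2 * L * K = L * K + L * K by ring]
  simp only [wp_seq, wp_nset, wp_rset, NExp.cost_reg, NExp.cost_one, NExp.cost_zero,
    RExp.cost_sub, RExp.cost_zero, RExp.cost_arr]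
  refine ⟨by omega, by omega, by omega, by omega, by omega, by omega, ?_⟩
  -- The part still to be treated ends at the multiple `r * 2 ^ h`. If `r` is odd, taking the block
  -- before this point makes the end a multiple of the next power of two.
  refine WP.loop (fun σ' T => ∃ h r, EvalState P S na ra a x h (r * 2 ^ h) σ' ∧
    σ'.nreg 23 = r ∧ a ≤ r * 2 ^ h ∧ r * 2 ^ h ≤ x ∧ h ≤ L ∧
    (L - h) * K + L * K + 60 ≤ T) ?_ ?_
  · refine ⟨0, x, ⟨by simp [h4], by simp [h20], by simp [h21], by simp [h21], by simp, by simp,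
      rfl, rfl, ?_⟩, by simp [h21], by simpa using hax, by simp, Nat.zero_le _,
      by rw [Nat.sub_zero]; omega⟩
    have := Profile.Partial.start (P := P) (a := a) (x := x)
    simpa [h21, ← hra, hT.D x hxM] using this
  · rintro σ' T ⟨h, r, hσ, h23, hae, hex, hhL, hTb⟩
    refine ⟨by simp; omega, fun hc => ?_, fun hc => ?_⟩
    · simp only [BExp.eval_nle, NExp.eval_add, NExp.eval_reg, hσ.n20, hσ.n22, hσ.n24] at hc
      have hlt : h < L := (Nat.pow_lt_pow_iff_right (a := 2) (by norm_num)).1 (by omega)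
      have e1 : (L - h) * K = (L - (h + 1)) * K + K := by
        rw [show L - h = L - (h + 1) + 1 by omega, add_mul, one_mul]
      rw [wp_seq, wp_ite]
      have fin : ∀ σ₁ T₁, EvalState P S na ra a x h (r / 2 * 2 ^ (h + 1)) σ₁ → σ₁.nreg 23 = r →
          a ≤ r / 2 * 2 ^ (h + 1) → T ≤ T₁ + K - 50 →
          WP (.nset 23 (.half (.reg 23)) ;; .nset 24 (.reg 24 + .reg 24) ;;
            .nset 25 (.reg 25 + .reg 4)) σ₁ T₁ fun σ' T => ∃ h r,
              EvalState P S na ra a x h (r * 2 ^ h) σ' ∧ σ'.nreg 23 = r ∧ a ≤ r * 2 ^ h ∧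
              r * 2 ^ h ≤ x ∧ h ≤ L ∧ (L - h) * K + L * K + 60 ≤ T := by
        intro σ₁ T₁ hσ₁ h23' hae' hT₁
        simp only [wp_seq, wp_nset, NExp.cost_half, NExp.cost_reg, NExp.cost_add]
        refine ⟨by omega, by omega, by omega, h + 1, r / 2, ?_, by simp [h23'], hae', ?_, hlt,
          by omega⟩
        · refine ⟨by simp [hσ₁.n4], by simp [hσ₁.n20], by simp [hσ₁.n21], by simp [hσ₁.n22],
            ?_, ?_, by simp [hσ₁.na], by simp [hσ₁.ra], by simpa using hσ₁.acc⟩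
          · simp [hσ₁.n24, pow_succ]; ring
          · simp [hσ₁.n25, hσ₁.n4]; ring
        · refine le_trans ?_ hex
          rw [pow_succ, mul_comm _ 2, ← mul_assoc]
          exact Nat.mul_le_mul_right _ (by omega)
      refine ⟨by simp; omega, fun hodd => ?_, fun hodd => ?_⟩
      · simp only [BExp.eval_nlt, NExp.eval_add, NExp.eval_half, NExp.eval_reg, h23] at hodd
        obtain ⟨r', rfl⟩ : ∃ r', r = r' + 1 := ⟨r - 1, by omega⟩
        have e2 : r' * 2 ^ h = (r' + 1) / 2 * 2 ^ (h + 1) := by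
          rw [pow_succ, mul_comm _ 2, ← mul_assoc]; congr 1; omega
        have e3 : (r' + 1) * 2 ^ h = r' * 2 ^ h + 2 ^ h := by ring
        refine (takeBlock_halts hT hσ (by omega) hex hxM hL).wp (by simp; omega) ?_
        intro σ₁ T₁ hs hσ₁ hT₁
        simp at hT₁
        rw [e2] at hσ₁
        exact fin σ₁ T₁ hσ₁ (by rw [hs.n _ rfl, h23]) (by omega) (by omega)
      · simp only [BExp.eval_nlt, NExp.eval_add, NExp.eval_half, NExp.eval_reg, h23] at hodd
        have e2 : r * 2 ^ h = r / 2 * 2 ^ (h + 1) := by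
          rw [pow_succ, mul_comm _ 2, ← mul_assoc]; congr 1; omega
        rw [e2] at hσ
        rw [wp_skip]
        exact ⟨by simp; omega, fin _ _ hσ h23 (by omega) (by simp; omega)⟩
    · simp only [BExp.eval_nle, NExp.eval_add, NExp.eval_reg, hσ.n20, hσ.n22, hσ.n24] at hc
      have hKL : h * K ≤ L * K := Nat.mul_le_mul_right _ hhL
      -- From now on less than one block of the current length remains, so every smaller length is
      -- used at most once.
      refine WP.loop (fun σ' T => ∃ h r, EvalState P S na ra a x h (r * 2 ^ h) σ' ∧
        a ≤ r * 2 ^ h ∧ r * 2 ^ h < a + 2 ^ h ∧ r * 2 ^ h ≤ x ∧ h * K + 40 ≤ T) ?_ ?_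
      · exact ⟨h, r, hσ, hae, by omega, hex, by simp; omega⟩
      · clear hσ hc hTb hKL hhL hae hex h23
        rintro σ' T ⟨h, r, hσ, hae, hlt, hex, hTb⟩
        refine ⟨by simp; omega, fun hc => ?_, fun hc => ?_⟩
        · simp only [BExp.eval_nle, NExp.eval_two, NExp.eval_reg, hσ.n24] at hc
          obtain ⟨h, rfl⟩ : ∃ h', h = h' + 1 := by
            refine ⟨h - 1, ?_⟩
            have : h ≠ 0 := by rintro rfl; simp at hc
            omega
          have e1 : (h + 1) * K = h * K + K := by ring
          have e2 : r * 2 ^ (h + 1) = r * 2 * 2 ^ h := by rw [pow_succ]; ring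
          have e3 : 2 ^ (h + 1) = 2 ^ h + 2 ^ h := by rw [pow_succ]; ring
          have e4 : (h + 1) * S - S = h * S := by rw [add_mul, one_mul, Nat.add_sub_cancel]
          rw [e2] at hσ hae hlt hex
          simp only [wp_seq, wp_nset, wp_ite]
          have hσ₁ : EvalState P S na ra a x h (r * 2 * 2 ^ h) ((σ'.setN 24 (2 ^ h)).setN 25
              (h * S)) :=
            ⟨by simp [hσ.n4], by simp [hσ.n20], by simp [hσ.n21], by simp [hσ.n22], by simp,
              by simp, by simp [hσ.na], by simp [hσ.ra], by simpa using hσ.acc⟩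
          have e5 : (2 ^ h + 2 ^ h) / 2 = 2 ^ h := by omega
          simp only [NExp.eval_half, NExp.eval_reg, hσ.n24, e3, e5, NExp.eval_sub,
            Mem.setN_nreg, hσ.n25, hσ.n4]
          norm_num only
          rw [if_false, if_false, e4]
          refine ⟨by simp; omega, by simp; omega, by simp; omega, fun hc' => ?_, fun hc' => ?_⟩
          · simp only [BExp.eval_nle, NExp.eval_add, NExp.eval_reg, hσ₁.n20, hσ₁.n22,
              hσ₁.n24] at hc'
            obtain ⟨r', hr'⟩ : ∃ r', r * 2 = r' + 1 := by
              refine ⟨r * 2 - 1, ?_⟩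
              have : r * 2 ≠ 0 := by
                intro h0
                rw [h0] at hc'
                have := Nat.two_pow_pos h
                omega
              omega
            rw [hr'] at hσ₁ hc' hex hlt
            have e6 : (r' + 1) * 2 ^ h = r' * 2 ^ h + 2 ^ h := by ring
            refine (takeBlock_halts hT hσ₁ (by omega) hex hxM hL).wp (by simp; omega) ?_
            intro σ₂ T₂ _ hσ₂ hT₂
            simp at hT₂
            exact ⟨h, r', hσ₂, by omega, by omega, by omega, by omega⟩
          · simp only [BExp.eval_nle, NExp.eval_add, NExp.eval_reg, hσ₁.n20, hσ₁.n22,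
              hσ₁.n24] at hc'
            rw [wp_skip]
            exact ⟨by simp; omega, h, r * 2, hσ₁, hae, by omega, hex, by simp; omega⟩
        · simp only [BExp.eval_nle, NExp.eval_two, NExp.eval_reg, hσ.n24] at hc
          have h0 : h = 0 := by
            by_contra hne
            have := Nat.pow_le_pow_right (show 0 < 2 by norm_num) (Nat.one_le_iff_ne_zero.2 hne)
            omega
          subst h0
          have hra' : r = a := by simp at hae hlt; omega
          subst hra'
          have hacc := hσ.acc
          rw [pow_zero, mul_one] at hacc
          rw [← hacc.cost_eq]
          refine ⟨by simp; omega, ?_⟩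
          simp [hσ.n21, hσ.ra, hT.D x hxM]

end RealRAM

/-! ### Computing the doubled path and the two envelopes of a block -/

namespace RealRAM

/-- Compute the doubled path. -/
def setup : Cmd :=
  .nset 3 (.reg 0 + .reg 0) ;; .nset 4 (.reg 3 + .reg 3) ;;
  .ite (.nle (.reg 1) (.reg 0)) (.nset 2 (.reg 1)) (.nset 2 (.reg 0)) ;;
  .nset 40 0 ;;
  .loop (.nlt (.reg 40) (.reg 3))
    (.ite (.nlt (.reg 40) (.reg 0)) (.nset 41 (.reg 40) ;; .nset 42 (.reg 40))
      (.nset 41 (.reg 3 - 1 - .reg 40) ;; .nset 42 (.reg 3 - 2 - .reg 40)) ;;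
     .rstore 10 (.reg 40 + 1) (.arr 10 (.reg 40) + .arr 0 (.reg 41)) ;;
     .rstore 11 (.reg 40 + 1) (.arr 11 (.reg 40) + .reg 0 * .arr 1 (.reg 42)) ;;
     .nset 40 (.reg 40 + 1) ;;
     .ite (.rlt 0 (.arr 2 (.reg 42))) (.rstore 12 (.reg 40 - 1) (1 / .arr 2 (.reg 42)))
      (.rstore 12 (.reg 40 - 1) 1))

theorem setup_halts (N : DynamicPath) (k : ℕ) :
    Halts setup (input N k) (200 * N.n + 100) fun σ' => σ'.nreg 2 = min k N.n ∧
      σ'.nreg 3 = N.n + N.n ∧ σ'.nreg 4 = N.n + N.n + (N.n + N.n) ∧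
      (∀ i ≤ N.n + N.n, σ'.rarr 10 i = N.profile.W i) ∧
      (∀ i ≤ N.n + N.n, σ'.rarr 11 i = N.profile.D i) ∧
      ∀ i < N.n + N.n, σ'.rarr 12 i = N.profile.γ i := by
  unfold setup Halts
  simp only [wp_seq]
  have i0 : (input N k).nreg 0 = N.n := rfl
  have i1 : (input N k).nreg 1 = k := rfl
  rw [wp_nset]
  refine ⟨by simp, ?_⟩
  rw [wp_nset]
  refine ⟨by simp, ?_⟩
  simp only [NExp.eval_add, NExp.eval_reg, i0, Mem.setN_nreg, reduceIte]
  have h2 : Halts (.ite (.nle (.reg 1) (.reg 0)) (.nset 2 (.reg 1)) (.nset 2 (.reg 0)))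
      (((input N k).setN 3 (N.n + N.n)).setN 4 (N.n + N.n + (N.n + N.n))) 10
      fun σ' => σ'.nreg 2 = min k N.n := by
    simp [Halts, i0, i1]
    omega
  refine h2.wp (by simp) ?_
  clear h2
  intro σ T hs h2 hT
  have n0 : σ.nreg 0 = N.n := by rw [hs.n _ rfl]; simp [i0]
  have n3 : σ.nreg 3 = N.n + N.n := by rw [hs.n _ rfl]; simp
  have n4 : σ.nreg 4 = N.n + N.n + (N.n + N.n) := by rw [hs.n _ rfl]; simp
  have ra : σ.rarr = (input N k).rarr := by funext A; rw [hs.ra A rfl]; simp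
  have rr : σ.rreg = (input N k).rreg := by funext A; rw [hs.r A rfl]; simp
  have a0 : σ.rarr 0 = N.w := by rw [ra]; rfl
  have a1 : σ.rarr 1 = N.l := by rw [ra]; rfl
  have a2 : σ.rarr 2 = N.c := by rw [ra]; rfl
  have a10 : σ.rarr 10 0 = 0 := by rw [ra]; rfl
  have a11 : σ.rarr 11 0 = 0 := by rw [ra]; rfl
  have r0 : σ.rreg 0 = N.τ := by rw [rr]; rfl
  simp only [NExp.cost_add, NExp.cost_reg] at hT
  clear hs ra rr
  rw [wp_nset]
  refine ⟨by simp; omega, ?_⟩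
  refine WP.loop (fun σ' T => ∃ i, σ'.nreg 40 = i ∧ i ≤ N.n + N.n ∧ σ'.nreg 0 = N.n ∧
    σ'.nreg 2 = min k N.n ∧ σ'.nreg 3 = N.n + N.n ∧ σ'.nreg 4 = N.n + N.n + (N.n + N.n) ∧
    σ'.rreg 0 = N.τ ∧ σ'.rarr 0 = N.w ∧ σ'.rarr 1 = N.l ∧ σ'.rarr 2 = N.c ∧
    (∀ j ≤ i, σ'.rarr 10 j = N.profile.W j) ∧ (∀ j ≤ i, σ'.rarr 11 j = N.profile.D j) ∧
    (∀ j < i, σ'.rarr 12 j = N.profile.γ j) ∧ 100 * (N.n + N.n - i) + 20 ≤ T) ?_ ?_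
  · refine ⟨0, by simp, Nat.zero_le _, by simpa, by simpa, by simpa, by simpa, by simpa, by simpa,
      by simpa, by simpa, ?_, ?_, by simp, by simp; omega⟩
    · intro j hj
      obtain rfl : j = 0 := by omega
      simp [a10, DynamicPath.profile]
    · intro j hj
      obtain rfl : j = 0 := by omega
      simp [a11, DynamicPath.profile]
  · clear n0 n3 n4 a0 a1 a2 a10 a11 r0 h2 hT
    rintro σ T ⟨i, n40, hi, n0, n2, n3, n4, r0, a0, a1, a2, hW, hD, hγ, hT⟩
    refine ⟨by simp; omega, fun hc => ?_, fun hc => ?_⟩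
    · simp only [BExp.eval_nlt, NExp.eval_reg, n40, n3] at hc
      simp only [wp_seq]
      have hite : Halts (.ite (.nlt (.reg 40) (.reg 0)) (.nset 41 (.reg 40) ;; .nset 42 (.reg 40))
          (.nset 41 (.reg 3 - 1 - .reg 40) ;; .nset 42 (.reg 3 - 2 - .reg 40))) σ 24
          fun σ' => σ'.nreg 41 = N.dv i ∧ σ'.nreg 42 = N.de i := by
        simp [Halts, n40, n0, n3, DynamicPath.dv, DynamicPath.de]
        constructor
        · intro h; simp [h]
        · intro h; simp [not_lt.2 h]
      refine hite.wp (by simp; omega) ?_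
      clear hite
      rintro σ₁ T₁ hs ⟨h41, h42⟩ hT₁
      simp only [BExp.cost_nlt, NExp.cost_reg] at hT₁
      rw [wp_rstore]
      refine ⟨by simp; omega, ?_⟩
      rw [wp_rstore]
      refine ⟨by simp; omega, ?_⟩
      rw [wp_nset]
      refine ⟨by simp; omega, ?_⟩
      have m40 : σ₁.nreg 40 = i := by rw [hs.n _ rfl, n40]
      have m0 : σ₁.nreg 0 = N.n := by rw [hs.n _ rfl, n0]
      have m2 : σ₁.nreg 2 = min k N.n := by rw [hs.n _ rfl, n2]
      have m3 : σ₁.nreg 3 = N.n + N.n := by rw [hs.n _ rfl, n3]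
      have m4 : σ₁.nreg 4 = N.n + N.n + (N.n + N.n) := by rw [hs.n _ rfl, n4]
      have q0 : σ₁.rreg 0 = N.τ := by rw [hs.r _ rfl, r0]
      have b0 : σ₁.rarr 0 = N.w := by rw [hs.ra _ rfl, a0]
      have b1 : σ₁.rarr 1 = N.l := by rw [hs.ra _ rfl, a1]
      have b2 : σ₁.rarr 2 = N.c := by rw [hs.ra _ rfl, a2]
      have b10 : σ₁.rarr 10 = σ.rarr 10 := hs.ra _ rfl
      have b11 : σ₁.rarr 11 = σ.rarr 11 := hs.ra _ rfl
      have b12 : σ₁.rarr 12 = σ.rarr 12 := hs.ra _ rfl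
      simp only [NExp.eval_add, NExp.eval_reg, NExp.eval_one, RExp.eval_add, RExp.eval_arr,
        RExp.eval_mul, RExp.eval_reg, Mem.stR_nreg, Mem.stR_rreg, Mem.stR_rarr, m40, h41, h42, q0,
        b0, b1, b10, b11, NExp.cost_add, NExp.cost_reg, NExp.cost_one, RExp.cost_add,
        RExp.cost_arr, RExp.cost_mul, RExp.cost_reg]
      norm_num only
      simp only [if_false]
      have hγ' : N.profile.γ i = if 0 < N.c (N.de i) then 1 / N.c (N.de i) else 1 := rfl
      have hite : Halts (.ite (.rlt 0 (.arr 2 (.reg 42)))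
          (.rstore 12 (.reg 40 - 1) (1 / .arr 2 (.reg 42))) (.rstore 12 (.reg 40 - 1) 1))
          (((σ₁.stR 10 (i + 1) (σ.rarr 10 i + N.w (N.dv i))).stR 11 (i + 1)
            (σ.rarr 11 i + N.τ * N.l (N.de i))).setN 40 (i + 1)) 20
          fun σ' => σ'.rarr 12 = Function.update (σ.rarr 12) i (N.profile.γ i) := by
        rw [hγ']
        simp [Halts, h42, b2, b12]
        constructor
        · intro h; simp [h]
        · intro h; simp [not_lt.2 h]
      refine hite.wp (by omega) ?_
      clear hite
      intro σ₂ T₂ hs₂ h12 hT₂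
      refine ⟨i + 1, by rw [hs₂.n _ rfl]; simp, hc, by rw [hs₂.n _ rfl]; simpa,
        by rw [hs₂.n _ rfl]; simpa, by rw [hs₂.n _ rfl]; simpa, by rw [hs₂.n _ rfl]; simpa,
        by rw [hs₂.r _ rfl]; simpa, by rw [hs₂.ra _ rfl]; simpa, by rw [hs₂.ra _ rfl]; simpa,
        by rw [hs₂.ra _ rfl]; simpa, fun j hj => ?_, fun j hj => ?_, fun j hj => ?_,
        by simp at hT₂; omega⟩
      · rw [hs₂.ra _ rfl]
        simp only [Mem.setN_rarr, Mem.stR_rarr, b10]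
        rcases hj.lt_or_eq with hj | rfl
        · simpa [Function.update_of_ne (show j ≠ i + 1 by omega)] using hW j (by omega)
        · simp [N.profile_W_succ, hW i le_rfl]
      · rw [hs₂.ra _ rfl]
        simp only [Mem.setN_rarr, Mem.stR_rarr, b11]
        rcases hj.lt_or_eq with hj | rfl
        · simpa [b11, Function.update_of_ne (show j ≠ i + 1 by omega)] using hD j (by omega)
        · simp [N.profile_D_succ, hD i le_rfl]
      · rw [h12]
        rcases (Nat.lt_succ_iff.1 hj).lt_or_eq with hj | rfl
        · rw [Function.update_of_ne (by omega), hγ j hj]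
        · rw [Function.update_self]
    · simp only [BExp.eval_nlt, NExp.eval_reg, n40, n3] at hc
      obtain rfl : i = N.n + N.n := by omega
      exact ⟨n2, n3, n4, hW, hD, hγ⟩

/-- Build the upper envelope of the lines with the slopes `W (i + 1)` for the block
`[nreg 32, nreg 32 + nreg 30)`, at the offset `nreg 35`. -/
def buildHull₂ : Cmd :=
  .nset 34 0 ;; .rstore 15 (.reg 35) 0 ;; .rstore 16 (.reg 35) (0 - .arr 11 (.reg 3)) ;;
  .nset 33 (.reg 32) ;;
  .loop (.nlt (.reg 33) (.reg 32 + .reg 30))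
    (.nset 33 (.reg 33 + 1) ;; .rset 30 (.arr 10 (.reg 33)) ;;
     .rset 31 (0 - .arr 11 (.reg 33 - 1)) ;; push 15 16) ;;
  .nstore 11 (.reg 35) (.reg 34)

/-- The slopes `W (i + 1)` increase with `i`, so pushing from left to right needs no sorting. The
constant line at `-D M` starts the stack; its slope `0` lies below all later slopes, as
`IsHull.first` requires. The term `60 * s` in the invariant is the potential for removals in
`push_wp`. -/
theorem buildHull₂_halts {P : Profile} {σ : Mem} {M o p w : ℕ} (h3 : σ.nreg 3 = M)
    (h30 : σ.nreg 30 = w) (h32 : σ.nreg 32 = p) (h35 : σ.nreg 35 = o) (hpw : p + w ≤ M)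
    (hW : ∀ i ≤ M, σ.rarr 10 i = P.W i) (hD : ∀ i ≤ M, σ.rarr 11 i = P.D i) :
    Halts buildHull₂ σ (200 * w + 200) fun σ' =>
      IsHull (σ'.rarr 15) (σ'.rarr 16) o (σ'.narr 11 o) ∧ σ'.narr 11 o ≤ w ∧
      (∀ y u, (∀ k ≤ σ'.narr 11 o, σ'.rarr 15 (o + k) * y + σ'.rarr 16 (o + k) ≤ u) ↔
        0 - P.D M ≤ u ∧ ∀ i, p ≤ i → i < p + w → P.W (i + 1) * y + (0 - P.D i) ≤ u) ∧
      ∀ k < o, σ'.rarr 15 k = σ.rarr 15 k ∧ σ'.rarr 16 k = σ.rarr 16 k ∧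
        σ'.narr 11 k = σ.narr 11 k := by
  unfold buildHull₂ Halts
  simp only [wp_seq]
  rw [wp_nset]
  refine ⟨by simp, ?_⟩
  rw [wp_rstore]
  refine ⟨by simp, ?_⟩
  rw [wp_rstore]
  refine ⟨by simp, ?_⟩
  rw [wp_nset]
  refine ⟨by simp, ?_⟩
  refine WP.loop (fun σ' T => ∃ i s, σ'.nreg 33 = i ∧ σ'.nreg 34 = s ∧ σ'.nreg 30 = w ∧
    σ'.nreg 32 = p ∧ σ'.nreg 35 = o ∧ p ≤ i ∧ i ≤ p + w ∧ s + p ≤ i ∧ σ'.narr = σ.narr ∧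
    (∀ i ≤ M, σ'.rarr 10 i = P.W i) ∧ (∀ i ≤ M, σ'.rarr 11 i = P.D i) ∧
    (∀ k < o, σ'.rarr 15 k = σ.rarr 15 k ∧ σ'.rarr 16 k = σ.rarr 16 k) ∧
    IsHull (σ'.rarr 15) (σ'.rarr 16) o s ∧ σ'.rarr 15 (o + s) ≤ P.W i ∧ σ'.rarr 15 o = 0 ∧
    (∀ y u, (∀ k ≤ s, σ'.rarr 15 (o + k) * y + σ'.rarr 16 (o + k) ≤ u) ↔
        0 - P.D M ≤ u ∧ ∀ j, p ≤ j → j < i → P.W (j + 1) * y + (0 - P.D j) ≤ u) ∧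
    200 * (p + w - i) + 60 * s + 150 ≤ T) ?_ ?_
  · refine ⟨p, 0, by simp [h32], by simp, by simp [h30], by simp [h32], by simp [h35], le_rfl,
      by omega, by omega, rfl, by simpa using hW, by simpa using hD, fun k hk => ?_, ?_, ?_, ?_,
      fun y u => ?_, by simp⟩
    · have : k ≠ o := hk.ne
      simp [h35, this]
    · exact ⟨fun k hk => by omega, fun hk => by omega, fun k hk => by omega⟩
    · simp [h35, P.W_nonneg p]
    · simp [h35]
    · simp only [Nat.le_zero, forall_eq, add_zero]
      simp [h35, h3, hD M le_rfl]
      intro _ j hj hj'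
      omega
  · rintro σ' T ⟨i, s, n33, n34, n30, n32, n35, hpi, hiw, hsi, na, hW', hD', hlow, hH, htop, hbot,
      henv, hT⟩
    refine ⟨by simp; omega, fun hc => ?_, fun hc => ?_⟩
    · simp only [BExp.eval_nlt, NExp.eval_add, NExp.eval_reg, n33, n32, n30] at hc
      simp only [wp_seq]
      rw [wp_nset]
      refine ⟨by simp; omega, ?_⟩
      rw [wp_rset]
      refine ⟨by simp; omega, ?_⟩
      rw [wp_rset]
      refine ⟨by simp; omega, ?_⟩
      have hWi := hW' (i + 1) (by omega)
      have hDi := hD' i (by omega)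
      refine push_wp (o := o) (s := s) (m := P.W (i + 1)) (b := 0 - P.D i) (by simp [n35])
        (by simp [n34]) (by simp [n33, hWi]) (by simp [n33, hDi]) (by simpa using hH)
        (by simpa using htop.trans (P.W_mono (Nat.lt_succ_self i)).le) ?_ (by simp; omega) ?_
      · have h1 := P.W_mono (Nat.lt_succ_self i)
        have h2 := P.W_nonneg i
        simp only [Nat.succ_eq_add_one] at h1
        simp only [Mem.setR_rarr, Mem.setN_rarr, hbot]
        linarith
      · intro s' T' hss' hT' hH' henv'
        simp only [Mem.setR_rarr, Mem.setN_rarr] at hH' henv'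
        refine ⟨i + 1, s' + 1, by simp [n33], by simp, by simp [n30], by simp [n32], by simp [n35],
          by omega, hc, by omega, by simp [na], by simpa using hW', by simpa using hD',
          fun k hk => ?_, by simpa using hH', by simp, ?_, fun y u => ?_, ?_⟩
        · have : k ≠ o + (s' + 1) := by omega
          simpa [this] using hlow k hk
        · simpa using hbot
        · simp only [Mem.stR_rarr, Mem.setN_rarr, Mem.setR_rarr]
          norm_num only
          rw [if_true, if_false, if_true, if_false, ← henv', henv]
          constructor
          · rintro ⟨⟨h1, h2⟩, h3⟩
            refine ⟨h1, fun j hj hji => ?_⟩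
            rcases (Nat.lt_succ_iff.1 hji).lt_or_eq with hji | rfl
            · exact h2 j hj hji
            · exact h3
          · rintro ⟨h1, h2⟩
            exact ⟨⟨h1, fun j hj hji => h2 j hj (by omega)⟩, h2 i hpi (by omega)⟩
        · simp at hT'
          omega
    · simp only [BExp.eval_nlt, NExp.eval_add, NExp.eval_reg, n33, n32, n30] at hc
      obtain rfl : i = p + w := by omega
      rw [wp_nstore]
      refine ⟨by simp; omega, ?_⟩
      refine ⟨by simpa [n35, n34] using hH, by simp [n35, n34]; omega,
        by simpa [n35, n34] using henv, fun k hk => ?_⟩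
      have : k ≠ o := hk.ne
      simpa [n35, this, na] using hlow k hk

/-- Build the upper envelope of the lines whose slopes are the largest inverse capacities up to the
end of the block `[nreg 32, nreg 32 + nreg 30)`, at the offset `nreg 35`. -/
def buildHull₁ : Cmd :=
  .nset 34 0 ;; .rstore 13 (.reg 35) 0 ;; .rstore 14 (.reg 35) (0 - .arr 11 (.reg 3)) ;;
  .rset 32 0 ;; .nset 33 (.reg 32 + .reg 30) ;;
  .loop (.nlt (.reg 32) (.reg 33))
    (.nset 33 (.reg 33 - 1) ;; maxInto 32 (.arr 12 (.reg 33)) ;; .rset 30 (.reg 32) ;;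
     .rset 31 (.arr 10 (.reg 33 + 1) * .reg 32 - .arr 11 (.reg 33)) ;; push 13 14) ;;
  .nstore 10 (.reg 35) (.reg 34) ;; .rstore 17 (.reg 35) (.reg 32)

/-- The slopes `gmax i (p + w)` grow as `i` decreases, so the lines are pushed from right to left
while the maximum is updated. Slopes may repeat here, which is why `IsHull` admits equal ones. -/
theorem buildHull₁_halts {P : Profile} {σ : Mem} {M o p w : ℕ} (h3 : σ.nreg 3 = M)
    (h30 : σ.nreg 30 = w) (h32 : σ.nreg 32 = p) (h35 : σ.nreg 35 = o) (hpw : p + w ≤ M)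
    (hW : ∀ i ≤ M, σ.rarr 10 i = P.W i) (hD : ∀ i ≤ M, σ.rarr 11 i = P.D i)
    (hγ : ∀ i < M, σ.rarr 12 i = P.γ i) :
    Halts buildHull₁ σ (200 * w + 200) fun σ' =>
      IsHull (σ'.rarr 13) (σ'.rarr 14) o (σ'.narr 10 o) ∧ σ'.narr 10 o ≤ w ∧
      (∀ y u, (∀ k ≤ σ'.narr 10 o, σ'.rarr 13 (o + k) * y + σ'.rarr 14 (o + k) ≤ u) ↔
        0 - P.D M ≤ u ∧ ∀ i, p ≤ i → i < p + w →
          P.gmax i (p + w) * y + (P.W (i + 1) * P.gmax i (p + w) - P.D i) ≤ u) ∧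
      σ'.rarr 17 o = P.gmax p (p + w) ∧
      ∀ k < o, σ'.rarr 13 k = σ.rarr 13 k ∧ σ'.rarr 14 k = σ.rarr 14 k ∧
        σ'.rarr 17 k = σ.rarr 17 k ∧ σ'.narr 10 k = σ.narr 10 k := by
  unfold buildHull₁ Halts
  simp only [wp_seq]
  rw [wp_nset]
  refine ⟨by simp, ?_⟩
  rw [wp_rstore]
  refine ⟨by simp, ?_⟩
  rw [wp_rstore]
  refine ⟨by simp, ?_⟩
  rw [wp_rset]
  refine ⟨by simp, ?_⟩
  rw [wp_nset]
  refine ⟨by simp, ?_⟩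
  refine WP.loop (fun σ' T => ∃ i s, σ'.nreg 33 = i ∧ σ'.nreg 34 = s ∧ σ'.nreg 30 = w ∧
    σ'.nreg 32 = p ∧ σ'.nreg 35 = o ∧ p ≤ i ∧ i ≤ p + w ∧ s + i ≤ p + w ∧ σ'.narr = σ.narr ∧
    σ'.rarr 17 = σ.rarr 17 ∧ (∀ i ≤ M, σ'.rarr 10 i = P.W i) ∧ (∀ i ≤ M, σ'.rarr 11 i = P.D i) ∧
    (∀ i < M, σ'.rarr 12 i = P.γ i) ∧ σ'.rreg 32 = P.gmax i (p + w) ∧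
    (∀ k < o, σ'.rarr 13 k = σ.rarr 13 k ∧ σ'.rarr 14 k = σ.rarr 14 k) ∧
    IsHull (σ'.rarr 13) (σ'.rarr 14) o s ∧ σ'.rarr 13 (o + s) ≤ P.gmax i (p + w) ∧
    σ'.rarr 13 o = 0 ∧
    (∀ y u, (∀ k ≤ s, σ'.rarr 13 (o + k) * y + σ'.rarr 14 (o + k) ≤ u) ↔
        0 - P.D M ≤ u ∧ ∀ j, i ≤ j → j < p + w →
          P.gmax j (p + w) * y + (P.W (j + 1) * P.gmax j (p + w) - P.D j) ≤ u) ∧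
    200 * (i - p) + 60 * s + 150 ≤ T) ?_ ?_
  · refine ⟨p + w, 0, by simp [h32, h30], by simp, by simp [h30], by simp [h32], by simp [h35],
      by omega, le_rfl, by omega, rfl, by simp, by simpa using hW, by simpa using hD,
      by simpa using hγ, by simp [Profile.gmax_self], fun k hk => ?_, ?_, ?_, ?_,
      fun y u => ?_, by simp⟩
    · have : k ≠ o := hk.ne
      simp [h35, this]
    · exact ⟨fun k hk => by omega, fun hk => by omega, fun k hk => by omega⟩
    · simp [h35, Profile.gmax_self]
    · simp [h35]
    · simp only [Nat.le_zero, forall_eq, add_zero]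
      simp [h35, h3, hD M le_rfl]
      intro _ j hj hj'
      omega
  · rintro σ' T ⟨i, s, n33, n34, n30, n32, n35, hpi, hiw, hsi, na, h17, hW', hD', hγ', r32, hlow, hH,
      htop, hbot, henv, hT⟩
    refine ⟨by simp; omega, fun hc => ?_, fun hc => ?_⟩
    · simp only [BExp.eval_nlt, NExp.eval_reg, n33, n32] at hc
      obtain ⟨i, rfl⟩ : ∃ i', i = i' + 1 := ⟨i - 1, by omega⟩
      simp only [wp_seq]
      rw [wp_nset]
      refine ⟨by simp; omega, ?_⟩
      refine WP.maxInto (by simp; omega) fun T₁ hT₁ => ?_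
      simp at hT₁
      rw [wp_rset]
      refine ⟨by simp; omega, ?_⟩
      rw [wp_rset]
      refine ⟨by simp; omega, ?_⟩
      have hWi := hW' (i + 1) (by omega)
      have hDi := hD' i (by omega)
      have hγi := hγ' i (by omega)
      have hg : max (P.gmax (i + 1) (p + w)) (P.γ i) = P.gmax i (p + w) := by
        rw [Profile.gmax_succ_left (show i < p + w by omega), max_comm]
      have hle : P.gmax (i + 1) (p + w) ≤ P.gmax i (p + w) := hg ▸ le_max_left _ _
      refine push_wp (o := o) (s := s) (m := P.gmax i (p + w))
        (b := P.W (i + 1) * P.gmax i (p + w) - P.D i) (by simp [n35])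
        (by simp [n34]) (by simp [n33, r32, hγi, hg]) (by simp [n33, hDi, hWi, hγi, r32, hg])
        (by simpa using hH) (by simpa using htop.trans hle) ?_ (by simp; omega) ?_
      · simp only [Mem.setR_rarr, Mem.setN_rarr, hbot]
        exact Profile.gmax_pos (by omega)
      · intro s' T' hss' hT' hH' henv'
        simp only [Mem.setR_rarr, Mem.setN_rarr] at hH' henv'
        refine ⟨i, s' + 1, by simp [n33], by simp, by simp [n30], by simp [n32], by simp [n35],
          by omega, by omega, by omega, by simp [na], by simp [h17], by simpa using hW',
          by simpa using hD', by simpa using hγ', by simp [n33, r32, hγi, hg],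
          fun k hk => ?_, by simpa using hH', by simp, ?_, fun y u => ?_, ?_⟩
        · have : k ≠ o + (s' + 1) := by omega
          simpa [this] using hlow k hk
        · simpa using hbot
        · simp only [Mem.stR_rarr, Mem.setN_rarr, Mem.setR_rarr]
          norm_num only
          rw [if_true, if_false, if_true, if_false, ← henv', henv]
          constructor
          · rintro ⟨⟨h1, h2⟩, h3⟩
            refine ⟨h1, fun j hj hji => ?_⟩
            rcases hj.eq_or_lt with rfl | hj
            · exact h3
            · exact h2 j hj hji
          · rintro ⟨h1, h2⟩
            exact ⟨⟨h1, fun j hj hji => h2 j (by omega) hji⟩, h2 i le_rfl (by omega)⟩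
        · simp at hT'
          omega
    · simp only [BExp.eval_nlt, NExp.eval_reg, n33, n32] at hc
      obtain rfl : i = p := by omega
      rw [wp_nstore]
      refine ⟨by simp; omega, ?_⟩
      rw [wp_rstore]
      refine ⟨by simp; omega, ?_⟩
      refine ⟨by simpa [n35, n34] using hH, by simp [n35, n34]; omega,
        by simpa [n35, n34] using henv, by simp [n35, r32], fun k hk => ?_⟩
      have : k ≠ o := hk.ne
      have := hlow k hk
      simp [n35, hk.ne, na, h17, this]

end RealRAM

/-! ### The table of all dyadic blocks -/

namespace RealRAM

/-- The memories of the blocks agree below the offset `o`. -/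
structure AgreeBelow (o : ℕ) (na na' : ℕ → ℕ → ℕ) (ra ra' : ℕ → ℕ → ℝ) : Prop where
  n10 : ∀ k < o, na' 10 k = na 10 k
  n11 : ∀ k < o, na' 11 k = na 11 k
  r13 : ∀ k < o, ra' 13 k = ra 13 k
  r14 : ∀ k < o, ra' 14 k = ra 14 k
  r15 : ∀ k < o, ra' 15 k = ra 15 k
  r16 : ∀ k < o, ra' 16 k = ra 16 k
  r17 : ∀ k < o, ra' 17 k = ra 17 k

/-- An envelope of a block of length `w` has at most `w + 1` lines and fits into `2 * w` entries.
With offsets spaced twice the block length apart, later blocks do not overwrite it. -/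
theorem BlockAt.congr {P : Profile} {z : ℝ} {na na' : ℕ → ℕ → ℕ} {ra ra' : ℕ → ℕ → ℝ}
    {o o' p q : ℕ} (h : BlockAt P z na ra o p q) (hpq : p < q) (ho : o + 2 * (q - p) ≤ o')
    (ha : AgreeBelow o' na na' ra ra') : BlockAt P z na' ra' o p q := by
  have h1 := h.size₁
  have h2 := h.size₂
  have e1 := ha.n10 o (by omega)
  have e2 := ha.n11 o (by omega)
  refine ⟨?_, ?_, by rwa [e1], by rwa [e2], fun y u => ?_, fun y u => ?_, ?_⟩
  · rw [e1]
    exact h.hull₁.congr (fun k _ _ => ha.r13 k (by omega)) (fun k _ _ => ha.r14 k (by omega))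
  · rw [e2]
    exact h.hull₂.congr (fun k _ _ => ha.r15 k (by omega)) (fun k _ _ => ha.r16 k (by omega))
  · rw [← h.env₁ y u, e1]
    refine forall₂_congr fun k hk => ?_
    rw [ha.r13 _ (by omega), ha.r14 _ (by omega)]
  · rw [← h.env₂ y u, e2]
    refine forall₂_congr fun k hk => ?_
    rw [ha.r15 _ (by omega), ha.r16 _ (by omega)]
  · rw [ha.r17 _ (by omega), h.gmax]

/-- Build the data for the block `[nreg 32, nreg 32 + nreg 30)`. -/
def buildBlock : Cmd :=
  .nset 35 (.reg 31 + (.reg 32 + .reg 32)) ;; buildHull₂ ;; buildHull₁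

theorem buildBlock_halts {P : Profile} {σ : Mem} {M b p w : ℕ} (h3 : σ.nreg 3 = M)
    (h30 : σ.nreg 30 = w) (h31 : σ.nreg 31 = b) (h32 : σ.nreg 32 = p) (hpw : p + w ≤ M)
    (hW : ∀ i ≤ M, σ.rarr 10 i = P.W i) (hD : ∀ i ≤ M, σ.rarr 11 i = P.D i)
    (hγ : ∀ i < M, σ.rarr 12 i = P.γ i) :
    Halts buildBlock σ (400 * w + 420) fun σ' =>
      BlockAt P (0 - P.D M) σ'.narr σ'.rarr (b + (p + p)) p (p + w) ∧
      AgreeBelow (b + (p + p)) σ.narr σ'.narr σ.rarr σ'.rarr := by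
  unfold buildBlock Halts
  simp only [wp_seq]
  rw [wp_nset]
  refine ⟨by simp, ?_⟩
  refine (buildHull₂_halts (P := P) (M := M) (o := b + (p + p)) (p := p) (w := w) (by simpa)
    (by simpa) (by simpa) (by simp [h31, h32]) hpw (by simpa using hW) (by simpa using hD)).wp
    (by simp; omega) ?_
  rintro σ₁ T₁ hs ⟨hH, hsz, henv, hlow⟩ hT₁
  simp at hT₁
  refine (buildHull₁_halts (P := P) (M := M) (o := b + (p + p)) (p := p) (w := w)
    (by rw [hs.n _ rfl]; simpa) (by rw [hs.n _ rfl]; simpa) (by rw [hs.n _ rfl]; simpa)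
    (by rw [hs.n _ rfl]; simp [h31, h32]) hpw (by rw [hs.ra _ rfl]; simpa using hW)
    (by rw [hs.ra _ rfl]; simpa using hD) (by rw [hs.ra _ rfl]; simpa using hγ)).wp (by omega) ?_
  rintro σ₂ T₂ hs₂ ⟨hH', hsz', henv', hg, hlow'⟩ hT₂
  have e1 := hs₂.ra 15 rfl
  have e2 := hs₂.ra 16 rfl
  have e3 := hs₂.na 11 rfl
  have e4 := hs.ra 13 rfl
  have e5 := hs.ra 14 rfl
  have e6 := hs.ra 17 rfl
  have e7 := hs.na 10 rfl
  simp only [Mem.setN_rarr, Mem.setN_narr] at e4 e5 e6 e7 hlow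
  refine ⟨⟨hH', by rwa [e1, e2, e3], by omega, by rw [e3]; omega, henv', by rwa [e1, e2, e3], hg⟩,
    ⟨fun k hk => ?_, fun k hk => ?_, fun k hk => ?_, fun k hk => ?_, fun k hk => ?_,
      fun k hk => ?_, fun k hk => ?_⟩⟩
  · rw [(hlow' k hk).2.2.2, e7]
  · rw [e3, (hlow k hk).2.2]
  · rw [(hlow' k hk).1, e4]
  · rw [(hlow' k hk).2.1, e5]
  · rw [e1, (hlow k hk).1]
  · rw [e2, (hlow k hk).2.1]
  · rw [(hlow' k hk).2.2.1, e6]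

/-- Build the data for all dyadic blocks. -/
def buildTree : Cmd :=
  .nset 30 1 ;; .nset 31 0 ;;
  .loop (.nle (.reg 30) (.reg 3))
    (.nset 32 0 ;;
     .loop (.nle (.reg 32 + .reg 30) (.reg 3)) (buildBlock ;; .nset 32 (.reg 32 + .reg 30)) ;;
     .nset 30 (.reg 30 + .reg 30) ;; .nset 31 (.reg 31 + .reg 4))

/-- The blocks of one level have total length at most `M`, so a level costs `O(M)` steps by the
amortized bounds, and there are at most `L` levels. The spacing `S ≥ 2 * M` leaves room for a whole
level. -/
theorem buildTree_halts {P : Profile} {σ : Mem} {M S L : ℕ} (h3 : σ.nreg 3 = M)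
    (h4 : σ.nreg 4 = S) (hS : 2 * M ≤ S) (hL : M < 2 ^ L)
    (hW : ∀ i ≤ M, σ.rarr 10 i = P.W i) (hD : ∀ i ≤ M, σ.rarr 11 i = P.D i)
    (hγ : ∀ i < M, σ.rarr 12 i = P.γ i) :
    Halts buildTree σ (L * (900 * M + 100) + 20) fun σ' => Tree P M S σ'.narr σ'.rarr := by
  unfold buildTree Halts
  simp only [wp_seq]
  rw [wp_nset]
  refine ⟨by simp, ?_⟩
  rw [wp_nset]
  refine ⟨by simp, ?_⟩
  obtain ⟨K, hK⟩ : ∃ K, K = 900 * M + 100 := ⟨_, rfl⟩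
  rw [← hK]
  refine WP.loop (fun σ' T => ∃ h, σ'.nreg 30 = 2 ^ h ∧ σ'.nreg 31 = h * S ∧ σ'.nreg 3 = M ∧
    σ'.nreg 4 = S ∧ h ≤ L ∧ (∀ i ≤ M, σ'.rarr 10 i = P.W i) ∧ (∀ i ≤ M, σ'.rarr 11 i = P.D i) ∧
    (∀ i < M, σ'.rarr 12 i = P.γ i) ∧ (∀ h' r, h' < h → (r + 1) * 2 ^ h' ≤ M →
      BlockAt P (0 - P.D M) σ'.narr σ'.rarr (h' * S + (r * 2 ^ h' + r * 2 ^ h')) (r * 2 ^ h')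
        ((r + 1) * 2 ^ h')) ∧ (L - h) * K + 10 ≤ T) ?_ ?_
  · refine ⟨0, by simp, by simp, by simpa, by simpa, Nat.zero_le _, by simpa using hW,
      by simpa using hD, by simpa using hγ, fun _ _ h => absurd h (Nat.not_lt_zero _), ?_⟩
    simp
  · clear h3 h4 hW hD hγ
    rintro σ T ⟨h, n30, n31, n3, n4, hhL, hW, hD, hγ, hB, hT⟩
    refine ⟨by simp; omega, fun hc => ?_, fun hc => ?_⟩
    · simp only [BExp.eval_nle, NExp.eval_reg, n30, n3] at hc
      have hlt : h < L := (Nat.pow_lt_pow_iff_right (a := 2) (by norm_num)).1 (by omega)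
      have e1 : (L - h) * K = (L - (h + 1)) * K + K := by
        rw [show L - h = L - (h + 1) + 1 by omega, add_mul, one_mul]
      have h2 := Nat.two_pow_pos h
      simp only [wp_seq]
      rw [wp_nset]
      refine ⟨by simp; omega, ?_⟩
      refine WP.loop (fun σ' T => ∃ r, σ'.nreg 32 = r * 2 ^ h ∧ r * 2 ^ h ≤ M ∧
        σ'.nreg 30 = 2 ^ h ∧ σ'.nreg 31 = h * S ∧ σ'.nreg 3 = M ∧ σ'.nreg 4 = S ∧
        (∀ i ≤ M, σ'.rarr 10 i = P.W i) ∧ (∀ i ≤ M, σ'.rarr 11 i = P.D i) ∧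
        (∀ i < M, σ'.rarr 12 i = P.γ i) ∧
        (∀ h' r', h' < h ∨ h' = h ∧ r' < r → (r' + 1) * 2 ^ h' ≤ M →
          BlockAt P (0 - P.D M) σ'.narr σ'.rarr (h' * S + (r' * 2 ^ h' + r' * 2 ^ h')) (r' * 2 ^ h')
          ((r' + 1) * 2 ^ h')) ∧
        (L - (h + 1)) * K + 10 + 900 * (M - r * 2 ^ h) + 50 ≤ T) ?_ ?_
      · refine ⟨0, by simp, by omega, by simpa, by simpa, by simpa, by simpa, by simpa using hW,
          by simpa using hD, by simpa using hγ, fun h' r' hh => ?_, ?_⟩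
        · exact hB h' r' (by omega)
        · simp
          omega
      · clear n30 n31 n3 n4 hW hD hγ hB hT
        rintro σ T ⟨r, n32, hrM, n30, n31, n3, n4, hW, hD, hγ, hB, hT⟩
        refine ⟨by simp; omega, fun hc' => ?_, fun hc' => ?_⟩
        · simp only [BExp.eval_nle, NExp.eval_add, NExp.eval_reg, n30, n32, n3] at hc'
          have e2 : (r + 1) * 2 ^ h = r * 2 ^ h + 2 ^ h := by ring
          rw [wp_seq]
          refine (buildBlock_halts n3 n30 n31 n32 hc' hW hD hγ).wp (by simp; omega) ?_
          rintro σ₁ T₁ hs ⟨hblock, hagree⟩ hT₁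
          simp at hT₁
          rw [wp_nset]
          refine ⟨by simp; omega, r + 1, ?_, by omega, by simp [hs.n 30 rfl, n30],
            by simp [hs.n 31 rfl, n31], by simp [hs.n 3 rfl, n3], by simp [hs.n 4 rfl, n4],
            by simpa [hs.ra 10 rfl] using hW, by simpa [hs.ra 11 rfl] using hD,
            by simpa [hs.ra 12 rfl] using hγ, fun h' r' hh hM => ?_, ?_⟩
          · simp [hs.n 32 rfl, hs.n 30 rfl, n32, n30, e2]
          · simp only [Mem.setN_narr, Mem.setN_rarr]
            by_cases hnew : h' = h ∧ r' = r
            · obtain ⟨rfl, rfl⟩ := hnew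
              rwa [e2]
            · have hold : h' < h ∨ h' = h ∧ r' < r := by omega
              have e3 : (r' + 1) * 2 ^ h' = r' * 2 ^ h' + 2 ^ h' := by ring
              have h2' := Nat.two_pow_pos h'
              refine (hB h' r' hold hM).congr (by omega) ?_ hagree
              -- A finished block lies on an earlier level or further left on the same one; in both
              -- cases its memory ends before the offset of the new block.
              rcases hold with hlt' | ⟨rfl, hlt'⟩
              · have e4 : (h' + 1) * S ≤ h * S := Nat.mul_le_mul_right _ hlt'
                rw [add_mul, one_mul] at e4
                omega
              · have e4 : (r' + 1) * 2 ^ h' ≤ r * 2 ^ h' := Nat.mul_le_mul_right _ hlt'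
                omega
          · simp
            omega
        · simp only [BExp.eval_nle, NExp.eval_add, NExp.eval_reg, n30, n32, n3] at hc'
          rw [wp_nset]
          refine ⟨by simp; omega, ?_⟩
          rw [wp_nset]
          refine ⟨by simp; omega, h + 1, ?_, ?_, by simpa, by simpa, hlt, by simpa using hW,
            by simpa using hD, by simpa using hγ, fun h' r' hh hM => ?_, ?_⟩
          · simp [n30, pow_succ]; omega
          · simp [n31, n4]; ring
          · simp only [Mem.setN_narr, Mem.setN_rarr]
            refine hB h' r' ?_ hM
            by_contra hne
            obtain rfl : h' = h := by omega
            have e3 : (r' + 1) * 2 ^ h' = r' * 2 ^ h' + 2 ^ h' := by ring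
            have e4 : r * 2 ^ h' ≤ r' * 2 ^ h' := Nat.mul_le_mul_right _ (by omega)
            omega
          · simp
            omega
    · simp only [BExp.eval_nle, NExp.eval_reg, n30, n3] at hc
      refine ⟨hW, hD, fun h' r hM => hB h' r ?_ hM⟩
      refine (Nat.pow_lt_pow_iff_right (a := 2) (by norm_num)).1 ?_
      have := Nat.le_mul_of_pos_left (2 ^ h') (Nat.succ_pos r)
      simp only [Nat.succ_eq_add_one] at this
      omega

end RealRAM

namespace RealRAM

/-! ## The test whether a time is feasible -/

theorem BlockAt.of_eq {P : Profile} {z : ℝ} {na na' : ℕ → ℕ → ℕ} {ra ra' : ℕ → ℕ → ℝ}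
    {o p q : ℕ} (h : BlockAt P z na ra o p q) (hn : ∀ A, 10 ≤ A → A < 20 → na' A = na A)
    (hr : ∀ A, 10 ≤ A → A < 20 → ra' A = ra A) : BlockAt P z na' ra' o p q := by
  have e10 := hn 10 (by omega) (by omega)
  have e11 := hn 11 (by omega) (by omega)
  have e13 := hr 13 (by omega) (by omega)
  have e14 := hr 14 (by omega) (by omega)
  have e15 := hr 15 (by omega) (by omega)
  have e16 := hr 16 (by omega) (by omega)
  have e17 := hr 17 (by omega) (by omega)
  obtain ⟨h1, h2, h3, h4, h5, h6, h7⟩ := h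
  constructor <;> simp only [e10, e11, e13, e14, e15, e16, e17] <;> assumption

theorem Tree.of_eq {P : Profile} {M S : ℕ} {na na' : ℕ → ℕ → ℕ} {ra ra' : ℕ → ℕ → ℝ}
    (h : Tree P M S na ra) (hn : ∀ A, 10 ≤ A → A < 20 → na' A = na A)
    (hr : ∀ A, 10 ≤ A → A < 20 → ra' A = ra A) : Tree P M S na' ra' :=
  ⟨by rw [hr 10 (by omega) (by omega)]; exact h.W, by rw [hr 11 (by omega) (by omega)]; exact h.D,
    fun e r hM => (h.block e r hM).of_eq hn hr⟩

/-- The memory contains the data of the network that are computed once and for all. -/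
structure Env (N : DynamicPath) (k : ℕ) (σ : Mem) : Prop where
  n0 : σ.nreg 0 = N.n
  n2 : σ.nreg 2 = min k N.n
  n3 : σ.nreg 3 = N.n + N.n
  n4 : σ.nreg 4 = N.n + N.n + (N.n + N.n)
  tree : Tree N.profile (N.n + N.n) (N.n + N.n + (N.n + N.n)) σ.narr σ.rarr

namespace Env

variable {N : DynamicPath} {k : ℕ} {σ σ' : Mem}

theorem of_eq (h : Env N k σ) (hn : ∀ x < 5, σ'.nreg x = σ.nreg x)
    (hna : ∀ A, 10 ≤ A → A < 20 → σ'.narr A = σ.narr A)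
    (hra : ∀ A, 10 ≤ A → A < 20 → σ'.rarr A = σ.rarr A) : Env N k σ' :=
  ⟨by rw [hn _ (by omega), h.n0], by rw [hn _ (by omega), h.n2], by rw [hn _ (by omega), h.n3],
    by rw [hn _ (by omega), h.n4], h.tree.of_eq hna hra⟩

/-- The side condition is a Boolean computed from the program, so that `rfl` proves it for each
concrete subprogram. -/
theorem same {c : Cmd} (h : Env N k σ) (hs : Same c σ σ')
    (hc : ((List.range 5).all fun x => !c.wN x) && ((List.range 10).all fun A =>
      !c.wNA (10 + A) && !c.wRA (10 + A)) = true) : Env N k σ' := by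
  simp only [Bool.and_eq_true, List.all_eq_true, List.mem_range, Bool.not_eq_true',
    decide_eq_true_eq] at hc
  refine h.of_eq (fun x hx => hs.n x (hc.1 x hx)) (fun A h1 h2 => ?_) (fun A h1 h2 => ?_)
  · refine hs.na A ?_
    obtain ⟨B, rfl⟩ := Nat.exists_eq_add_of_le h1
    exact (hc.2 B (by omega)).1
  · refine hs.ra A ?_
    obtain ⟨B, rfl⟩ := Nat.exists_eq_add_of_le h1
    exact (hc.2 B (by omega)).2

theorem setN (h : Env N k σ) {x v : ℕ} (hx : 5 ≤ x) : Env N k (σ.setN x v) :=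
  h.of_eq (fun y hy => by rw [Mem.setN_nreg, if_neg (by omega)]) (fun _ _ _ => rfl)
    fun _ _ _ => rfl

theorem setR (h : Env N k σ) {x : ℕ} {v : ℝ} : Env N k (σ.setR x v) :=
  h.of_eq (fun _ _ => rfl) (fun _ _ _ => rfl) fun _ _ _ => rfl

theorem stN (h : Env N k σ) {A i v : ℕ} (hA : A < 10 ∨ 20 ≤ A) : Env N k (σ.stN A i v) :=
  h.of_eq (fun _ _ => rfl) (fun B _ _ => by rw [Mem.stN_narr, if_neg (by omega)]) fun _ _ _ => rfl

theorem stR (h : Env N k σ) {A i : ℕ} {v : ℝ} (hA : A < 10 ∨ 20 ≤ A) : Env N k (σ.stR A i v) :=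
  h.of_eq (fun _ _ => rfl) (fun _ _ _ => rfl) fun B _ _ => by rw [Mem.stR_rarr, if_neg (by omega)]

theorem trav (h : Env N k σ) {x : ℕ} (hx : x < N.n) :
    σ.rarr 11 (x + 1) - σ.rarr 11 x = N.trav x := by
  rw [h.tree.D _ (by omega), h.tree.D _ (by omega)]; rfl

end Env

/-- Compute the cost from `e` to `f` in the real register `20`. -/
def callCost (e f : NExp) : Cmd := .nset 20 e ;; .nset 21 f ;; evalCost

/-- A bound for the running time of `callCost`. -/
def callTime (L : ℕ) : ℕ := 2 * L * (100 * L + 300) + 150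

section

variable {N : DynamicPath} {k L : ℕ} {σ : Mem} {T : ℕ} {Q : Mem → ℕ → Prop} {e f : NExp}

theorem callCost_wp {a x : ℕ} (hE : Env N k σ) (hL : N.n + N.n < 2 ^ L) (he : e.eval σ = a)
    (hf : f.eval (σ.setN 20 a) = x) (hc : e.cost + f.cost ≤ 40) (hax : a ≤ x)
    (hx : x ≤ N.n + N.n) (hT : callTime L ≤ T)
    (hQ : ∀ σ' T', Same (callCost e f) σ σ' → Env N k σ' → σ'.rreg 20 = N.profile.cost a x →
      T ≤ T' + callTime L → Q σ' T') : WP (callCost e f) σ T Q := by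
  have h : Halts (callCost e f) σ (callTime L) fun σ' => σ'.rreg 20 = N.profile.cost a x := by
    unfold callCost Halts callTime
    rw [wp_seq, wp_nset]
    refine ⟨by omega, ?_⟩
    rw [wp_seq, wp_nset]
    refine ⟨by omega, ?_⟩
    rw [he, hf]
    exact (evalCost_halts (σ := (σ.setN 20 a).setN 21 x) hE.tree (by simpa using hE.n4) (by simp)
      (by simp) hax hx hL).wp (by omega) fun σ' T' _ h _ => h
  exact h.wp hT fun σ' T' hs hp hT' => hQ σ' T' hs (hE.same hs rfl) hp hT'

/-- The arguments are reflected into the mirrored half of the path, where evacuation from the right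
runs from left to right. -/
theorem callCostR_wp {b x : ℕ} (hE : Env N k σ) (hL : N.n + N.n < 2 ^ L) (he : e.eval σ = b)
    (hf : f.eval (σ.setN 20 (N.n + N.n - 1 - b)) = x) (hc : e.cost + f.cost ≤ 20) (hxb : x ≤ b)
    (hT : callTime L ≤ T)
    (hQ : ∀ σ' T', Same (callCost (.reg 3 - 1 - e) (.reg 3 - 1 - f)) σ σ' → Env N k σ' →
      σ'.rreg 20 = N.costR b x → T ≤ T' + callTime L → Q σ' T') :
    WP (callCost (.reg 3 - 1 - e) (.reg 3 - 1 - f)) σ T Q :=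
  callCost_wp hE hL (by simp [hE.n3, he]) (by simp [hE.n3, hf]) (by simp; omega) (by omega)
    (by omega) hT hQ

end

/-- Find the last vertex which the evacuees from `nreg 51` on can reach in the time `rreg 50`. -/
def findSink : Cmd :=
  .nset 52 (.reg 51) ;; .nset 54 1 ;;
  .loop (.nle 1 (.reg 54))
    (.ite (.nlt (.reg 52 + 1) (.reg 0))
      (callCost (.reg 51) (.reg 52 + 1) ;;
       .ite (.rle (.reg 20) (.reg 50)) (.nset 52 (.reg 52 + 1)) (.nset 54 0))
      (.nset 54 0))

/-- Find the last vertex of the block which starts at `nreg 51` and has its sink at the vertex or on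
the edge `nreg 52`. -/
def findEnd : Cmd :=
  .rset 51 (.reg 20 - (.arr 11 (.reg 52 + 1) - .arr 11 (.reg 52))) ;;
  .nset 53 (.reg 52) ;; .nset 54 1 ;;
  .loop (.nle 1 (.reg 54))
    (.ite (.nlt (.reg 53 + 1) (.reg 0))
      (callCost (.reg 3 - 1 - (.reg 53 + 1)) (.reg 3 - 1 - .reg 52) ;;
       .ite (.and (.rlt (.reg 50) (.reg 20)) (.rlt (.reg 50 + .reg 50) (.reg 51 + .reg 20)))
         (.nset 54 0) (.nset 53 (.reg 53 + 1)))
      (.nset 54 0))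

/-- Write the sink for the block from `nreg 51` to `nreg 53`. -/
def writeSink : Cmd :=
  callCost (.reg 3 - 1 - .reg 53) (.reg 3 - 1 - .reg 52) ;;
  .nstore 0 (.reg 50) (.reg 52) ;;
  .ite (.rle (.reg 20) (.reg 50)) (.rstore 3 (.reg 50) 0)
    (.rstore 3 (.reg 50)
      ((.reg 50 - .reg 51) / (.arr 11 (.reg 52 + 1) - .arr 11 (.reg 52))))

section

variable {N : DynamicPath} {k L K : ℕ} {σ : Mem} {T a x b : ℕ} {t : ℝ} {Q : Mem → ℕ → Prop}

/-- With `K` credits for one evaluation, the scan is charged to the vertices it passes: `x - a + 2`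
units. Since blocks follow one another, these charges telescope over a whole test. -/
theorem findSink_wp (hE : Env N k σ) (hL : N.n + N.n < 2 ^ L) (hK : callTime L + 100 ≤ K)
    (h51 : σ.nreg 51 = a) (ha : a < N.n) (ht : 0 ≤ t) (r50 : σ.rreg 50 = t)
    (hT : N.n * K + 2 * K ≤ T + a * K)
    (hQ : ∀ σ' T' x, Same findSink σ σ' → Env N k σ' → σ'.nreg 52 = x → a ≤ x → x < N.n →
      N.profile.cost a x ≤ t → (x + 1 < N.n → t < N.profile.cost a (x + 1) ∧
        σ'.rreg 20 = N.profile.cost a (x + 1)) → T + a * K ≤ T' + x * K + 2 * K → Q σ' T') :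
    WP findSink σ T Q := by
  have h : WP findSink σ T fun σ' T' => ∃ x, Env N k σ' ∧ σ'.nreg 52 = x ∧ a ≤ x ∧ x < N.n ∧
      N.profile.cost a x ≤ t ∧ (x + 1 < N.n → t < N.profile.cost a (x + 1) ∧
        σ'.rreg 20 = N.profile.cost a (x + 1)) ∧ T + a * K ≤ T' + x * K + 2 * K := by
    clear hQ
    have hle : a * K + K ≤ N.n * K := by
      rw [← Nat.succ_mul]; exact Nat.mul_le_mul_right _ ha
    unfold findSink
    rw [wp_seq, wp_nset]
    refine ⟨by simp; omega, ?_⟩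
    rw [wp_seq, wp_nset]
    refine ⟨by simp; omega, ?_⟩
    refine WP.loop (fun σ' T' => ∃ x, Env N k σ' ∧ σ'.nreg 51 = a ∧ σ'.rreg 50 = t ∧
      σ'.nreg 52 = x ∧ a ≤ x ∧ x < N.n ∧ N.profile.cost a x ≤ t ∧
      (σ'.nreg 54 = 0 → x + 1 < N.n → t < N.profile.cost a (x + 1) ∧
        σ'.rreg 20 = N.profile.cost a (x + 1)) ∧
      T + a * K ≤ T' + x * K + K + (if σ'.nreg 54 = 0 then K - 10 else 0)) ?_ ?_
    · refine ⟨a, (hE.setN (by omega)).setN (by omega), by simpa, by simpa, by simpa, le_rfl, ha,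
        ?_, by simp, ?_⟩
      · rw [Profile.cost_of_le le_rfl]; exact ht
      · simp
        omega
    · clear hE h51 r50
      rintro σ T' ⟨x, hE, n51, r50, n52, hax, hxn, hc, hc', hT'⟩
      have hle' : x * K + K ≤ N.n * K := by
        rw [← Nat.succ_mul]; exact Nat.mul_le_mul_right _ hxn
      refine ⟨by split_ifs at hT' <;> simp <;> omega, fun h54 => ?_, fun h54 => ?_⟩
      · simp only [BExp.eval_nle, NExp.eval_one, NExp.eval_reg] at h54
        rw [if_neg (by omega)] at hT'
        rw [wp_ite]
        refine ⟨by simp; omega, fun hx => ?_, fun hx => ?_⟩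
        · simp only [BExp.eval_nlt, NExp.eval_add, NExp.eval_one, NExp.eval_reg, n52, hE.n0] at hx
          rw [wp_seq]
          refine callCost_wp hE hL n51 (x := x + 1) (by simp [n52]) (by simp) (by omega)
            (by omega) (by simp; omega) fun σ₁ T₁ hs hE₁ hp hT₁ => ?_
          simp at hT₁
          rw [wp_ite]
          refine ⟨by simp; omega, fun h => ?_, fun h => ?_⟩
          · simp only [BExp.eval_rle, RExp.eval_reg, hp, hs.r 50 rfl, r50] at h
            rw [wp_nset]
            refine ⟨by simp; omega, x + 1, hE₁.setN (by omega), by simp [hs.n 51 rfl, n51],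
              by simp [hs.r 50 rfl, r50], by simp [hs.n 52 rfl, n52], by omega, hx, h, ?_, ?_⟩
            · simp [hs.n 54 rfl]; omega
            · have : (x + 1) * K = x * K + K := Nat.succ_mul _ _
              simp [hs.n 54 rfl]
              omega
          · simp only [BExp.eval_rle, RExp.eval_reg, hp, hs.r 50 rfl, r50, not_le] at h
            rw [wp_nset]
            refine ⟨by simp; omega, x, hE₁.setN (by omega), by simp [hs.n 51 rfl, n51],
              by simp [hs.r 50 rfl, r50], by simp [hs.n 52 rfl, n52], hax, hxn, hc, ?_, ?_⟩
            · exact fun _ _ => ⟨h, by simpa using hp⟩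
            · simp
              omega
        · simp only [BExp.eval_nlt, NExp.eval_add, NExp.eval_one, NExp.eval_reg, n52, hE.n0] at hx
          rw [wp_nset]
          refine ⟨by simp; omega, x, hE.setN (by omega), by simpa, by simpa, by simpa, hax, hxn,
            hc, ?_, ?_⟩
          · exact fun _ h => absurd h hx
          · simp
            omega
      · simp only [BExp.eval_nle, NExp.eval_one, NExp.eval_reg, not_le, Nat.lt_one_iff] at h54
        rw [if_pos h54] at hT'
        refine ⟨x, hE, n52, hax, hxn, hc, hc' h54, ?_⟩
        simp
        omega
  -- The frame is read off from the run afterwards, so the loop invariant need not carry it.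
  obtain ⟨T', σ', hr, hle, x, h1, h2, h3, h4, h5, h6, h7⟩ := h
  exact ⟨T', σ', hr, hle, hQ _ _ x hr.same h1 h2 h3 h4 h5 h6 h7⟩

/-- Real register `20` still holds the last rejected value `cost a (x + 1)` of the preceding scan,
so it is not evaluated again. If `x` is the last vertex the value is meaningless, but then the loop
stops before using it. -/
theorem findEnd_wp (hE : Env N k σ) (hL : N.n + N.n < 2 ^ L) (hK : callTime L + 100 ≤ K)
    (h52 : σ.nreg 52 = x) (hxn : x < N.n) (ht : 0 ≤ t) (r50 : σ.rreg 50 = t)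
    (r20 : x + 1 < N.n → σ.rreg 20 = N.profile.cost a (x + 1))
    (hT : N.n * K + 2 * K ≤ T + x * K)
    (hQ : ∀ σ' T' b, Same findEnd σ σ' → Env N k σ' → σ'.nreg 53 = b → x ≤ b → b < N.n →
      N.edgeCost a x b ≤ t → (b + 1 < N.n → t < N.edgeCost a x (b + 1)) →
      (x + 1 < N.n → σ'.rreg 51 = N.profile.cost a (x + 1) - N.trav x) →
      T + x * K ≤ T' + b * K + 2 * K → Q σ' T') :
    WP findEnd σ T Q := by
  have h : WP findEnd σ T fun σ' T' => ∃ b, Env N k σ' ∧ σ'.nreg 53 = b ∧ x ≤ b ∧ b < N.n ∧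
      N.edgeCost a x b ≤ t ∧ (b + 1 < N.n → t < N.edgeCost a x (b + 1)) ∧
      (x + 1 < N.n → σ'.rreg 51 = N.profile.cost a (x + 1) - N.trav x) ∧
      T + x * K ≤ T' + b * K + 2 * K := by
    clear hQ
    have hle : x * K + K ≤ N.n * K := by
      rw [← Nat.succ_mul]; exact Nat.mul_le_mul_right _ hxn
    unfold findEnd
    rw [wp_seq, wp_rset]
    refine ⟨by simp; omega, ?_⟩
    rw [wp_seq, wp_nset]
    refine ⟨by simp; omega, ?_⟩
    rw [wp_seq, wp_nset]
    refine ⟨by simp; omega, ?_⟩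
    refine WP.loop (fun σ' T' => ∃ b, Env N k σ' ∧ σ'.nreg 52 = x ∧ σ'.rreg 50 = t ∧
      (x + 1 < N.n → σ'.rreg 51 = N.profile.cost a (x + 1) - N.trav x) ∧
      σ'.nreg 53 = b ∧ x ≤ b ∧ b < N.n ∧ N.edgeCost a x b ≤ t ∧
      (σ'.nreg 54 = 0 → b + 1 < N.n → t < N.edgeCost a x (b + 1)) ∧
      T + x * K ≤ T' + b * K + K + (if σ'.nreg 54 = 0 then K - 10 else 0)) ?_ ?_
    · refine ⟨x, (hE.setR.setN (by omega)).setN (by omega), by simpa, by simpa, fun h => ?_,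
        by simpa, le_rfl, hxn, ?_, by simp, ?_⟩
      · simp [r20 h, h52, hE.trav hxn]
      · exact (min_le_left _ _).trans (by rwa [DynamicPath.costR_of_le le_rfl])
      · simp
        omega
    · clear hE h52 r50
      rintro σ T' ⟨b, hE, n52, r50, r51, n53, hxb, hbn, hc, hc', hT'⟩
      have hle' : b * K + K ≤ N.n * K := by
        rw [← Nat.succ_mul]; exact Nat.mul_le_mul_right _ hbn
      refine ⟨by split_ifs at hT' <;> simp <;> omega, fun h54 => ?_, fun h54 => ?_⟩
      · simp only [BExp.eval_nle, NExp.eval_one, NExp.eval_reg] at h54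
        rw [if_neg (by omega)] at hT'
        rw [wp_ite]
        refine ⟨by simp; omega, fun hx => ?_, fun hx => ?_⟩
        · simp only [BExp.eval_nlt, NExp.eval_add, NExp.eval_one, NExp.eval_reg, n53, hE.n0] at hx
          rw [wp_seq]
          refine callCostR_wp hE hL (b := b + 1) (by simp [n53]) (x := x) (by simp [n52]) (by simp)
            (by omega) (by simp; omega) fun σ₁ T₁ hs hE₁ hp hT₁ => ?_
          simp at hT₁
          have hA := r51 (by omega)
          -- The program compares doubled quantities instead of dividing by two.
          have hiff : t < N.edgeCost a x (b + 1) ↔ t < N.costR (b + 1) x ∧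
              t + t < N.profile.cost a (x + 1) - N.trav x + N.costR (b + 1) x := by
            rw [DynamicPath.edgeCost, lt_min_iff, lt_div_iff₀ two_pos, mul_two]
          rw [wp_ite]
          refine ⟨by simp; omega, fun h => ?_, fun h => ?_⟩
          · simp only [BExp.eval_and, BExp.eval_rlt, RExp.eval_add, RExp.eval_reg, hp,
              hs.r 50 rfl, hs.r 51 rfl, r50, hA, ← hiff] at h
            rw [wp_nset]
            refine ⟨by simp; omega, b, hE₁.setN (by omega), by simp [hs.n 52 rfl, n52],
              by simp [hs.r 50 rfl, r50], by simpa [hs.r 51 rfl] using r51,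
              by simp [hs.n 53 rfl, n53], hxb, hbn, hc, fun _ _ => h, ?_⟩
            simp
            omega
          · simp only [BExp.eval_and, BExp.eval_rlt, RExp.eval_add, RExp.eval_reg, hp,
              hs.r 50 rfl, hs.r 51 rfl, r50, hA, ← hiff, not_lt] at h
            rw [wp_nset]
            refine ⟨by simp; omega, b + 1, hE₁.setN (by omega), by simp [hs.n 52 rfl, n52],
              by simp [hs.r 50 rfl, r50], by simpa [hs.r 51 rfl] using r51,
              by simp [hs.n 53 rfl, n53], by omega, hx, h, ?_, ?_⟩
            · simp [hs.n 54 rfl]; omega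
            · have : (b + 1) * K = b * K + K := Nat.succ_mul _ _
              simp [hs.n 54 rfl]
              omega
        · simp only [BExp.eval_nlt, NExp.eval_add, NExp.eval_one, NExp.eval_reg, n53, hE.n0] at hx
          rw [wp_nset]
          refine ⟨by simp; omega, b, hE.setN (by omega), by simpa, by simpa, by simpa using r51,
            by simpa, hxb, hbn, hc, ?_, ?_⟩
          · exact fun _ h => absurd h hx
          · simp
            omega
      · simp only [BExp.eval_nle, NExp.eval_one, NExp.eval_reg, not_le, Nat.lt_one_iff] at h54
        rw [if_pos h54] at hT'
        refine ⟨b, hE, n53, hxb, hbn, hc, hc' h54, r51, ?_⟩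
        simp
        omega
  obtain ⟨T', σ', hr, hle, x, h1, h2, h3, h4, h5, h6, h7, h8⟩ := h
  exact ⟨T', σ', hr, hle, hQ _ _ x hr.same h1 h2 h3 h4 h5 h6 h7 h8⟩

theorem writeSink_halts {i : ℕ} (hE : Env N k σ) (hL : N.n + N.n < 2 ^ L) (h50 : σ.nreg 50 = i)
    (h52 : σ.nreg 52 = x) (h53 : σ.nreg 53 = b) (hax : a ≤ x) (hxb : x ≤ b) (hbn : b < N.n)
    (ht : 0 ≤ t) (r50 : σ.rreg 50 = t)
    (r51 : x + 1 < N.n → σ.rreg 51 = N.profile.cost a (x + 1) - N.trav x)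
    (hc : N.profile.cost a x ≤ t) (hc' : x + 1 < N.n → t < N.profile.cost a (x + 1))
    (hV : N.edgeCost a x b ≤ t) :
    Halts writeSink σ (callTime L + 60) fun σ' => ∃ f, N.CanEvacuate a b ⟨x, f⟩ t ∧
      σ'.narr 0 = Function.update (σ.narr 0) i x ∧
      σ'.rarr 3 = Function.update (σ.rarr 3) i f := by
  unfold writeSink Halts
  rw [wp_seq]
  refine callCostR_wp hE hL (b := b) (by simp [h53]) (x := x) (by simp [h52]) (by simp) hxb
    (by omega) fun σ₁ T₁ hs hE₁ hp hT₁ => ?_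
  rw [wp_seq, wp_nstore]
  refine ⟨by simp; omega, ?_⟩
  rw [wp_ite]
  have hev := DynamicPath.canEvacuate_sink ht hax hxb hbn hc (fun h => hc' (by omega)) hV
  refine ⟨by simp; omega, fun h => ?_, fun h => ?_⟩
  · simp only [BExp.eval_rle, RExp.eval_reg, Mem.stN_rreg, hp, hs.r 50 rfl, r50] at h
    rw [if_pos h] at hev
    rw [wp_rstore]
    refine ⟨by simp; omega, _, hev, ?_, ?_⟩
    · simp [hs.n 50 rfl, hs.n 52 rfl, hs.na 0 rfl, h50, h52]
    · simp [hs.n 50 rfl, hs.ra 3 rfl, h50]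
  · simp only [BExp.eval_rle, RExp.eval_reg, Mem.stN_rreg, hp, hs.r 50 rfl, r50] at h
    rw [if_neg h] at hev
    -- At the last vertex nothing comes from the right, so a sink inside an edge occurs only where
    -- real register `51` is meaningful.
    have hxn : x + 1 < N.n := by
      by_contra hx
      exact h (by rwa [DynamicPath.costR_of_le (by omega)])
    rw [wp_rstore]
    refine ⟨by simp; omega, _, hev, ?_, ?_⟩
    · simp [hs.n 50 rfl, hs.n 52 rfl, hs.na 0 rfl, h50, h52]
    · have := hE₁.trav (x := x) (by omega)
      simp [hs.n 50 rfl, hs.n 52 rfl, hs.ra 3 rfl, h50, h52, hs.r 50 rfl, hs.r 51 rfl, r50,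
        r51 hxn, this]

end

end RealRAM

/-! ### The greedy feasibility test -/

namespace RealRAM

/-- Test whether the time `rreg 50` is feasible with `k` sinks; the result is written to `nreg 55`,
and the sinks to the output arrays. -/
def test : Cmd :=
  .nset 50 0 ;; .nset 51 0 ;;
  .loop (.and (.nlt (.reg 51) (.reg 0)) (.nlt (.reg 50) (.reg 2)))
    (findSink ;; findEnd ;; writeSink ;; .nset 51 (.reg 53 + 1) ;; .nset 50 (.reg 50 + 1)) ;;
  .ite (.nle (.reg 0) (.reg 51)) (.nset 55 1) (.nset 55 0) ;;
  .loop (.nlt (.reg 50) (.reg 2))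
    (.nstore 0 (.reg 50) 0 ;; .rstore 3 (.reg 50) 0 ;; .nset 50 (.reg 50 + 1))

/-- The first `i` sinks in the memory serve the first `a` vertices in the time `t`, which are as
many as possible. -/
structure Greedy (N : DynamicPath) (k : ℕ) (t : ℝ) (s : ℕ → PathPoint) (i a : ℕ) : Prop where
  le_min : i ≤ min k N.n
  le_left : i ≤ a
  le_n : a ≤ N.n
  blocks : ∃ d : ℕ → ℕ, Monotone d ∧ d 0 = 0 ∧ (∀ j, i ≤ j → d j = a) ∧
    ∀ j < i, N.CanEvacuate (d j) (d (j + 1) - 1) (s j) t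
  maximal : ∀ d : ℕ → ℕ, Monotone d → d 0 = 0 → d k = N.n →
    (∀ j < k, d j < d (j + 1) → N.BlockOK (d j) (d (j + 1) - 1) t) → d i ≤ a

namespace Greedy

variable {N : DynamicPath} {k i a x b : ℕ} {t f : ℝ} {s : ℕ → PathPoint}

theorem zero : Greedy N k t s 0 0 :=
  ⟨Nat.zero_le _, le_rfl, Nat.zero_le _, ⟨fun _ => 0, fun _ _ _ => le_rfl, rfl, fun _ _ => rfl,
    fun _ h => absurd h (Nat.not_lt_zero _)⟩, fun _ _ h _ _ => h.le⟩

/-- The new block ends at `b`; by `greedy_step` no feasible division gets further with as many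
blocks. -/
theorem succ (h : Greedy N k t s i a) {s' : ℕ → PathPoint} (hs : ∀ j < i, s' j = s j)
    (hi : i < min k N.n) (ht : 0 ≤ t) (hax : a ≤ x) (hxb : x ≤ b) (hbn : b < N.n)
    (hc : N.profile.cost a x ≤ t) (hc' : x + 1 < N.n → t < N.profile.cost a (x + 1))
    (hV : b + 1 < N.n → t < N.edgeCost a x (b + 1)) (hev : N.CanEvacuate a b (s' i) t) :
    Greedy N k t s' (i + 1) (b + 1) := by
  obtain ⟨h1, h2, h3, ⟨d, hd, h0, hda, hds⟩, hmax⟩ := h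
  refine ⟨hi, by omega, hbn, ⟨fun j => if j ≤ i then d j else b + 1, fun j j' hj => ?_, ?_,
    fun j hj => if_neg (by omega), fun j hj => ?_⟩, fun d' hd' h0' hk' hd's => ?_⟩
  · dsimp only
    split_ifs with h4 h5
    · exact hd hj
    · have := hd h4
      rw [hda i le_rfl] at this
      omega
    · omega
    · exact le_rfl
  · simpa using h0
  · dsimp only
    rw [if_pos (by omega)]
    rcases Nat.lt_succ_iff_lt_or_eq.1 hj with h4 | rfl
    · rw [if_pos (by omega), hs j h4]
      exact hds j h4
    · rw [if_neg (by omega), hda j le_rfl]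
      exact hev
  · have h4 := hmax d' hd' h0' hk' hd's
    have h5 : d' (i + 1) ≤ d' k := hd' (by omega)
    exact DynamicPath.greedy_step ht (hd's i (by omega)) (by omega) h4 hax (by omega) hc hc' hV

theorem congr (h : Greedy N k t s i a) {s' : ℕ → PathPoint} (hs : ∀ j < i, s' j = s j) :
    Greedy N k t s' i a := by
  obtain ⟨h1, h2, h3, ⟨d, hd, h0, hda, hds⟩, hmax⟩ := h
  exact ⟨h1, h2, h3, ⟨d, hd, h0, hda, fun j hj => by rw [hs j hj]; exact hds j hj⟩, hmax⟩

/-- The sinks that the greedy division does not need belong to empty blocks, so any point of the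
path may be written for them. -/
theorem feasible (h : Greedy N k t s i N.n) (hs : ∀ j, i ≤ j → j < min k N.n → s j = ⟨0, 0⟩) :
    N.Feasible (fun j : Fin (min k N.n) => s j) t := by
  obtain ⟨h1, h2, h3, ⟨d, hd, h0, hda, hds⟩, -⟩ := h
  have hdn : ∀ j, d j ≤ N.n := fun j => by
    rcases le_total i j with h | h
    · exact (hda j h).le
    · exact (hd h).trans (hda i le_rfl).le
  have hn := N.n_pos
  have hon : ∀ j < min k N.n, N.OnPath (s j) := fun j hj => by
    rcases lt_or_ge j i with h | h
    · exact (hds j h).onPath (by have := hdn (j + 1); omega)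
    · rw [hs j h hj]; exact DynamicPath.onPath_zero
  refine DynamicPath.feasible_of hon hd h0 (hda _ h1) fun j hj hlt => ?_
  rcases lt_or_ge j i with h | h
  · exact hds j h
  · rw [hda j h, hda (j + 1) (by omega)] at hlt
    exact absurd hlt (lt_irrefl _)

/-- For `k ≤ n` a feasible division would end beyond `a`, against maximality. For `k ≥ n` the
situation is impossible, because greedy blocks are nonempty and `n` of them cover the path. -/
theorem not_feasK (h : Greedy N k t s (min k N.n) a) (ha : a < N.n) : ¬ N.FeasK k t := by
  intro hF
  obtain ⟨d, hd, h0, hk, hb⟩ := DynamicPath.feasK_iff.1 hF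
  have h1 := h.maximal d hd h0 hk hb
  have h2 := h.le_left
  rcases le_total k N.n with h3 | h3
  · rw [min_eq_left h3] at h1
    omega
  · rw [min_eq_right h3] at h2
    omega

end Greedy

/-- The number of steps of a test. -/
def testTime (n L : ℕ) : ℕ := (6 * n + 2) * (callTime L + 200)

/-- The memory contains the sinks for an evacuation in the time `t`, or there is none. -/
def Tested (N : DynamicPath) (k : ℕ) (t : ℝ) (σ : Mem) : Prop :=
  σ.nreg 55 = 1 ∧ N.Feasible (output σ (min k N.n)) t ∨ σ.nreg 55 = 0 ∧ ¬ N.FeasK k t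

variable {N : DynamicPath} {k L : ℕ} {σ : Mem} {t : ℝ}

/-- The loop ends because the path is covered or because the sinks are used up; these are the two
alternatives of `Tested`. -/
theorem test_halts (hE : Env N k σ) (hL : N.n + N.n < 2 ^ L) (ht : 0 ≤ t)
    (r50 : σ.rreg 50 = t) :
    Halts test σ (testTime N.n L) (Tested N k t) := by
  obtain ⟨K, hK⟩ : ∃ K, K = callTime L + 200 := ⟨_, rfl⟩
  have e0 : testTime N.n L = 6 * (N.n * K) + 2 * K := by
    rw [testTime, ← hK]; ring
  have hnK : N.n * 200 ≤ N.n * K := Nat.mul_le_mul_left _ (by omega)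
  rw [e0]
  unfold test Halts
  rw [wp_seq, wp_nset]
  refine ⟨by simp; omega, ?_⟩
  rw [wp_seq, wp_nset]
  refine ⟨by simp; omega, ?_⟩
  rw [wp_seq]
  -- A block from `a` to `b` costs at most `b - a` units `K` for the vertices passed, two additional
  -- units for each of the two scans and one for the sink. This is at most `5 * (b + 1 - a)` units.
  refine WP.loop (fun σ' T' => ∃ i a, Env N k σ' ∧ σ'.nreg 50 = i ∧ σ'.nreg 51 = a ∧
    σ'.rreg 50 = t ∧ Greedy N k t (fun j => ⟨σ'.narr 0 j, σ'.rarr 3 j⟩) i a ∧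
    5 * (N.n * K) + 30 * N.n + K ≤ T' + 5 * (a * K)) ?_ ?_
  · refine ⟨0, 0, (hE.setN (by omega)).setN (by omega), by simp, by simp, by simpa, Greedy.zero, ?_⟩
    simp
    omega
  · clear hE r50
    rintro σ T ⟨i, a, hE, n50, n51, r50, hg, hT⟩
    have hann : a * K ≤ N.n * K := Nat.mul_le_mul_right _ hg.le_n
    refine ⟨by simp; omega, fun hc => ?_, fun hc => ?_⟩
    · simp only [BExp.eval_and, BExp.eval_nlt, NExp.eval_reg, n50, n51, hE.n0, hE.n2] at hc
      have hle : a * K + K ≤ N.n * K := by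
        rw [← Nat.succ_mul]; exact Nat.mul_le_mul_right _ hc.1
      rw [wp_seq]
      refine findSink_wp hE hL (K := K) (by omega) n51 hc.1 ht r50 (by simp; omega) ?_
      intro σ₁ T₁ x hs₁ hE₁ n52 hax hxn hcx hcx' hT₁
      simp at hT₁
      have hle₁ : x * K + K ≤ N.n * K := by
        rw [← Nat.succ_mul]; exact Nat.mul_le_mul_right _ hxn
      rw [wp_seq]
      refine findEnd_wp (a := a) hE₁ hL (K := K) (by omega) n52 hxn ht (by rw [hs₁.r 50 rfl, r50])
        (fun h => (hcx' h).2) (by omega) ?_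
      intro σ₂ T₂ b hs₂ hE₂ n53 hxb hbn hV hV' r51 hT₂
      have hle₂ : b * K + K ≤ N.n * K := by
        rw [← Nat.succ_mul]; exact Nat.mul_le_mul_right _ hbn
      have hab : a * K ≤ b * K := Nat.mul_le_mul_right _ (hax.trans hxb)
      have n50' : σ₂.nreg 50 = i := by rw [hs₂.n 50 rfl, hs₁.n 50 rfl, n50]
      rw [wp_seq]
      refine (writeSink_halts hE₂ hL n50' (by rw [hs₂.n 52 rfl, n52]) n53 hax hxb hbn ht
        (by rw [hs₂.r 50 rfl, hs₁.r 50 rfl, r50]) r51 hcx (fun h => (hcx' h).1) hV).wp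
        (by omega) ?_
      rintro σ₃ T₃ hs₃ ⟨f, hev, hna, hra⟩ hT₃
      have hE₃ : Env N k σ₃ := hE₂.same hs₃ rfl
      rw [wp_seq, wp_nset]
      refine ⟨by simp; omega, ?_⟩
      rw [wp_nset]
      have hbK : (b + 1) * K = b * K + K := Nat.succ_mul _ _
      refine ⟨by simp; omega, i + 1, b + 1, (hE₃.setN (by omega)).setN (by omega),
        by simp [hs₃.n 50 rfl, n50'], by simp [hs₃.n 53 rfl, n53],
        by simp [hs₃.r 50 rfl, hs₂.r 50 rfl, hs₁.r 50 rfl, r50], ?_, ?_⟩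
      · refine hg.succ (fun j hj => ?_) hc.2 ht hax hxb hbn hcx (fun h => (hcx' h).1) hV' ?_
        · simp only [Mem.setN_narr, Mem.setN_rarr, hna, hra, Function.update_of_ne hj.ne,
            hs₂.na 0 rfl, hs₂.ra 3 rfl, hs₁.na 0 rfl, hs₁.ra 3 rfl]
        · simp only [Mem.setN_narr, Mem.setN_rarr, hna, hra, Function.update_self]
          exact hev
      · simp
        omega
    · simp only [BExp.eval_and, BExp.eval_nlt, NExp.eval_reg, n50, n51, hE.n0, hE.n2] at hc
      have hres : WP (.ite (.nle (.reg 0) (.reg 51)) (.nset 55 1) (.nset 55 0)) σ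
          (T - ((BExp.and (.nlt (.reg 51) (.reg 0)) (.nlt (.reg 50) (.reg 2))).cost + 1))
          fun σ' T' => Env N k σ' ∧ σ'.nreg 50 = i ∧ σ'.narr = σ.narr ∧ σ'.rarr = σ.rarr ∧
            (σ'.nreg 55 = 1 ∧ a = N.n ∨ σ'.nreg 55 = 0 ∧ i = min k N.n ∧ a < N.n) ∧
            T ≤ T' + 40 := by
        rw [wp_ite]
        have h1 := hg.le_n
        have h2 := hg.le_min
        refine ⟨by simp; omega, fun h => ?_, fun h => ?_⟩
        · simp only [BExp.eval_nle, NExp.eval_reg, n51, hE.n0] at h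
          rw [wp_nset]
          refine ⟨by simp; omega, hE.setN (by omega), by simpa, by simp, by simp,
            Or.inl ⟨by simp, by omega⟩, ?_⟩
          simp
          omega
        · simp only [BExp.eval_nle, NExp.eval_reg, n51, hE.n0] at h
          rw [wp_nset]
          refine ⟨by simp; omega, hE.setN (by omega), by simpa, by simp, by simp,
            Or.inr ⟨by simp, by omega, by omega⟩, ?_⟩
          simp
          omega
      obtain ⟨T₁, σ₁, hr₁, hle₁, hE₁, n50', hna, hra, hres, hT₁⟩ := hres
      refine wp_seq.2 ⟨T₁, σ₁, hr₁, hle₁, ?_⟩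
      have hin := hg.le_min
      refine WP.loop (fun σ' T' => ∃ j, Env N k σ' ∧ σ'.nreg 50 = j ∧ i ≤ j ∧ j ≤ min k N.n ∧
        σ'.nreg 55 = σ₁.nreg 55 ∧ (∀ q < i, σ'.narr 0 q = σ.narr 0 q ∧ σ'.rarr 3 q = σ.rarr 3 q) ∧
        (∀ q, i ≤ q → q < j → σ'.narr 0 q = 0 ∧ σ'.rarr 3 q = 0) ∧
        20 * (N.n - j) + 20 ≤ T') ?_ ?_
      · exact ⟨i, hE₁, n50', le_rfl, hg.le_min, rfl, fun q _ => by rw [hna, hra]; exact ⟨rfl, rfl⟩,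
          fun q h1 h2 => absurd (h1.trans_lt h2) (lt_irrefl _), by omega⟩
      · clear hT₁ hE₁ n50' hE hle₁
        rintro σ' T' ⟨j, hE, n50', hij, hjn, n55, hlow, hhigh, hT'⟩
        refine ⟨by simp; omega, fun h => ?_, fun h => ?_⟩
        · simp only [BExp.eval_nlt, NExp.eval_reg, n50', hE.n2] at h
          have hjn : j < N.n := by omega
          rw [wp_seq, wp_nstore]
          refine ⟨by simp; omega, ?_⟩
          rw [wp_seq, wp_rstore]
          refine ⟨by simp; omega, ?_⟩
          rw [wp_nset]
          refine ⟨by simp; omega, j + 1, ?_, by simp [n50'], by omega, h, by simpa,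
            fun q hq => ?_, fun q hq hq' => ?_, ?_⟩
          · exact ((hE.stN (by omega)).stR (by omega)).setN (by omega)
          · have := hlow q hq
            have hne : q ≠ j := by omega
            simpa [n50', Function.update_of_ne hne] using this
          · rcases eq_or_ne q j with rfl | hne
            · simp [n50']
            · have := hhigh q hq (by omega)
              simpa [n50', Function.update_of_ne hne] using this
          · simp
            omega
        · simp only [BExp.eval_nlt, NExp.eval_reg, n50', hE.n2, not_lt] at h
          rw [Tested, n55]
          refine hres.imp (fun ⟨h1, h2⟩ => ⟨h1, ?_⟩) fun ⟨h1, h2, h3⟩ => ⟨h1, ?_⟩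
          · rw [h2] at hg
            refine (hg.congr (s' := fun j => ⟨σ'.narr 0 j, σ'.rarr 3 j⟩) fun q hq => ?_).feasible
              fun q hq hq' => ?_
            · rw [(hlow q hq).1, (hlow q hq).2]
            · rw [(hhigh q hq (by omega)).1, (hhigh q hq (by omega)).2]
          · rw [h2] at hg
            exact hg.not_feasK h3

end RealRAM

namespace RealRAM

/-! ## Sorting -/

/-- `K` is sorted on the positions `s, …, e - 1`. -/
def SortedOn (K : ℕ → ℝ) (s e : ℕ) : Prop := ∀ p q, s ≤ p → p ≤ q → q < e → K p ≤ K q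

/-- The sum of the weights on the positions `s, …, e - 1`, multiplied by a function of the keys. -/
def wsum (φ : ℝ → ℕ) (K : ℕ → ℝ) (wt : ℕ → ℕ) (s e : ℕ) : ℕ :=
  ∑ q ∈ Finset.Ico s e, φ (K q) * wt q

section

variable {φ : ℝ → ℕ} {K K' : ℕ → ℝ} {wt wt' : ℕ → ℕ} {s m e : ℕ}

theorem wsum_self : wsum φ K wt s s = 0 := by simp [wsum]

theorem wsum_succ (h : s ≤ e) : wsum φ K wt s (e + 1) = wsum φ K wt s e + φ (K e) * wt e :=
  Finset.sum_Ico_succ_top h _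

theorem wsum_append (h1 : s ≤ m) (h2 : m ≤ e) :
    wsum φ K wt s m + wsum φ K wt m e = wsum φ K wt s e :=
  Finset.sum_Ico_consecutive _ h1 h2

theorem wsum_congr (h : ∀ q, s ≤ q → q < e → K' q = K q ∧ wt' q = wt q) :
    wsum φ K' wt' s e = wsum φ K wt s e := by
  refine Finset.sum_congr rfl fun q hq => ?_
  obtain ⟨h1, h2⟩ := Finset.mem_Ico.1 hq
  rw [(h q h1 h2).1, (h q h1 h2).2]

theorem SortedOn.congr (h : SortedOn K s e) (hK : ∀ q, s ≤ q → q < e → K' q = K q) :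
    SortedOn K' s e := fun p q h1 h2 h3 => by
  rw [hK p h1 (by omega), hK q (by omega) h3]
  exact h p q h1 h2 h3

end

/-- Merge the two runs of length `nreg 61` from `nreg 62` on into the auxiliary arrays. -/
def mergeRuns : Cmd :=
  .nset 63 (.reg 60 - (.reg 60 - (.reg 62 + .reg 61))) ;;
  .nset 64 (.reg 60 - (.reg 60 - (.reg 62 + .reg 61 + .reg 61))) ;;
  .nset 65 (.reg 62) ;; .nset 66 (.reg 63) ;; .nset 67 (.reg 62) ;;
  .loop (.nlt (.reg 67) (.reg 64))
    (.ite (.and (.nlt (.reg 65) (.reg 63))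
        (.not (.and (.nlt (.reg 66) (.reg 64)) (.rlt (.arr 20 (.reg 66)) (.arr 20 (.reg 65))))))
      (.rstore 21 (.reg 67) (.arr 20 (.reg 65)) ;; .nstore 21 (.reg 67) (.arr 20 (.reg 65)) ;;
       .nset 65 (.reg 65 + 1) ;; .nset 67 (.reg 67 + 1))
      (.rstore 21 (.reg 67) (.arr 20 (.reg 66)) ;; .nstore 21 (.reg 67) (.arr 20 (.reg 66)) ;;
       .nset 66 (.reg 66 + 1) ;; .nset 67 (.reg 67 + 1)))

/-- The state of a merge of the runs `s, …, m - 1` and `m, …, e - 1` of `K` into `X`, of which the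
first `i - s` and `j - m` elements have been merged. -/
structure Merged (K : ℕ → ℝ) (wt : ℕ → ℕ) (X : ℕ → ℝ) (xt : ℕ → ℕ) (s m e i j k : ℕ) : Prop where
  si : s ≤ i
  im : i ≤ m
  mj : m ≤ j
  je : j ≤ e
  k_eq : k + m = i + j
  sorted : SortedOn X s k
  le₁ : ∀ q p, s ≤ q → q < k → i ≤ p → p < m → X q ≤ K p
  le₂ : ∀ q p, s ≤ q → q < k → j ≤ p → p < e → X q ≤ K p
  sum : ∀ φ, wsum φ X xt s k = wsum φ K wt s i + wsum φ K wt m j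

namespace Merged

variable {K X : ℕ → ℝ} {wt xt : ℕ → ℕ} {s m e i j k : ℕ}

theorem init (h1 : s ≤ m) (h2 : m ≤ e) : Merged K wt X xt s m e s m s :=
  ⟨le_rfl, h1, le_rfl, h2, rfl, fun _ _ _ _ _ => by omega, fun _ _ _ _ _ => by omega,
    fun _ _ _ _ _ => by omega, fun φ => by simp only [wsum_self]⟩

theorem sortedOn_update (h : SortedOn X s k) {v : ℝ} (hv : ∀ q, s ≤ q → q < k → X q ≤ v) :
    SortedOn (Function.update X k v) s (k + 1) := by
  intro p q h1 h2 h3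
  rcases Nat.lt_succ_iff_lt_or_eq.1 h3 with h4 | rfl
  · rw [Function.update_of_ne (by omega), Function.update_of_ne (by omega)]
    exact h p q h1 h2 h4
  · rcases eq_or_lt_of_le h2 with rfl | h4
    · exact le_rfl
    · rw [Function.update_self, Function.update_of_ne (by omega)]
      exact hv p h1 h4

theorem wsum_update {φ : ℝ → ℕ} {v : ℝ} {u : ℕ} (h : s ≤ k) :
    wsum φ (Function.update X k v) (Function.update xt k u) s (k + 1) =
      wsum φ X xt s k + φ v * u := by
  rw [wsum_succ h, Function.update_self, Function.update_self]
  congr 1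
  refine wsum_congr fun q h1 h2 => ?_
  rw [Function.update_of_ne (by omega), Function.update_of_ne (by omega)]
  exact ⟨rfl, rfl⟩

theorem le_update {v u : ℝ} {q : ℕ} (hq : q < k + 1) (h : q < k → X q ≤ u) (hv : v ≤ u) :
    Function.update X k v q ≤ u := by
  rcases Nat.lt_succ_iff_lt_or_eq.1 hq with h4 | rfl
  · rw [Function.update_of_ne (by omega)]
    exact h h4
  · rwa [Function.update_self]

theorem left (h : Merged K wt X xt s m e i j k) (h1 : SortedOn K s m) (h2 : SortedOn K m e)
    (hi : i < m) (hj : j < e → K i ≤ K j) :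
    Merged K wt (Function.update X k (K i)) (Function.update xt k (wt i)) s m e (i + 1) j
      (k + 1) := by
  obtain ⟨si, im, mj, je, ke, hs, l1, l2, hsum⟩ := h
  refine ⟨by omega, hi, mj, je, by omega, sortedOn_update hs fun q h3 h4 => l1 q i h3 h4 le_rfl hi,
    fun q p h3 h4 h5 h6 => ?_, fun q p h3 h4 h5 h6 => ?_, fun φ => ?_⟩
  · exact le_update h4 (fun h => l1 q p h3 h (by omega) h6) (h1 _ _ si (by omega) h6)
  · exact le_update h4 (fun h => l2 q p h3 h h5 h6)
      ((hj (by omega)).trans (h2 _ _ mj h5 h6))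
  · rw [wsum_update (by omega), hsum, wsum_succ si]
    omega

theorem right (h : Merged K wt X xt s m e i j k) (h1 : SortedOn K s m) (h2 : SortedOn K m e)
    (hj : j < e) (hi : i < m → K j ≤ K i) :
    Merged K wt (Function.update X k (K j)) (Function.update xt k (wt j)) s m e i (j + 1)
      (k + 1) := by
  obtain ⟨si, im, mj, je, ke, hs, l1, l2, hsum⟩ := h
  refine ⟨si, im, by omega, hj, by omega, sortedOn_update hs fun q h3 h4 => l2 q j h3 h4 le_rfl hj,
    fun q p h3 h4 h5 h6 => ?_, fun q p h3 h4 h5 h6 => ?_, fun φ => ?_⟩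
  · exact le_update h4 (fun h => l1 q p h3 h h5 h6)
      ((hi (by omega)).trans (h1 _ _ si h5 h6))
  · exact le_update h4 (fun h => l2 q p h3 h (by omega) h6) (h2 _ _ mj (by omega) h6)
  · rw [wsum_update (by omega), hsum, wsum_succ mj]
    omega

end Merged

theorem mergeRuns_halts {σ : Mem} {N w s m e : ℕ} (h60 : σ.nreg 60 = N) (h61 : σ.nreg 61 = w)
    (h62 : σ.nreg 62 = s) (hs : s ≤ N) (hm : m = min (s + w) N) (he : e = min (s + w + w) N)
    (h1 : SortedOn (σ.rarr 20) s m) (h2 : SortedOn (σ.rarr 20) m e) :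
    Halts mergeRuns σ (80 * (e - s) + 60) fun σ' =>
      (∀ q < s, σ'.rarr 21 q = σ.rarr 21 q ∧ σ'.narr 21 q = σ.narr 21 q) ∧
      SortedOn (σ'.rarr 21) s e ∧
      ∀ φ, wsum φ (σ'.rarr 21) (σ'.narr 21) s e = wsum φ (σ.rarr 20) (σ.narr 20) s e := by
  unfold mergeRuns Halts
  -- Truncated subtraction applied twice computes a minimum without a branch.
  have em : N - (N - (s + w)) = m := by omega
  have ee : N - (N - (s + w + w)) = e := by omega
  rw [wp_seq, wp_nset]
  refine ⟨by simp, ?_⟩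
  rw [wp_seq, wp_nset]
  refine ⟨by simp, ?_⟩
  rw [wp_seq, wp_nset]
  refine ⟨by simp, ?_⟩
  rw [wp_seq, wp_nset]
  refine ⟨by simp, ?_⟩
  rw [wp_seq, wp_nset]
  refine ⟨by simp, ?_⟩
  refine WP.loop (fun σ' T' => ∃ i j k, σ'.nreg 63 = m ∧ σ'.nreg 64 = e ∧ σ'.nreg 65 = i ∧
    σ'.nreg 66 = j ∧ σ'.nreg 67 = k ∧ σ'.rarr 20 = σ.rarr 20 ∧ σ'.narr 20 = σ.narr 20 ∧
    (∀ q < s, σ'.rarr 21 q = σ.rarr 21 q ∧ σ'.narr 21 q = σ.narr 21 q) ∧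
    Merged (σ.rarr 20) (σ.narr 20) (σ'.rarr 21) (σ'.narr 21) s m e i j k ∧
    80 * (e - k) + 10 ≤ T') ?_ ?_
  · refine ⟨s, m, s, ?_, ?_, ?_, ?_, ?_, by simp, by simp, by simp,
      Merged.init (by omega) (by omega), ?_⟩
    · simp [h60, h61, h62, em]
    · simp [h60, h61, h62, ee]
    · simp [h62]
    · simp [h60, h61, h62, em]
    · simp [h62]
    · simp
  · rintro σ' T' ⟨i, j, k, n63, n64, n65, n66, n67, hK, hwt, hlow, hM, hT'⟩
    have hke := hM.k_eq
    have hsi := hM.si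
    have him := hM.im
    have hmj := hM.mj
    have hje := hM.je
    refine ⟨by simp; omega, fun hc => ?_, fun hc => ?_⟩
    · simp only [BExp.eval_nlt, NExp.eval_reg, n67, n64] at hc
      rw [wp_ite]
      refine ⟨by simp; omega, fun h => ?_, fun h => ?_⟩
      · simp only [BExp.eval_and, BExp.eval_nlt, BExp.eval_not, BExp.eval_rlt, RExp.eval_arr,
          NExp.eval_reg, n63, n64, n65, n66, hK] at h
        simp only [wp_seq, wp_rstore, wp_nstore, wp_nset]
        refine ⟨by simp; omega, by simp; omega, by simp; omega, by simp; omega,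
          i + 1, j, k + 1, by simpa, by simpa, by simp [n65], by simpa, by simp [n67], by simpa,
          by simpa, fun q hq => ?_, ?_, ?_⟩
        · have hne : q ≠ k := by omega
          simpa [n67, Function.update_of_ne hne] using hlow q hq
        · have := hM.left h1 h2 h.1 fun hj => not_lt.1 fun hlt => h.2 ⟨hj, hlt⟩
          simpa [n67, n65, hK, hwt] using this
        · simp
          omega
      · simp only [BExp.eval_and, BExp.eval_nlt, BExp.eval_not, BExp.eval_rlt, RExp.eval_arr,
          NExp.eval_reg, n63, n64, n65, n66, hK, not_and] at h
        simp only [wp_seq, wp_rstore, wp_nstore, wp_nset]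
        refine ⟨by simp; omega, by simp; omega, by simp; omega, by simp; omega,
          i, j + 1, k + 1, by simpa, by simpa, by simpa, by simp [n66], by simp [n67], by simpa,
          by simpa, fun q hq => ?_, ?_, ?_⟩
        · have hne : q ≠ k := by omega
          simpa [n67, Function.update_of_ne hne] using hlow q hq
        · have := hM.right h1 h2 (by
            by_contra hj
            exact h (by omega) fun h => absurd h hj) fun hi =>
              (not_lt.1 fun hlt => h hi fun _ => not_lt.2 hlt.le)
          simpa [n67, n66, hK, hwt] using this
        · simp
          omega
    · simp only [BExp.eval_nlt, NExp.eval_reg, n67, n64] at hc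
      obtain rfl : i = m := by omega
      obtain rfl : j = e := by omega
      obtain rfl : k = j := by omega
      refine ⟨hlow, hM.sorted, fun φ => ?_⟩
      rw [hM.sum, wsum_append hsi hmj]

/-- Copy the auxiliary arrays back. -/
def copyBack : Cmd :=
  .nset 67 0 ;;
  .loop (.nlt (.reg 67) (.reg 60))
    (.rstore 20 (.reg 67) (.arr 21 (.reg 67)) ;; .nstore 20 (.reg 67) (.arr 21 (.reg 67)) ;;
     .nset 67 (.reg 67 + 1))

theorem copyBack_halts {σ : Mem} {N : ℕ} (h60 : σ.nreg 60 = N) :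
    Halts copyBack σ (30 * N + 20) fun σ' =>
      ∀ q < N, σ'.rarr 20 q = σ.rarr 21 q ∧ σ'.narr 20 q = σ.narr 21 q := by
  unfold copyBack Halts
  rw [wp_seq, wp_nset]
  refine ⟨by simp, ?_⟩
  refine WP.loop (fun σ' T' => ∃ k, σ'.nreg 60 = N ∧ σ'.nreg 67 = k ∧ k ≤ N ∧
    σ'.rarr 21 = σ.rarr 21 ∧ σ'.narr 21 = σ.narr 21 ∧
    (∀ q < k, σ'.rarr 20 q = σ.rarr 21 q ∧ σ'.narr 20 q = σ.narr 21 q) ∧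
    30 * (N - k) + 10 ≤ T') ?_ ?_
  · refine ⟨0, by simpa, by simp, Nat.zero_le _, by simp, by simp,
      fun _ h => absurd h (Nat.not_lt_zero _), ?_⟩
    simp
  · rintro σ' T' ⟨k, n60, n67, hkN, e1, e2, hlow, hT'⟩
    refine ⟨by simp; omega, fun hc => ?_, fun hc => ?_⟩
    · simp only [BExp.eval_nlt, NExp.eval_reg, n67, n60] at hc
      simp only [wp_seq, wp_rstore, wp_nstore, wp_nset]
      refine ⟨by simp; omega, by simp; omega, by simp; omega, k + 1, by simpa,
        by simp [n67], hc, by simpa, by simpa, fun q hq => ?_, ?_⟩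
      · rcases eq_or_ne q k with rfl | hne
        · simp [n67, e1, e2]
        · simpa [n67, Function.update_of_ne hne] using hlow q (by omega)
      · simp
        omega
    · simp only [BExp.eval_nlt, NExp.eval_reg, n67, n60] at hc
      intro q hq
      exact hlow q (by omega)

/-- `K` consists of sorted runs of length `w`. -/
def Runs (K : ℕ → ℝ) (w N : ℕ) : Prop := ∀ r, SortedOn K (r * w) (min (r * w + w) N)

/-- Sort the keys in the real array `20`, together with their weights. -/
def sort : Cmd :=
  .nset 61 1 ;;
  .loop (.nlt (.reg 61) (.reg 60))
    (.nset 62 0 ;;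
     .loop (.nlt (.reg 62) (.reg 60)) (mergeRuns ;; .nset 62 (.reg 62 + .reg 61 + .reg 61)) ;;
     copyBack ;; .nset 61 (.reg 61 + .reg 61))

/-- Bottom-up merge sort. That keys are permuted together with their weights is expressed by the
invariance of `wsum φ` for all `φ`; the median argument needs only such sums, and no permutation has
to be tracked. -/
theorem sort_halts {σ : Mem} {N L : ℕ} (h60 : σ.nreg 60 = N) (hL : N ≤ 2 ^ L) :
    Halts sort σ (L * (200 * N + 100) + 20) fun σ' => SortedOn (σ'.rarr 20) 0 N ∧
      ∀ φ, wsum φ (σ'.rarr 20) (σ'.narr 20) 0 N = wsum φ (σ.rarr 20) (σ.narr 20) 0 N := by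
  unfold sort Halts
  obtain ⟨K, hK⟩ : ∃ K, K = 200 * N + 100 := ⟨_, rfl⟩
  rw [← hK, wp_seq, wp_nset]
  refine ⟨by simp, ?_⟩
  refine WP.loop (fun σ' T' => ∃ h, σ'.nreg 60 = N ∧ σ'.nreg 61 = 2 ^ h ∧ h ≤ L ∧
    Runs (σ'.rarr 20) (2 ^ h) N ∧
    (∀ φ, wsum φ (σ'.rarr 20) (σ'.narr 20) 0 N = wsum φ (σ.rarr 20) (σ.narr 20) 0 N) ∧
    (L - h) * K + 10 ≤ T') ?_ ?_
  · refine ⟨0, by simpa, by simp, Nat.zero_le _, fun r p q h1 h2 h3 => ?_, by simp, ?_⟩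
    · obtain rfl : p = q := by omega
      exact le_rfl
    · simp
  · clear h60
    rintro σ₀ T₀ ⟨h, n60, n61, hhL, hR, hsum, hT₀⟩
    refine ⟨by simp; omega, fun hc => ?_, fun hc => ?_⟩
    · simp only [BExp.eval_nlt, NExp.eval_reg, n60, n61] at hc
      have hlt : h < L := (Nat.pow_lt_pow_iff_right (a := 2) (by norm_num)).1 (by omega)
      have e1 : (L - h) * K = (L - (h + 1)) * K + K := by
        rw [show L - h = L - (h + 1) + 1 by omega, add_mul, one_mul]
      obtain ⟨w, hw⟩ : ∃ w, w = 2 ^ h := ⟨_, rfl⟩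
      have hw0 : 0 < w := hw ▸ Nat.two_pow_pos h
      have hw2 : 2 ^ (h + 1) = w + w := by rw [pow_succ, ← hw]; ring
      rw [← hw] at n61 hR
      rw [wp_seq, wp_nset]
      refine ⟨by simp; omega, ?_⟩
      rw [wp_seq]
      refine WP.loop (fun σ' T' => ∃ r, σ'.nreg 60 = N ∧ σ'.nreg 61 = w ∧
        σ'.nreg 62 = r * (w + w) ∧ σ'.rarr 20 = σ₀.rarr 20 ∧ σ'.narr 20 = σ₀.narr 20 ∧
        (∀ r' < r, SortedOn (σ'.rarr 21) (r' * (w + w)) (min (r' * (w + w) + (w + w)) N)) ∧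
        (∀ φ, wsum φ (σ'.rarr 21) (σ'.narr 21) 0 (min (r * (w + w)) N) =
          wsum φ (σ₀.rarr 20) (σ₀.narr 20) 0 (min (r * (w + w)) N)) ∧
        (L - (h + 1)) * K + 30 * N + 50 + 160 * (N - r * (w + w)) ≤ T') ?_ ?_
      · refine ⟨0, by simpa, by simpa, by simp, by simp, by simp,
          fun _ h => absurd h (Nat.not_lt_zero _), fun φ => ?_, ?_⟩
        · simp [wsum_self]
        · simp
          omega
      · rintro σ₁ T₁ ⟨r, n60, n61, n62, e20, e20', hsort, hsum₁, hT₁⟩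
        refine ⟨by simp; omega, fun hc' => ?_, fun hc' => ?_⟩
        · simp only [BExp.eval_nlt, NExp.eval_reg, n60, n62] at hc'
          have er : (r + 1) * (w + w) = r * (w + w) + w + w := by ring
          have hr1 := hR (r + r)
          have hr2 := hR (r + r + 1)
          rw [show (r + r) * w = r * (w + w) by ring] at hr1
          rw [show (r + r + 1) * w = r * (w + w) + w by ring] at hr2
          rw [wp_seq]
          refine (mergeRuns_halts n60 n61 n62 hc'.le rfl rfl (by rwa [e20]) ?_).wp
            (by simp; omega) ?_
          · rw [e20]
            intro p q h1 h2 h3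
            exact hr2 p q (by omega) h2 h3
          rintro σ₂ T₂ hs ⟨hlow, hnew, hsum₂⟩ hT₂
          simp at hT₂
          rw [wp_nset]
          refine ⟨by simp; omega, r + 1, by simp [hs.n 60 rfl, n60], by simp [hs.n 61 rfl, n61],
            by simp [hs.n 62 rfl, hs.n 61 rfl, n61, n62, er], by simp [hs.ra 20 rfl, e20],
            by simp [hs.na 20 rfl, e20'], fun r' hr' => ?_, fun φ => ?_, ?_⟩
          · simp only [Mem.setN_rarr]
            rcases Nat.lt_succ_iff_lt_or_eq.1 hr' with h4 | rfl
            · have h5 : (r' + 1) * (w + w) ≤ r * (w + w) := Nat.mul_le_mul_right _ h4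
              rw [Nat.succ_mul] at h5
              exact (hsort r' h4).congr fun q _ hq => (hlow q (by omega)).1
            · rwa [← add_assoc]
          · simp only [Mem.setN_rarr, Mem.setN_narr]
            have h3 : min (r * (w + w)) N = r * (w + w) := by omega
            have h4 := hsum₁ φ
            have h5 := hsum₂ φ
            rw [h3] at h4
            rw [er, ← wsum_append (m := r * (w + w)) (Nat.zero_le _) (by omega),
              ← wsum_append (m := r * (w + w)) (K := σ₀.rarr 20) (Nat.zero_le _) (by omega), h5,
              e20, e20', ← h4]
            congr 1
            exact wsum_congr fun q _ hq => hlow q hq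
          · simp
            omega
        · simp only [BExp.eval_nlt, NExp.eval_reg, n60, n62] at hc'
          rw [wp_seq]
          refine (copyBack_halts n60).wp (by simp; omega) ?_
          rintro σ₂ T₂ hs hcopy hT₂
          simp at hT₂
          rw [wp_nset]
          refine ⟨by simp; omega, h + 1, by simp [hs.n 60 rfl, n60],
            by simp [hs.n 61 rfl, n61, hw2], hlt, fun r' => ?_, fun φ => ?_, ?_⟩
          · simp only [Mem.setN_rarr, hw2]
            rcases lt_or_ge r' r with h4 | h4
            · exact (hsort r' h4).congr fun q _ hq => (hcopy q (by omega)).1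
            · have h5 : r * (w + w) ≤ r' * (w + w) := Nat.mul_le_mul_right _ h4
              intro p q h1 h2 h3
              omega
          · simp only [Mem.setN_rarr, Mem.setN_narr]
            have h3 : min (r * (w + w)) N = N := by omega
            have h4 := hsum₁ φ
            rw [h3] at h4
            rw [← hsum φ, ← h4]
            exact wsum_congr fun q _ hq => hcopy q hq
          · simp
            omega
    · simp only [BExp.eval_nlt, NExp.eval_reg, n60, n61] at hc
      refine ⟨?_, hsum⟩
      have h1 := hR 0
      rw [zero_mul, zero_add, min_eq_right (by omega)] at h1
      exact h1

end RealRAM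

namespace RealRAM

/-! ## Searching in sorted rows -/

theorem Same.trans {c c' : Cmd} {σ σ' σ'' : Mem} (h : Same c σ σ') (h' : Same c' σ' σ'')
    (hN : ∀ x, c.wN x = false → c'.wN x = false) (hR : ∀ x, c.wR x = false → c'.wR x = false)
    (hNA : ∀ x, c.wNA x = false → c'.wNA x = false)
    (hRA : ∀ x, c.wRA x = false → c'.wRA x = false) : Same c σ σ'' :=
  ⟨fun x hx => by rw [h'.n x (hN x hx), h.n x hx], fun x hx => by rw [h'.r x (hR x hx), h.r x hx],
    fun x hx => by rw [h'.na x (hNA x hx), h.na x hx],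
    fun x hx => by rw [h'.ra x (hRA x hx), h.ra x hx]⟩

/-- The loop rule for invariants that may use the frame. -/
theorem WP.loop_same {p : Cmd} {σ₀ : Mem} {T₀ : ℕ} {Q : Mem → ℕ → Prop} {b : BExp}
    (I : Mem → ℕ → Prop) (hI : I σ₀ T₀)
    (h : ∀ σ T, Same p σ₀ σ → I σ T → b.cost + 1 ≤ T ∧
      (b.eval σ → WP p σ (T - (b.cost + 1)) I) ∧ (¬ b.eval σ → Q σ (T - (b.cost + 1)))) :
    WP (.loop b p) σ₀ T₀ Q := by
  refine WP.loop (fun σ T => Same p σ₀ σ ∧ I σ T)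
    ⟨⟨fun _ _ => rfl, fun _ _ => rfl, fun _ _ => rfl, fun _ _ => rfl⟩, hI⟩ ?_
  rintro σ T ⟨hs, hI⟩
  obtain ⟨h1, h2, h3⟩ := h σ T hs hI
  refine ⟨h1, fun hb => ?_, h3⟩
  obtain ⟨T', σ', hr, hle, hI'⟩ := h2 hb
  exact ⟨T', σ', hr, hle, hs.trans hr.same (fun _ h => h) (fun _ h => h) (fun _ h => h)
    fun _ h => h, hI'⟩

/-- The value in the row `r` and the column `c`. -/
noncomputable def cell (N : DynamicPath) (mode : ℕ) (X : ℕ → ℕ) (r c : ℕ) : ℝ :=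
  if mode = 0 then N.profile.cost r c else N.edgeCost r (X r) c

section

variable {N : DynamicPath} {k mode L : ℕ} {X : ℕ → ℕ} {σ σ' : Mem} {r c c' : ℕ}

theorem cell_nonneg (h : r ≤ X r) : 0 ≤ cell N mode X r c := by
  unfold cell
  split_ifs
  exacts [Profile.cost_nonneg, DynamicPath.edgeCost_nonneg h]

theorem cell_mono (h : c ≤ c') : cell N mode X r c ≤ cell N mode X r c' := by
  unfold cell
  split_ifs
  exacts [Profile.cost_mono h, DynamicPath.edgeCost_mono h]

/-- The memory contains the data for evaluating the cells. -/
structure CellEnv (N : DynamicPath) (k mode : ℕ) (X : ℕ → ℕ) (σ : Mem) : Prop where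
  env : Env N k σ
  n5 : σ.nreg 5 = mode
  edges : mode ≠ 0 → ∀ r < N.n, σ.narr 32 r = X r
  bounds : ∀ r < N.n, r ≤ X r ∧ X r < N.n

namespace CellEnv

theorem same {c : Cmd} (h : CellEnv N k mode X σ) (hs : Same c σ σ')
    (hc : ((List.range 5).all fun x => !c.wN x) && ((List.range 10).all fun A =>
      !c.wNA (10 + A) && !c.wRA (10 + A)) = true) (h5 : c.wN 5 = false)
    (h32 : c.wNA 32 = false) : CellEnv N k mode X σ' :=
  ⟨h.env.same hs hc, by rw [hs.n 5 h5, h.n5], by rw [hs.na 32 h32]; exact h.edges, h.bounds⟩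

end CellEnv

/-- Compute the value in the row `nreg 70` and the column `nreg 73` in the real register `20`. -/
def evalCell : Cmd :=
  .ite (.nle 1 (.reg 5))
    (callCost (.reg 70) (.arr 32 (.reg 70) + 1) ;;
     .rset 70 (.reg 20 - (.arr 11 (.arr 32 (.reg 70) + 1) - .arr 11 (.arr 32 (.reg 70)))) ;;
     callCost (.reg 3 - 1 - .reg 73) (.reg 3 - 1 - .arr 32 (.reg 70)) ;;
     .ite (.rlt (.reg 70) (.reg 20)) (.rset 20 ((.reg 70 + .reg 20) / 2)) .skip)
    (callCost (.reg 70) (.reg 73))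

theorem evalCell_halts (hE : CellEnv N k mode X σ) (hL : N.n + N.n < 2 ^ L)
    (h70 : σ.nreg 70 = r) (h73 : σ.nreg 73 = c) (hr : r < N.n) (hc : X r ≤ c) (hcn : c < N.n) :
    Halts evalCell σ (2 * callTime L + 70) fun σ' => σ'.rreg 20 = cell N mode X r c := by
  obtain ⟨hE, n5, hX, hb⟩ := hE
  have hrX := (hb r hr).1
  unfold evalCell Halts
  rw [wp_ite]
  refine ⟨by simp, fun h => ?_, fun h => ?_⟩
  · simp only [BExp.eval_nle, NExp.eval_one, NExp.eval_reg, n5] at h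
    have hXr := hX (by omega) r hr
    rw [cell, if_neg (by omega)]
    rw [wp_seq]
    refine callCost_wp hE hL h70 (x := X r + 1) (by simp [h70, hXr]) (by simp) (by omega)
      (by omega) (by simp; omega) fun σ₁ T₁ hs₁ hE₁ hp hT₁ => ?_
    simp at hT₁
    rw [wp_seq, wp_rset]
    refine ⟨by simp; omega, ?_⟩
    have ht := hE₁.trav (x := X r) (by omega)
    rw [wp_seq]
    refine callCostR_wp hE₁.setR hL (b := c) (by simp [hs₁.n 73 rfl, h73]) (x := X r)
      (by simp [hs₁.n 70 rfl, hs₁.na 32 rfl, h70, hXr]) (by simp) hc (by simp; omega)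
      fun σ₂ T₂ hs₂ hE₂ hp₂ hT₂ => ?_
    simp at hT₂
    have r70 : σ₂.rreg 70 = N.profile.cost r (X r + 1) - N.trav (X r) := by
      rw [hs₂.r 70 rfl]
      simp [hs₁.n 70 rfl, hs₁.na 32 rfl, h70, hXr, hp, ht]
    rw [wp_ite]
    refine ⟨by simp; omega, fun h => ?_, fun h => ?_⟩
    · simp only [BExp.eval_rlt, RExp.eval_reg, r70, hp₂] at h
      rw [wp_rset]
      refine ⟨by simp; omega, ?_⟩
      rw [DynamicPath.edgeCost, min_eq_right (by linarith)]
      simp [r70, hp₂]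
    · simp only [BExp.eval_rlt, RExp.eval_reg, r70, hp₂, not_lt] at h
      rw [wp_skip]
      refine ⟨by simp; omega, ?_⟩
      rw [DynamicPath.edgeCost, min_eq_left (by linarith)]
      exact hp₂
  · simp only [BExp.eval_nle, NExp.eval_one, NExp.eval_reg, n5, not_le, Nat.lt_one_iff] at h
    rw [cell, if_pos h]
    exact callCost_wp hE hL h70 (x := c) (by simp [h73]) (by simp) (by omega) (by omega)
      (by simp; omega) fun σ₁ T₁ hs₁ hE₁ hp hT₁ => hp

/-- The column in the middle of the remaining part of the row `r`. -/
def midCol (LO HI : ℕ → ℕ) (r : ℕ) : ℕ := LO r + (HI r - LO r) / 2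

/-- The number of the remaining cells. -/
def remaining (n : ℕ) (LO HI : ℕ → ℕ) : ℕ := ∑ r ∈ Finset.range n, (HI r - LO r)

/-- Store the weight of the row `nreg 70`, and add it to `nreg 71`. -/
def rowWeight : Cmd :=
  .nset 74 (.arr 31 (.reg 70) - .arr 30 (.reg 70)) ;;
  .nstore 20 (.reg 70) (.reg 74) ;;
  .nset 71 (.reg 71 + .reg 74)

/-- Store the value in the middle of the row `nreg 70`. -/
def rowValue : Cmd :=
  .ite (.nle 1 (.reg 74)) (.nset 73 (.arr 30 (.reg 70) + .half (.reg 74)) ;; evalCell) .skip ;;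
  .rstore 20 (.reg 70) (.reg 20) ;; .rstore 30 (.reg 70) (.reg 20)

/-- Evaluate the cells in the middle of the rows. -/
def fill : Cmd :=
  .nset 70 0 ;; .nset 71 0 ;;
  .loop (.nlt (.reg 70) (.reg 0)) (rowWeight ;; rowValue ;; .nset 70 (.reg 70 + 1))

theorem rowWeight_halts (h70 : σ.nreg 70 = r) : Halts rowWeight σ 20 fun σ' =>
    σ'.nreg 74 = σ.narr 31 r - σ.narr 30 r ∧
    σ'.narr 20 = Function.update (σ.narr 20) r (σ.narr 31 r - σ.narr 30 r) ∧
    σ'.nreg 71 = σ.nreg 71 + (σ.narr 31 r - σ.narr 30 r) := by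
  unfold rowWeight Halts
  simp only [wp_seq, wp_nset, wp_nstore]
  exact ⟨by simp, by simp, by simp, by simp [h70], by simp [h70], by simp [h70]⟩

/-- For an empty row whatever was left in real register `20` is stored. Its weight is `0`, so it
cannot influence the median. -/
theorem rowValue_halts {LO HI : ℕ → ℕ} (hE : CellEnv N k mode X σ) (hL : N.n + N.n < 2 ^ L)
    (h70 : σ.nreg 70 = r) (h74 : σ.nreg 74 = HI r - LO r) (h30 : σ.narr 30 = LO) (hr : r < N.n)
    (hX : X r ≤ LO r) (hn : HI r ≤ N.n) :
    Halts rowValue σ (2 * callTime L + 100) fun σ' => ∃ v,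
      σ'.rarr 20 = Function.update (σ.rarr 20) r v ∧
      σ'.rarr 30 = Function.update (σ.rarr 30) r v ∧
      (LO r < HI r → v = cell N mode X r (midCol LO HI r)) := by
  have hmid : Halts (.ite (.nle 1 (.reg 74))
      (.nset 73 (.arr 30 (.reg 70) + .half (.reg 74)) ;; evalCell) .skip) σ
      (2 * callTime L + 90) fun σ' => LO r < HI r →
        σ'.rreg 20 = cell N mode X r (midCol LO HI r) := by
    unfold Halts
    rw [wp_ite]
    refine ⟨by simp, fun h => ?_, fun h => ?_⟩
    · simp only [BExp.eval_nle, NExp.eval_one, NExp.eval_reg] at h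
      rw [wp_seq, wp_nset]
      refine ⟨by simp, ?_⟩
      refine (evalCell_halts (r := r) (c := midCol LO HI r) (hE.same (Run.same (.nset _ _ _))
        rfl rfl rfl) hL ?_ ?_ hr ?_ ?_).wp ?_ fun σ₃ T₃ _ h _ _ => h
      · simpa using h70
      · simp [midCol, h74, h70, h30]
      · unfold midCol; omega
      · unfold midCol; omega
      · simp
    · simp only [BExp.eval_nle, NExp.eval_one, NExp.eval_reg] at h
      rw [wp_skip]
      exact ⟨by simp, fun _ => by omega⟩
  unfold rowValue Halts
  rw [wp_seq]
  refine hmid.wp (by omega) ?_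
  rintro σ₁ T₁ hs hval hT₁
  rw [wp_seq, wp_rstore]
  refine ⟨by simp; omega, ?_⟩
  rw [wp_rstore]
  refine ⟨by simp; omega, σ₁.rreg 20, ?_, ?_, hval⟩
  · simp [hs.n 70 rfl, h70, hs.ra 20 rfl]
  · simp [hs.n 70 rfl, h70, hs.ra 30 rfl]

/-- The memory contains the values and weights of the cells in the middle of the rows. -/
structure Filled (N : DynamicPath) (mode : ℕ) (X : ℕ → ℕ) (LO HI : ℕ → ℕ) (σ : Mem) (n : ℕ) :
    Prop where
  key : ∀ r < n, LO r < HI r → σ.rarr 20 r = cell N mode X r (midCol LO HI r)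
  value : ∀ r < n, LO r < HI r → σ.rarr 30 r = cell N mode X r (midCol LO HI r)
  weight : ∀ r < n, σ.narr 20 r = HI r - LO r
  total : σ.nreg 71 = remaining n LO HI

/-- Values are stored twice: the sort permutes the real array `20`, while the real array `30` stays
indexed by rows for the subsequent cut. -/
theorem fill_halts {LO HI : ℕ → ℕ} (hE : CellEnv N k mode X σ) (hL : N.n + N.n < 2 ^ L)
    (hLO : σ.narr 30 = LO) (hHI : σ.narr 31 = HI) (hX : ∀ r < N.n, X r ≤ LO r)
    (hn : ∀ r < N.n, HI r ≤ N.n) :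
    Halts fill σ (N.n * (2 * callTime L + 200) + 50) fun σ' => Filled N mode X LO HI σ' N.n := by
  unfold fill Halts
  obtain ⟨K, hK⟩ : ∃ K, K = 2 * callTime L + 200 := ⟨_, rfl⟩
  rw [← hK, wp_seq, wp_nset]
  refine ⟨by simp, ?_⟩
  rw [wp_seq, wp_nset]
  refine ⟨by simp, ?_⟩
  have hE' := (hE.same (Run.same (.nset 70 0 _)) rfl rfl rfl).same (Run.same (.nset 71 0 _))
    rfl rfl rfl
  refine WP.loop_same (fun σ' T' => ∃ r, σ'.nreg 70 = r ∧ r ≤ N.n ∧ Filled N mode X LO HI σ' r ∧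
    (N.n - r) * K + 20 ≤ T') ?_ ?_
  · refine ⟨0, by simp, Nat.zero_le _, ⟨fun _ h => absurd h (Nat.not_lt_zero _),
      fun _ h => absurd h (Nat.not_lt_zero _), fun _ h => absurd h (Nat.not_lt_zero _), by simp [remaining]⟩, ?_⟩
    simp
  · rintro σ₁ T₁ hs ⟨r, n70, hrn, ⟨hkey, hval, hwt, htot⟩, hT₁⟩
    have hE₁ : CellEnv N k mode X σ₁ := hE'.same hs rfl rfl rfl
    have e30 : σ₁.narr 30 = LO := by rw [hs.na 30 rfl]; simpa
    have e31 : σ₁.narr 31 = HI := by rw [hs.na 31 rfl]; simpa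
    refine ⟨by simp; omega, fun hc => ?_, fun hc => ?_⟩
    · simp only [BExp.eval_nlt, NExp.eval_reg, n70, hE₁.env.n0] at hc
      have e1 : (N.n - r) * K = (N.n - (r + 1)) * K + K := by
        rw [show N.n - r = N.n - (r + 1) + 1 by omega, add_mul, one_mul]
      rw [wp_seq]
      refine (rowWeight_halts n70).wp (by simp; omega) ?_
      rintro σ₂ T₂ hs₂ ⟨n74, na20, n71⟩ hT₂
      simp at hT₂
      rw [e30, e31] at n74 na20 n71
      have hE₂ : CellEnv N k mode X σ₂ := hE₁.same hs₂ rfl rfl rfl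
      rw [wp_seq]
      refine (rowValue_halts hE₂ hL (by rw [hs₂.n 70 rfl, n70]) n74 (by rw [hs₂.na 30 rfl, e30]) hc
        (hX r hc) (hn r hc)).wp (by omega) ?_
      rintro σ₃ T₃ hs₃ ⟨v, ra20, ra30, hv⟩ hT₃
      have h70 : σ₃.nreg 70 = r := by rw [hs₃.n 70 rfl, hs₂.n 70 rfl, n70]
      rw [wp_nset]
      refine ⟨by simp; omega, r + 1, by simp [h70], hc,
        ⟨fun q hq hlt => ?_, fun q hq hlt => ?_, fun q hq => ?_, ?_⟩,
        ?_⟩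
      · rw [Mem.setN_rarr, ra20, hs₂.ra 20 rfl]
        rcases eq_or_ne q r with rfl | hne
        · rw [Function.update_self, hv hlt]
        · rw [Function.update_of_ne hne, hkey q (by omega) hlt]
      · rw [Mem.setN_rarr, ra30, hs₂.ra 30 rfl]
        rcases eq_or_ne q r with rfl | hne
        · rw [Function.update_self, hv hlt]
        · rw [Function.update_of_ne hne, hval q (by omega) hlt]
      · rw [Mem.setN_narr, hs₃.na 20 rfl, na20]
        rcases eq_or_ne q r with rfl | hne
        · rw [Function.update_self]
        · rw [Function.update_of_ne hne, hwt q (by omega)]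
      · simp [hs₃.n 71 rfl, n71, htot, remaining, Finset.sum_range_succ]
      · simp
        omega
    · simp only [BExp.eval_nlt, NExp.eval_reg, n70, hE₁.env.n0] at hc
      obtain rfl : r = N.n := by omega
      exact ⟨hkey, hval, hwt, htot⟩

end

end RealRAM

/-! ### Weighted medians and cutting of rows -/

namespace RealRAM

/-- Twice the weight of the keys on either side of `v` is at least the total weight. -/
structure IsMedian (K : ℕ → ℝ) (wt : ℕ → ℕ) (n : ℕ) (v : ℝ) : Prop where
  low : wsum (fun _ => 1) K wt 0 n ≤ 2 * wsum (fun x => if x ≤ v then 1 else 0) K wt 0 n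
  high : wsum (fun _ => 1) K wt 0 n ≤ 2 * wsum (fun x => if v ≤ x then 1 else 0) K wt 0 n
  mem : ∀ φ, wsum φ K wt 0 n = 0 → φ v = 0

/-- Write a weighted median of the sorted keys to `rreg 50`; `nreg 71` is the total weight. -/
def selectMedian : Cmd :=
  .nset 72 0 ;; .nset 74 (.arr 20 0) ;;
  .loop (.nlt (.reg 74 + .reg 74) (.reg 71))
    (.nset 72 (.reg 72 + 1) ;; .nset 74 (.reg 74 + .arr 20 (.reg 72))) ;;
  .rset 50 (.arr 20 (.reg 72))

/-- At `q` the prefix weight first reaches one half. The keys up to `q` are at most `K q`, those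
from `q` on are at least `K q`, and both parts carry half of the weight. -/
theorem isMedian_of_prefix {K : ℕ → ℝ} {wt : ℕ → ℕ} {n q : ℕ} (hK : SortedOn K 0 n) (hq : q < n)
    (h1 : 2 * wsum (fun _ => 1) K wt 0 q < wsum (fun _ => 1) K wt 0 n)
    (h2 : wsum (fun _ => 1) K wt 0 n ≤ 2 * wsum (fun _ => 1) K wt 0 (q + 1)) :
    IsMedian K wt n (K q) := by
  have hs : wsum (fun _ => 1) K wt 0 (q + 1) = wsum (fun _ => 1) K wt 0 q + 1 * wt q :=
    wsum_succ (Nat.zero_le _)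
  refine ⟨h2.trans (Nat.mul_le_mul_left _ ?_), ?_, fun φ hφ => ?_⟩
  · rw [← wsum_append (Nat.zero_le (q + 1)) hq]
    refine le_trans (le_of_eq (Finset.sum_congr rfl fun p hp => ?_)) (Nat.le_add_right _ _)
    have := (Finset.mem_Ico.1 hp).2
    dsimp only
    rw [if_pos (hK p q (Nat.zero_le _) (by omega) hq)]
  · have h3 : wsum (fun _ => 1) K wt q n ≤ wsum (fun x => if K q ≤ x then 1 else 0) K wt 0 n := by
      rw [← wsum_append (Nat.zero_le q) hq.le]
      refine le_trans (le_of_eq (Finset.sum_congr rfl fun p hp => ?_)) (Nat.le_add_left _ _)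
      obtain ⟨h4, h5⟩ := Finset.mem_Ico.1 hp
      dsimp only
      rw [if_pos (hK q p (Nat.zero_le _) h4 h5)]
    have h4 := wsum_append (φ := fun _ => 1) (K := K) (wt := wt) (Nat.zero_le q) hq.le
    omega
  · have h3 : φ (K q) * wt q ≤ wsum φ K wt 0 n :=
      Finset.single_le_sum (f := fun p => φ (K p) * wt p) (fun _ _ => Nat.zero_le _)
        (Finset.mem_Ico.2 ⟨Nat.zero_le _, hq⟩)
    -- The weight at `q` is positive, because the prefix weight crosses one half exactly there.
    rw [hφ, Nat.le_zero, Nat.mul_eq_zero] at h3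
    exact h3.resolve_right (by omega)

theorem selectMedian_halts {σ : Mem} {n : ℕ} (hK : SortedOn (σ.rarr 20) 0 n)
    (h71 : σ.nreg 71 = wsum (fun _ => 1) (σ.rarr 20) (σ.narr 20) 0 n) (h : 1 ≤ σ.nreg 71) :
    Halts selectMedian σ (30 * n + 40) fun σ' =>
      IsMedian (σ.rarr 20) (σ.narr 20) n (σ'.rreg 50) := by
  have hn : 0 < n := by
    rcases Nat.eq_zero_or_pos n with rfl | h0
    · rw [wsum_self] at h71; omega
    · exact h0
  unfold selectMedian Halts
  rw [wp_seq, wp_nset]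
  refine ⟨by simp, ?_⟩
  rw [wp_seq, wp_nset]
  refine ⟨by simp, ?_⟩
  rw [wp_seq]
  refine WP.loop_same (fun σ' T' => ∃ q, q < n ∧ σ'.nreg 72 = q ∧
    σ'.nreg 74 = wsum (fun _ => 1) (σ.rarr 20) (σ.narr 20) 0 (q + 1) ∧
    2 * wsum (fun _ => 1) (σ.rarr 20) (σ.narr 20) 0 q < σ.nreg 71 ∧ 20 * (n - q) + 10 ≤ T') ?_ ?_
  · refine ⟨0, hn, by simp, ?_, ?_, ?_⟩
    · rw [wsum_succ le_rfl, wsum_self]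
      simp
    · rw [wsum_self]; omega
    · simp
      omega
  · rintro σ₁ T₁ hs ⟨q, hq, n72, n74, hlt, hT₁⟩
    have e20 : σ₁.narr 20 = σ.narr 20 := by rw [hs.na 20 rfl]; simp
    have e20' : σ₁.rarr 20 = σ.rarr 20 := by rw [hs.ra 20 rfl]; simp
    have e71 : σ₁.nreg 71 = σ.nreg 71 := by rw [hs.n 71 rfl]; simp
    refine ⟨by simp; omega, fun hc => ?_, fun hc => ?_⟩
    · simp only [BExp.eval_nlt, NExp.eval_add, NExp.eval_reg, n74, e71] at hc
      have hq' : q + 1 < n := by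
        by_contra hq'
        obtain rfl : n = q + 1 := by omega
        omega
      rw [wp_seq, wp_nset]
      refine ⟨by simp; omega, ?_⟩
      rw [wp_nset]
      refine ⟨by simp; omega, q + 1, hq', by simp [n72], ?_, by omega, ?_⟩
      · rw [wsum_succ (Nat.zero_le (q + 1)), ← n74]
        simp [n72, e20]
      · simp
        omega
    · simp only [BExp.eval_nlt, NExp.eval_add, NExp.eval_reg, n74, e71] at hc
      rw [wp_rset]
      refine ⟨by simp; omega, ?_⟩
      simp only [Mem.setR_rreg, RExp.eval_arr, NExp.eval_reg, n72, e20', reduceIte]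
      exact isMedian_of_prefix hK hq (by omega) (by omega)

/-- Cut off the right parts of the rows whose middle value is at least `rreg 50`. -/
def lowerRows : Cmd :=
  .nset 70 0 ;;
  .loop (.nlt (.reg 70) (.reg 0))
    (.ite (.and (.nlt (.arr 30 (.reg 70)) (.arr 31 (.reg 70)))
        (.rle (.reg 50) (.arr 30 (.reg 70))))
      (.nstore 31 (.reg 70) (.arr 30 (.reg 70) +
        .half (.arr 31 (.reg 70) - .arr 30 (.reg 70)))) .skip ;;
     .nset 70 (.reg 70 + 1))

/-- Cut off the left parts of the rows whose middle value is at most `rreg 50`. -/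
def raiseRows : Cmd :=
  .nset 70 0 ;;
  .loop (.nlt (.reg 70) (.reg 0))
    (.ite (.and (.nlt (.arr 30 (.reg 70)) (.arr 31 (.reg 70)))
        (.rle (.arr 30 (.reg 70)) (.reg 50)))
      (.nstore 30 (.reg 70) (.arr 30 (.reg 70) +
        .half (.arr 31 (.reg 70) - .arr 30 (.reg 70)) + 1)) .skip ;;
     .nset 70 (.reg 70 + 1))

section

variable {σ : Mem} {n : ℕ} {LO HI : ℕ → ℕ} {val : ℕ → ℝ} {v : ℝ}

open Classical in
theorem lowerRows_halts (h0 : σ.nreg 0 = n) (h30 : σ.narr 30 = LO) (h31 : σ.narr 31 = HI)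
    (hv : σ.rarr 30 = val) (h50 : σ.rreg 50 = v) :
    Halts lowerRows σ (60 * n + 20) fun σ' => ∀ r < n, σ'.narr 31 r =
      if LO r < HI r ∧ v ≤ val r then midCol LO HI r else HI r := by
  unfold lowerRows Halts
  rw [wp_seq, wp_nset]
  refine ⟨by simp, ?_⟩
  refine WP.loop_same (fun σ' T' => ∃ r, σ'.nreg 70 = r ∧ r ≤ n ∧
    (∀ q, q < r → σ'.narr 31 q = if LO q < HI q ∧ v ≤ val q then midCol LO HI q else HI q) ∧
    (∀ q, r ≤ q → σ'.narr 31 q = HI q) ∧ 60 * (n - r) + 10 ≤ T') ?_ ?_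
  · refine ⟨0, by simp, Nat.zero_le _, fun _ h => absurd h (Nat.not_lt_zero _), by simp [h31], ?_⟩
    simp
  · rintro σ₁ T₁ hs ⟨r, n70, hrn, hlow, hhigh, hT₁⟩
    have e0 : σ₁.nreg 0 = n := by rw [hs.n 0 rfl]; simpa
    have e30 : σ₁.narr 30 = LO := by rw [hs.na 30 rfl]; simpa
    have e30' : σ₁.rarr 30 = val := by rw [hs.ra 30 rfl]; simpa
    have e50 : σ₁.rreg 50 = v := by rw [hs.r 50 rfl]; simpa
    refine ⟨by simp; omega, fun hc => ?_, fun hc => ?_⟩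
    · simp only [BExp.eval_nlt, NExp.eval_reg, n70, e0] at hc
      rw [wp_seq, wp_ite]
      refine ⟨by simp; omega, fun h => ?_, fun h => ?_⟩
      · simp only [BExp.eval_and, BExp.eval_nlt, BExp.eval_rle, NExp.eval_arr, RExp.eval_arr,
          NExp.eval_reg, RExp.eval_reg, n70, e30, e30', e50, hhigh r le_rfl] at h
        rw [wp_nstore]
        refine ⟨by simp; omega, ?_⟩
        rw [wp_nset]
        refine ⟨by simp; omega, r + 1, by simp [n70], hc, fun q hq => ?_, fun q hq => ?_, ?_⟩
        · rcases eq_or_ne q r with rfl | hne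
          · rw [if_pos h]
            simp [n70, e30, hhigh q le_rfl, midCol]
          · rw [← hlow q (by omega)]
            simp [n70, Function.update_of_ne hne]
        · have hne : q ≠ r := by omega
          simp [n70, Function.update_of_ne hne, hhigh q (by omega)]
        · simp
          omega
      · simp only [BExp.eval_and, BExp.eval_nlt, BExp.eval_rle, NExp.eval_arr, RExp.eval_arr,
          NExp.eval_reg, RExp.eval_reg, n70, e30, e30', e50, hhigh r le_rfl] at h
        rw [wp_skip]
        refine ⟨by simp; omega, ?_⟩
        rw [wp_nset]
        refine ⟨by simp; omega, r + 1, by simp [n70], hc, fun q hq => ?_, fun q hq => ?_, ?_⟩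
        · rcases eq_or_ne q r with rfl | hne
          · rw [if_neg h]
            simp [hhigh q le_rfl]
          · rw [← hlow q (by omega)]
            simp
        · simp [hhigh q (by omega)]
        · simp
          omega
    · simp only [BExp.eval_nlt, NExp.eval_reg, n70, e0] at hc
      exact fun q hq => hlow q (by omega)

open Classical in
theorem raiseRows_halts (h0 : σ.nreg 0 = n) (h30 : σ.narr 30 = LO) (h31 : σ.narr 31 = HI)
    (hv : σ.rarr 30 = val) (h50 : σ.rreg 50 = v) :
    Halts raiseRows σ (60 * n + 20) fun σ' => ∀ r < n, σ'.narr 30 r =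
      if LO r < HI r ∧ val r ≤ v then midCol LO HI r + 1 else LO r := by
  unfold raiseRows Halts
  rw [wp_seq, wp_nset]
  refine ⟨by simp, ?_⟩
  refine WP.loop_same (fun σ' T' => ∃ r, σ'.nreg 70 = r ∧ r ≤ n ∧
    (∀ q, q < r → σ'.narr 30 q = if LO q < HI q ∧ val q ≤ v then midCol LO HI q + 1 else LO q) ∧
    (∀ q, r ≤ q → σ'.narr 30 q = LO q) ∧ 60 * (n - r) + 10 ≤ T') ?_ ?_
  · refine ⟨0, by simp, Nat.zero_le _, fun _ h => absurd h (Nat.not_lt_zero _), by simp [h30], ?_⟩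
    simp
  · rintro σ₁ T₁ hs ⟨r, n70, hrn, hlow, hhigh, hT₁⟩
    have e0 : σ₁.nreg 0 = n := by rw [hs.n 0 rfl]; simpa
    have e31 : σ₁.narr 31 = HI := by rw [hs.na 31 rfl]; simpa
    have e30' : σ₁.rarr 30 = val := by rw [hs.ra 30 rfl]; simpa
    have e50 : σ₁.rreg 50 = v := by rw [hs.r 50 rfl]; simpa
    refine ⟨by simp; omega, fun hc => ?_, fun hc => ?_⟩
    · simp only [BExp.eval_nlt, NExp.eval_reg, n70, e0] at hc
      rw [wp_seq, wp_ite]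
      refine ⟨by simp; omega, fun h => ?_, fun h => ?_⟩
      · simp only [BExp.eval_and, BExp.eval_nlt, BExp.eval_rle, NExp.eval_arr, RExp.eval_arr,
          NExp.eval_reg, RExp.eval_reg, n70, e31, e30', e50, hhigh r le_rfl] at h
        rw [wp_nstore]
        refine ⟨by simp; omega, ?_⟩
        rw [wp_nset]
        refine ⟨by simp; omega, r + 1, by simp [n70], hc, fun q hq => ?_, fun q hq => ?_, ?_⟩
        · rcases eq_or_ne q r with rfl | hne
          · rw [if_pos h]
            simp [n70, e31, hhigh q le_rfl, midCol]
          · rw [← hlow q (by omega)]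
            simp [n70, Function.update_of_ne hne]
        · have hne : q ≠ r := by omega
          simp [n70, Function.update_of_ne hne, hhigh q (by omega)]
        · simp
          omega
      · simp only [BExp.eval_and, BExp.eval_nlt, BExp.eval_rle, NExp.eval_arr, RExp.eval_arr,
          NExp.eval_reg, RExp.eval_reg, n70, e31, e30', e50, hhigh r le_rfl] at h
        rw [wp_skip]
        refine ⟨by simp; omega, ?_⟩
        rw [wp_nset]
        refine ⟨by simp; omega, r + 1, by simp [n70], hc, fun q hq => ?_, fun q hq => ?_, ?_⟩
        · rcases eq_or_ne q r with rfl | hne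
          · rw [if_neg h]
            simp [hhigh q le_rfl]
          · rw [← hlow q (by omega)]
            simp
        · simp [hhigh q (by omega)]
        · simp
          omega
    · simp only [BExp.eval_nlt, NExp.eval_reg, n70, e0] at hc
      exact fun q hq => hlow q (by omega)

end

/-- The time `lo` is not feasible, the time `hi` is feasible, and the values to the left of the
columns `LO r` are at most `lo`, those from the columns `HI r` on are at least `hi`. -/
structure Bounds (N : DynamicPath) (k mode : ℕ) (X LO HI : ℕ → ℕ) (lo hi : ℝ) : Prop where
  lo_nonneg : 0 ≤ lo
  not_feasK : ¬ N.FeasK k lo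
  feasK : N.FeasK k hi
  left : ∀ r < N.n, X r < LO r
  le : ∀ r < N.n, LO r ≤ HI r
  right : ∀ r < N.n, HI r ≤ N.n
  low : ∀ r < N.n, ∀ c, X r < c → c < LO r → cell N mode X r c ≤ lo
  high : ∀ r < N.n, ∀ c, HI r ≤ c → c < N.n → hi ≤ cell N mode X r c

section

variable {N : DynamicPath} {k mode : ℕ} {X LO HI LO' HI' : ℕ → ℕ} {lo hi v : ℝ}

-- Rows increase, so once the middle entry is at least the feasible time `v`, all entries to its
-- right are too, and they are settled by the new upper bound `min hi v`.
open Classical in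
theorem Bounds.lower (h : Bounds N k mode X LO HI lo hi) (hv : N.FeasK k v)
    (hHI : ∀ r < N.n, HI' r = if LO r < HI r ∧ v ≤ cell N mode X r (midCol LO HI r) then
      midCol LO HI r else HI r) :
    Bounds N k mode X LO HI' lo (min hi v) := by
  obtain ⟨h1, h2, h3, h4, h5, h6, h7, h8⟩ := h
  refine ⟨h1, h2, ?_, h4, fun r hr => ?_, fun r hr => ?_, h7, fun r hr c hc hcn => ?_⟩
  · rcases min_choice hi v with h | h <;> rw [h] <;> assumption
  · have := h5 r hr
    rw [hHI r hr]
    unfold midCol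
    split_ifs <;> omega
  · have := h6 r hr
    rw [hHI r hr]
    unfold midCol
    split_ifs <;> omega
  · rw [hHI r hr] at hc
    split_ifs at hc with h
    · exact (min_le_right _ _).trans (h.2.trans (cell_mono hc))
    · exact (min_le_left _ _).trans (h8 r hr c hc hcn)

open Classical in
theorem Bounds.raise (h : Bounds N k mode X LO HI lo hi) (hv : ¬ N.FeasK k v)
    (hLO : ∀ r < N.n, LO' r = if LO r < HI r ∧ cell N mode X r (midCol LO HI r) ≤ v then
      midCol LO HI r + 1 else LO r) :
    Bounds N k mode X LO' HI (max lo v) hi := by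
  obtain ⟨h1, h2, h3, h4, h5, h6, h7, h8⟩ := h
  refine ⟨h1.trans (le_max_left _ _), ?_, h3, fun r hr => ?_, fun r hr => ?_, h6,
    fun r hr c hc hcn => ?_, h8⟩
  · rcases max_choice lo v with h | h <;> rw [h] <;> assumption
  · have := h4 r hr
    rw [hLO r hr]
    unfold midCol
    split_ifs <;> omega
  · have := h5 r hr
    rw [hLO r hr]
    unfold midCol
    split_ifs <;> omega
  · rw [hLO r hr] at hcn
    split_ifs at hcn with h
    · exact (cell_mono (Nat.lt_succ_iff.1 hcn)).trans (h.2.trans (le_max_right _ _))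
    · exact (h7 r hr c hc hcn).trans (le_max_left _ _)

/-- Here `φ` marks the rows that are cut. Each of them loses at least half of its entries, and they
carry at least half of all entries, so a quarter of the total disappears. -/
theorem remaining_decrease {n : ℕ} {K : ℕ → ℝ} {φ : ℝ → ℕ} {wt : ℕ → ℕ}
    (hwt : ∀ r < n, wt r = HI r - LO r) (hφ : wsum (fun _ => 1) K wt 0 n ≤ 2 * wsum φ K wt 0 n)
    (h : ∀ r < n, 2 * (HI' r - LO' r) + φ (K r) * wt r ≤ 2 * wt r) :
    4 * remaining n LO' HI' ≤ 3 * remaining n LO HI := by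
  have h1 : remaining n LO HI = wsum (fun _ => 1) K wt 0 n := by
    rw [remaining, wsum, Finset.range_eq_Ico]
    refine Finset.sum_congr rfl fun r hr => ?_
    rw [hwt r (Finset.mem_Ico.1 hr).2, one_mul]
  have h2 : 2 * remaining n LO' HI' + wsum φ K wt 0 n ≤ 2 * wsum (fun _ => 1) K wt 0 n := by
    rw [remaining, wsum, wsum, Finset.range_eq_Ico, Finset.mul_sum, Finset.mul_sum,
      ← Finset.sum_add_distrib]
    refine Finset.sum_le_sum fun r hr => ?_
    rw [one_mul]
    exact h r (Finset.mem_Ico.1 hr).2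
  omega

/-- Since `(3 / 4) ^ 3 < 1 / 2`, the cube of the number of entries halves in each round, and rounds
can be counted by an integral exponent. -/
theorem cube_decrease {a b e : ℕ} (h : 4 * a ≤ 3 * b) (hb : 1 ≤ b) (he : b ^ 3 < 2 ^ e) :
    1 ≤ e ∧ a ^ 3 < 2 ^ (e - 1) := by
  have he1 : 1 ≤ e := by
    by_contra h0
    obtain rfl : e = 0 := by omega
    have := Nat.one_le_pow 3 b hb
    omega
  refine ⟨he1, ?_⟩
  have h1 : (4 * a) ^ 3 ≤ (3 * b) ^ 3 := Nat.pow_le_pow_left h 3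
  rw [mul_pow, mul_pow] at h1
  have h2 : 2 ^ e = 2 * 2 ^ (e - 1) := by
    rw [← pow_succ', Nat.sub_add_cancel he1]
  omega

end

end RealRAM

open DynamicPath in
theorem DynamicPath.FeasK.mono_sinks {N : DynamicPath} {k k' : ℕ} {t : ℝ} (h : N.FeasK k t)
    (hk : k ≤ k') : N.FeasK k' t := by
  obtain ⟨d, hd, h0, hn, hb⟩ := feasK_iff.1 h
  refine feasK_iff.2 ⟨fun j => d (min j k), fun i j hij => hd (by omega), by simpa using h0, ?_,
    fun j hj hlt => ?_⟩
  · dsimp only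
    rw [min_eq_right hk, hn]
  · dsimp only at hlt ⊢
    rcases lt_or_ge j k with h | h
    · rw [min_eq_left h.le, min_eq_left (by omega : j + 1 ≤ k)] at hlt ⊢
      exact hb j h hlt
    · rw [min_eq_right h, min_eq_right (by omega : k ≤ j + 1)] at hlt
      exact absurd hlt (lt_irrefl _)

/-! ### The search for the least feasible time among the entries of the rows -/

namespace RealRAM

/-- Halve many of the rows according to a test of the median of their middle values. -/
def searchRound : Cmd :=
  sort ;; selectMedian ;; test ;;
  .ite (.nle 1 (.reg 55)) (.ite (.rle (.reg 50) (.reg 60)) (.rset 60 (.reg 50)) .skip ;; lowerRows)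
    raiseRows ;;
  fill

/-- Compare all values in the rows with the least feasible time; `rreg 60` is a feasible time. -/
def search : Cmd :=
  .nset 60 (.reg 0) ;; fill ;; .loop (.nle 1 (.reg 71)) searchRound

/-- The number of steps of a round of the search. -/
def roundTime (n L : ℕ) : ℕ :=
  L * (200 * n + 100) + testTime n L + n * (2 * callTime L + 400) + 300

variable {N : DynamicPath} {k mode L : ℕ} {X LO HI : ℕ → ℕ} {σ : Mem} {lo : ℝ}

theorem Tested.feasK {t : ℝ} (h : Tested N k t σ) (h1 : 1 ≤ σ.nreg 55) : N.FeasK k t := by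
  rcases h with ⟨-, h⟩ | ⟨h, -⟩
  · exact DynamicPath.FeasK.mono_sinks ⟨_, h⟩ (min_le_left _ _)
  · omega

theorem Tested.not_feasK {t : ℝ} (h : Tested N k t σ) (h1 : ¬ 1 ≤ σ.nreg 55) :
    ¬ N.FeasK k t := by
  rcases h with ⟨h, -⟩ | ⟨-, h⟩
  · omega
  · exact h

/-- If the median `v` is feasible, the rows with a middle entry at least `v` are cut on the right;
otherwise those with a middle entry at most `v` are cut on the left. By the two halves of the median
property, either set carries half of the weight. -/
theorem searchRound_halts (hE : CellEnv N k mode X σ) (hL : N.n + N.n < 2 ^ L)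
    (h60 : σ.nreg 60 = N.n) (hB : Bounds N k mode X (σ.narr 30) (σ.narr 31) lo (σ.rreg 60))
    (hF : Filled N mode X (σ.narr 30) (σ.narr 31) σ N.n)
    (hrem : 1 ≤ remaining N.n (σ.narr 30) (σ.narr 31)) :
    Halts searchRound σ (roundTime N.n L) fun σ' => ∃ lo', lo ≤ lo' ∧ σ'.rreg 60 ≤ σ.rreg 60 ∧
      Bounds N k mode X (σ'.narr 30) (σ'.narr 31) lo' (σ'.rreg 60) ∧
      Filled N mode X (σ'.narr 30) (σ'.narr 31) σ' N.n ∧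
      4 * remaining N.n (σ'.narr 30) (σ'.narr 31) ≤ 3 * remaining N.n (σ.narr 30) (σ.narr 31) := by
  unfold searchRound Halts roundTime
  obtain ⟨KS, hKS⟩ : ∃ K, K = L * (200 * N.n + 100) := ⟨_, rfl⟩
  obtain ⟨KT, hKT⟩ : ∃ K, K = testTime N.n L := ⟨_, rfl⟩
  have e1 : N.n * (2 * callTime L + 400) = N.n * (2 * callTime L + 200) + 200 * N.n := by ring
  obtain ⟨KF, hKF⟩ : ∃ K, K = N.n * (2 * callTime L + 200) := ⟨_, rfl⟩
  rw [e1, ← hKS, ← hKT, ← hKF]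
  obtain ⟨hkey, hval, hwt, htot⟩ := hF
  rw [wp_seq]
  refine (sort_halts h60 (by omega : N.n ≤ 2 ^ L)).wp (by omega) ?_
  rintro σ₁ T₁ hs₁ ⟨hsorted, hsum⟩ hT₁
  have hE₁ : CellEnv N k mode X σ₁ := hE.same hs₁ rfl rfl rfl
  have hone : remaining N.n (σ.narr 30) (σ.narr 31) =
      wsum (fun _ => 1) (σ.rarr 20) (σ.narr 20) 0 N.n := by
    rw [remaining, wsum, Finset.range_eq_Ico]
    refine Finset.sum_congr rfl fun r hr => ?_
    rw [hwt r (Finset.mem_Ico.1 hr).2, one_mul]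
  rw [wp_seq]
  refine (selectMedian_halts hsorted (by rw [hs₁.n 71 rfl, htot, hone, hsum])
    (by rwa [hs₁.n 71 rfl, htot])).wp (by omega) ?_
  rintro σ₂ T₂ hs₂ hmed hT₂
  have hE₂ : CellEnv N k mode X σ₂ := hE₁.same hs₂ rfl rfl rfl
  obtain ⟨v, hv⟩ : ∃ v, v = σ₂.rreg 50 := ⟨_, rfl⟩
  rw [← hv] at hmed
  obtain ⟨hm1, hm2, hm3⟩ := hmed
  rw [hsum, hsum] at hm1 hm2
  -- The median is the middle entry of some nonempty row, hence nonnegative. This follows from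
  -- `IsMedian.mem` for the indicator of the negative numbers.
  have hv0 : 0 ≤ v := by
    by_contra hneg
    have := hm3 (fun x => if x < 0 then 1 else 0) (by
      rw [hsum]
      refine Finset.sum_eq_zero fun r hr => ?_
      have hr := (Finset.mem_Ico.1 hr).2
      by_cases hlt : σ.narr 30 r < σ.narr 31 r
      · dsimp only
        rw [hkey r hr hlt, if_neg (not_lt.2 (cell_nonneg (hE.bounds r hr).1)), zero_mul]
      · rw [hwt r hr, Nat.sub_eq_zero_of_le (by omega), mul_zero])
    rw [if_pos (not_le.1 hneg)] at this
    exact one_ne_zero this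
  rw [wp_seq]
  refine (test_halts hE₂.env hL hv0 hv.symm).wp (by omega) ?_
  rintro σ₃ T₃ hs₃ htest hT₃
  have hE₃ : CellEnv N k mode X σ₃ := hE₂.same hs₃ rfl rfl rfl
  have r50 : σ₃.rreg 50 = v := by rw [hs₃.r 50 rfl, hv]
  have r60 : σ₃.rreg 60 = σ.rreg 60 := by rw [hs₃.r 60 rfl, hs₂.r 60 rfl, hs₁.r 60 rfl]
  have na30 : σ₃.narr 30 = σ.narr 30 := by rw [hs₃.na 30 rfl, hs₂.na 30 rfl, hs₁.na 30 rfl]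
  have na31 : σ₃.narr 31 = σ.narr 31 := by rw [hs₃.na 31 rfl, hs₂.na 31 rfl, hs₁.na 31 rfl]
  have ra30 : σ₃.rarr 30 = σ.rarr 30 := by rw [hs₃.ra 30 rfl, hs₂.ra 30 rfl, hs₁.ra 30 rfl]
  rw [wp_seq]
  have hcut : Halts (.ite (.nle 1 (.reg 55))
      (.ite (.rle (.reg 50) (.reg 60)) (.rset 60 (.reg 50)) .skip ;; lowerRows) raiseRows) σ₃
      (60 * N.n + 60) fun σ' => ∃ lo', lo ≤ lo' ∧ σ'.rreg 60 ≤ σ.rreg 60 ∧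
        Bounds N k mode X (σ'.narr 30) (σ'.narr 31) lo' (σ'.rreg 60) ∧
        4 * remaining N.n (σ'.narr 30) (σ'.narr 31) ≤
          3 * remaining N.n (σ.narr 30) (σ.narr 31) := by
    unfold Halts
    rw [wp_ite]
    refine ⟨by simp, fun h => ?_, fun h => ?_⟩
    · have hf := htest.feasK h
      have hmin : Halts (.ite (.rle (.reg 50) (.reg 60)) (.rset 60 (.reg 50)) .skip) σ₃ 20
          fun σ' => σ'.rreg 60 = min (σ.rreg 60) v := by
        unfold Halts
        rw [wp_ite]
        refine ⟨by simp, fun h => ?_, fun h => ?_⟩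
        · simp only [BExp.eval_rle, RExp.eval_reg, r50, r60] at h
          rw [wp_rset]
          exact ⟨by simp, by simp [r50, min_eq_right h]⟩
        · simp only [BExp.eval_rle, RExp.eval_reg, r50, r60, not_le] at h
          rw [wp_skip]
          refine ⟨by simp, ?_⟩
          dsimp only
          rw [r60, min_eq_left h.le]
      rw [wp_seq]
      refine hmin.wp (by simp) ?_
      intro σ₄ T₄ hs₄ h60' hT₄
      simp at hT₄
      refine (lowerRows_halts (n := N.n) (LO := σ.narr 30) (HI := σ.narr 31) (val := σ.rarr 30)
        (v := v) (by rw [hs₄.n 0 rfl, hE₃.env.n0]) (by rw [hs₄.na 30 rfl, na30])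
        (by rw [hs₄.na 31 rfl, na31]) (by rw [hs₄.ra 30 rfl, ra30])
        (by rw [hs₄.r 50 rfl, r50])).wp (by omega) ?_
      intro σ₅ T₅ hs₅ hHI hT₅
      have hHI' : ∀ r < N.n, σ₅.narr 31 r = if σ.narr 30 r < σ.narr 31 r ∧
          v ≤ cell N mode X r (midCol (σ.narr 30) (σ.narr 31) r) then
          midCol (σ.narr 30) (σ.narr 31) r else σ.narr 31 r := fun r hr => by
        rw [hHI r hr]
        by_cases hlt : σ.narr 30 r < σ.narr 31 r
        · simp only [hlt, true_and, hval r hr hlt]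
        · simp only [hlt, false_and]
      have e30 : σ₅.narr 30 = σ.narr 30 := by rw [hs₅.na 30 rfl, hs₄.na 30 rfl, na30]
      have e60 : σ₅.rreg 60 = min (σ.rreg 60) v := by rw [hs₅.r 60 rfl, h60']
      refine ⟨lo, le_rfl, by rw [e60]; exact min_le_left _ _, ?_, ?_⟩
      · rw [e30, e60]
        exact hB.lower hf hHI'
      · rw [e30]
        refine remaining_decrease hwt hm2 fun r hr => ?_
        rw [hHI' r hr, hwt r hr]
        by_cases hlt : σ.narr 30 r < σ.narr 31 r
        · rw [hkey r hr hlt]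
          by_cases hle : v ≤ cell N mode X r (midCol (σ.narr 30) (σ.narr 31) r)
          · rw [if_pos ⟨hlt, hle⟩, if_pos hle, midCol]
            omega
          · rw [if_neg fun h => hle h.2, if_neg hle]
            omega
        · simp only [hlt, false_and, if_false]
          rw [Nat.sub_eq_zero_of_le (by omega)]
          omega
    · have hf := htest.not_feasK h
      refine (raiseRows_halts (n := N.n) (LO := σ.narr 30) (HI := σ.narr 31) (val := σ.rarr 30)
        (v := v) hE₃.env.n0 na30 na31 ra30 r50).wp (by simp) ?_
      intro σ₅ T₅ hs₅ hLO hT₅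
      have hLO' : ∀ r < N.n, σ₅.narr 30 r = if σ.narr 30 r < σ.narr 31 r ∧
          cell N mode X r (midCol (σ.narr 30) (σ.narr 31) r) ≤ v then
          midCol (σ.narr 30) (σ.narr 31) r + 1 else σ.narr 30 r := fun r hr => by
        rw [hLO r hr]
        by_cases hlt : σ.narr 30 r < σ.narr 31 r
        · simp only [hlt, true_and, hval r hr hlt]
        · simp only [hlt, false_and]
      have e31 : σ₅.narr 31 = σ.narr 31 := by rw [hs₅.na 31 rfl, na31]
      have e60 : σ₅.rreg 60 = σ.rreg 60 := by rw [hs₅.r 60 rfl, r60]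
      refine ⟨max lo v, le_max_left _ _, e60.le, ?_, ?_⟩
      · rw [e31, e60]
        exact hB.raise hf hLO'
      · rw [e31]
        refine remaining_decrease hwt hm1 fun r hr => ?_
        rw [hLO' r hr, hwt r hr]
        by_cases hlt : σ.narr 30 r < σ.narr 31 r
        · rw [hkey r hr hlt]
          by_cases hle : cell N mode X r (midCol (σ.narr 30) (σ.narr 31) r) ≤ v
          · rw [if_pos ⟨hlt, hle⟩, if_pos hle, midCol]
            omega
          · rw [if_neg fun h => hle h.2, if_neg hle]
            omega
        · simp only [hlt, false_and, if_false]
          rw [Nat.sub_eq_zero_of_le (by omega)]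
          omega
  refine hcut.wp (by omega) ?_
  rintro σ₄ T₄ hs₄ ⟨lo', hlo, hhi, hB', hdec⟩ hT₄
  have hE₄ : CellEnv N k mode X σ₄ := hE₃.same hs₄ rfl rfl rfl
  refine (fill_halts hE₄ hL rfl rfl (fun r hr => (hB'.left r hr).le) hB'.right).wp (by omega) ?_
  intro σ₅ T₅ hs₅ hF hT₅
  have e30 : σ₅.narr 30 = σ₄.narr 30 := by rw [hs₅.na 30 rfl]
  have e31 : σ₅.narr 31 = σ₄.narr 31 := by rw [hs₅.na 31 rfl]
  have e60 : σ₅.rreg 60 = σ₄.rreg 60 := by rw [hs₅.r 60 rfl]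
  dsimp only
  rw [e30, e31, e60]
  exact ⟨lo', hlo, hhi, hB', hF, hdec⟩

/-- The number of steps of a search. -/
def searchTime (n L : ℕ) : ℕ := (6 * L + 1) * (roundTime n L + 10)

/-- When no entry remains, every entry of every row is at most the final lower bound or at least the
final upper bound. -/
theorem search_halts (hE : CellEnv N k mode X σ) (hL : N.n + N.n < 2 ^ L)
    (hB : Bounds N k mode X (σ.narr 30) (σ.narr 31) lo (σ.rreg 60)) :
    Halts search σ (searchTime N.n L) fun σ' => ∃ lo', lo ≤ lo' ∧ σ'.rreg 60 ≤ σ.rreg 60 ∧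
      Bounds N k mode X (σ'.narr 30) (σ'.narr 31) lo' (σ'.rreg 60) ∧
      ∀ r < N.n, σ'.narr 30 r = σ'.narr 31 r := by
  unfold search Halts searchTime
  obtain ⟨K, hK⟩ : ∃ K, K = roundTime N.n L + 10 := ⟨_, rfl⟩
  have hK' : N.n * (2 * callTime L + 200) + 300 ≤ K := by
    have : N.n * (2 * callTime L + 200) ≤ N.n * (2 * callTime L + 400) :=
      Nat.mul_le_mul_left _ (by omega)
    rw [hK, roundTime]
    omega
  rw [← hK, add_mul, one_mul]
  obtain ⟨KF, hKF⟩ : ∃ K, K = N.n * (2 * callTime L + 200) := ⟨_, rfl⟩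
  rw [← hKF] at hK'
  rw [wp_seq, wp_nset]
  refine ⟨by simp; omega, ?_⟩
  have hE₀ := hE.same (Run.same (.nset 60 (.reg 0) _)) rfl rfl rfl
  rw [wp_seq]
  refine (fill_halts hE₀ hL rfl rfl (fun r hr => (hB.left r hr).le) hB.right).wp
    (by simp; omega) ?_
  intro σ₁ T₁ hs₁ hF hT₁
  have hE₁ : CellEnv N k mode X σ₁ := hE₀.same hs₁ rfl rfl rfl
  have e30 : σ₁.narr 30 = σ.narr 30 := by rw [hs₁.na 30 rfl]
  have e31 : σ₁.narr 31 = σ.narr 31 := by rw [hs₁.na 31 rfl]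
  have e60 : σ₁.rreg 60 = σ.rreg 60 := by rw [hs₁.r 60 rfl]
  have n60 : σ₁.nreg 60 = N.n := by rw [hs₁.n 60 rfl]; simp [hE.env.n0]
  simp at hT₁
  refine WP.loop (fun σ' T' => ∃ e lo', CellEnv N k mode X σ' ∧ σ'.nreg 60 = N.n ∧ lo ≤ lo' ∧
    σ'.rreg 60 ≤ σ.rreg 60 ∧ Bounds N k mode X (σ'.narr 30) (σ'.narr 31) lo' (σ'.rreg 60) ∧
    Filled N mode X (σ'.narr 30) (σ'.narr 31) σ' N.n ∧
    remaining N.n (σ'.narr 30) (σ'.narr 31) ^ 3 < 2 ^ e ∧ e * K + 10 ≤ T') ?_ ?_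
  -- Initially there are at most `n * n < 2 ^ (2 * L)` entries, and the exponent bounds the cube of
  -- their number.
  · refine ⟨6 * L, lo, hE₁, n60, le_rfl, e60.le, by rwa [e30, e31, e60], by rw [e30, e31]; exact hF,
      ?_, by omega⟩
    have h1 : remaining N.n (σ₁.narr 30) (σ₁.narr 31) ≤ N.n * N.n := by
      rw [remaining]
      refine (Finset.sum_le_card_nsmul _ _ N.n fun r hr => ?_).trans (by simp)
      have := hB.right r (Finset.mem_range.1 hr)
      rw [e31]
      omega
    have h2 : N.n * N.n < 2 ^ L * 2 ^ L := Nat.mul_self_lt_mul_self (by omega)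
    calc _ < (2 ^ L * 2 ^ L) ^ 3 := Nat.pow_lt_pow_left (h1.trans_lt h2) (by norm_num)
      _ = 2 ^ (6 * L) := by ring
  · clear hE hB hE₀ hs₁ hF hE₁ e30 e31 e60 n60 hT₁
    rintro σ₁ T₁ ⟨e, lo', hE, n60, hlo, hhi, hB, hF, he, hT₁⟩
    refine ⟨by simp; omega, fun hc => ?_, fun hc => ?_⟩
    · simp only [BExp.eval_nle, NExp.eval_one, NExp.eval_reg, hF.total] at hc
      have he1 := (cube_decrease (a := 0) (by omega) hc he).1
      have hmul : e * K = (e - 1) * K + K := by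
        rw [← Nat.succ_mul, Nat.succ_eq_add_one, Nat.sub_add_cancel he1]
      refine (searchRound_halts hE hL n60 hB hF hc).wp (by simp; omega) ?_
      rintro σ₂ T₂ hs ⟨lo'', h1, h2, h3, h4, h5⟩ hT₂
      simp at hT₂
      exact ⟨e - 1, lo'', hE.same hs rfl rfl rfl, by rw [hs.n 60 rfl, n60], hlo.trans h1,
        h2.trans hhi, h3, h4, (cube_decrease h5 hc he).2, by omega⟩
    · simp only [BExp.eval_nle, NExp.eval_one, NExp.eval_reg, hF.total, not_le,
        Nat.lt_one_iff] at hc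
      refine ⟨lo', hlo, hhi, hB, fun r hr => ?_⟩
      rw [remaining, Finset.sum_eq_zero_iff] at hc
      have h1 := hc r (Finset.mem_range.2 hr)
      have h2 := hB.le r hr
      omega

end RealRAM

/-- A single sink at the last vertex supplies the first feasible time for the search. -/
theorem DynamicPath.feasK_cost (N : DynamicPath) {k : ℕ} (hk : 1 ≤ k) :
    N.FeasK k (N.profile.cost 0 (N.n - 1)) := by
  have hn := N.n_pos
  refine FeasK.mono_sinks (k := 1) (feasK_iff.2 ⟨fun j => if j = 0 then 0 else N.n, ?_, by simp,
    by simp, fun j hj _ => ?_⟩) hk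
  · intro i j hij
    dsimp only
    split_ifs <;> omega
  · obtain rfl : j = 0 := by omega
    refine ⟨⟨N.n - 1, 0⟩, ?_⟩
    simp only [reduceIte, zero_add, one_ne_zero]
    rw [canEvacuate_iff (by omega) Profile.cost_nonneg]
    refine ⟨⟨Nat.zero_le _, le_rfl, zero_lt_one, by simp⟩, fun _ => le_rfl,
      fun h => absurd h (lt_irrefl _), ?_⟩
    rw [costR_of_le le_rfl, mul_zero, add_zero]
    exact Profile.cost_nonneg

namespace RealRAM

/-! ## The algorithm -/

/-- Start the search among the times for reaching a vertex from the left. -/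
def startLeft : Cmd :=
  .nset 70 0 ;;
  .loop (.nlt (.reg 70) (.reg 0))
    (.nstore 30 (.reg 70) (.reg 70 + 1) ;; .nstore 31 (.reg 70) (.reg 0) ;;
     .nset 70 (.reg 70 + 1))

/-- Start the search among the times for sinks on the edges that are found by the first search. -/
def startRight : Cmd :=
  .nset 70 0 ;;
  .loop (.nlt (.reg 70) (.reg 0))
    (.nstore 32 (.reg 70) (.arr 30 (.reg 70) - 1) ;; .nstore 31 (.reg 70) (.reg 0) ;;
     .nset 70 (.reg 70 + 1))

theorem startLeft_halts {σ : Mem} {n : ℕ} (h0 : σ.nreg 0 = n) :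
    Halts startLeft σ (40 * n + 20) fun σ' =>
      ∀ r < n, σ'.narr 30 r = r + 1 ∧ σ'.narr 31 r = n := by
  unfold startLeft Halts
  rw [wp_seq, wp_nset]
  refine ⟨by simp, ?_⟩
  refine WP.loop_same (fun σ' T' => ∃ r, σ'.nreg 70 = r ∧ r ≤ n ∧
    (∀ q < r, σ'.narr 30 q = q + 1 ∧ σ'.narr 31 q = n) ∧ 40 * (n - r) + 10 ≤ T') ?_ ?_
  · refine ⟨0, by simp, Nat.zero_le _, fun _ h => absurd h (Nat.not_lt_zero _), ?_⟩
    simp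
  · rintro σ₁ T₁ hs ⟨r, n70, hrn, hlow, hT₁⟩
    have e0 : σ₁.nreg 0 = n := by rw [hs.n 0 rfl]; simpa
    refine ⟨by simp; omega, fun hc => ?_, fun hc => ?_⟩
    · simp only [BExp.eval_nlt, NExp.eval_reg, n70, e0] at hc
      simp only [wp_seq, wp_nstore, wp_nset]
      refine ⟨by simp; omega, by simp; omega, by simp; omega, r + 1, by simp [n70], hc,
        fun q hq => ?_, ?_⟩
      · rcases eq_or_ne q r with rfl | hne
        · simp [n70, e0]
        · simpa [n70, Function.update_of_ne hne] using hlow q (by omega)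
      · simp
        omega
    · simp only [BExp.eval_nlt, NExp.eval_reg, n70, e0] at hc
      exact fun q hq => hlow q (by omega)

theorem startRight_halts {σ : Mem} {n : ℕ} (h0 : σ.nreg 0 = n) :
    Halts startRight σ (40 * n + 20) fun σ' =>
      ∀ r < n, σ'.narr 32 r = σ.narr 30 r - 1 ∧ σ'.narr 31 r = n := by
  unfold startRight Halts
  rw [wp_seq, wp_nset]
  refine ⟨by simp, ?_⟩
  refine WP.loop_same (fun σ' T' => ∃ r, σ'.nreg 70 = r ∧ r ≤ n ∧
    (∀ q < r, σ'.narr 32 q = σ.narr 30 q - 1 ∧ σ'.narr 31 q = n) ∧ 40 * (n - r) + 10 ≤ T') ?_ ?_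
  · refine ⟨0, by simp, Nat.zero_le _, fun _ h => absurd h (Nat.not_lt_zero _), ?_⟩
    simp
  · rintro σ₁ T₁ hs ⟨r, n70, hrn, hlow, hT₁⟩
    have e0 : σ₁.nreg 0 = n := by rw [hs.n 0 rfl]; simpa
    have e30 : σ₁.narr 30 = σ.narr 30 := by rw [hs.na 30 rfl]; simp
    refine ⟨by simp; omega, fun hc => ?_, fun hc => ?_⟩
    · simp only [BExp.eval_nlt, NExp.eval_reg, n70, e0] at hc
      simp only [wp_seq, wp_nstore, wp_nset]
      refine ⟨by simp; omega, by simp; omega, by simp; omega, r + 1, by simp [n70], hc,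
        fun q hq => ?_, ?_⟩
      · rcases eq_or_ne q r with rfl | hne
        · simp [n70, e0, e30]
        · simpa [n70, Function.update_of_ne hne] using hlow q (by omega)
      · simp
        omega
    · simp only [BExp.eval_nlt, NExp.eval_reg, n70, e0] at hc
      exact fun q hq => hlow q (by omega)

/-- Find an optimal `k`-sink, given that the time `0` is not feasible. -/
def optimize : Cmd :=
  .nset 5 0 ;; callCost 0 (.reg 0 - 1) ;; .rset 60 (.reg 20) ;; startLeft ;; search ;;
  .nset 5 1 ;; startRight ;; search ;; .rset 50 (.reg 60) ;; test

/-- The program for the optimal `k`-sink. -/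
def kSink : Cmd :=
  setup ;; buildTree ;; .rset 50 0 ;; test ;; .ite (.nle 1 (.reg 55)) .skip optimize

/-- The number of steps of `optimize`. -/
def optimizeTime (n L : ℕ) : ℕ :=
  callTime L + 80 * n + 2 * searchTime n L + testTime n L + 100

variable {N : DynamicPath} {k L : ℕ} {σ : Mem}

/-- The first search fixes, for every `a`, the last vertex `X a` reachable at all times from `lo` up
to, but not including, `hi`. Only then are the critical times on the edges determined by `a` and
`b`, and the second search settles them. The final test at the optimal time writes the sinks. -/
theorem optimize_halts (hE : Env N k σ) (hL : N.n + N.n < 2 ^ L) (hk : 1 ≤ k)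
    (h0 : ¬ N.FeasK k 0) :
    Halts optimize σ (optimizeTime N.n L) fun σ' => N.OptimalSinks k (output σ' (min k N.n)) := by
  have hn := N.n_pos
  unfold optimize Halts optimizeTime
  rw [wp_seq, wp_nset]
  refine ⟨by simp, ?_⟩
  rw [wp_seq]
  refine callCost_wp (hE.setN (by omega)) hL (a := 0) (x := N.n - 1) (by simp) (by simp [hE.n0])
    (by simp) (Nat.zero_le _) (by omega) (by simp; omega) fun σ₁ T₁ hs₁ hE₁ hp hT₁ => ?_
  simp at hT₁
  rw [wp_seq, wp_rset]
  refine ⟨by simp; omega, ?_⟩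
  rw [wp_seq]
  refine (startLeft_halts (n := N.n) (by simpa using hE₁.n0)).wp (by simp; omega) ?_
  intro σ₂ T₂ hs₂ hinit hT₂
  simp at hT₂
  have hE₂ : CellEnv N k 0 id σ₂ := by
    refine ⟨hE₁.setR.same hs₂ rfl, ?_, fun h => absurd rfl h, fun r hr => ⟨le_rfl, hr⟩⟩
    rw [hs₂.n 5 rfl, Mem.setR_nreg, hs₁.n 5 rfl]
    simp
  have r60 : σ₂.rreg 60 = N.profile.cost 0 (N.n - 1) := by
    rw [hs₂.r 60 rfl]
    simpa using hp
  rw [wp_seq]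
  refine (search_halts (lo := 0) hE₂ hL ⟨le_rfl, h0, by rw [r60]; exact N.feasK_cost hk,
    fun r hr => ?_, fun r hr => ?_, fun r hr => ?_, fun r hr c h1 h2 => ?_,
    fun r hr c h1 h2 => ?_⟩).wp (by omega) ?_
  · rw [(hinit r hr).1]; exact Nat.lt_succ_self r
  · rw [(hinit r hr).1, (hinit r hr).2]; exact hr
  · rw [(hinit r hr).2]
  · rw [(hinit r hr).1] at h2
    simp only [id] at h1
    omega
  · rw [(hinit r hr).2] at h1
    omega
  rintro σ₃ T₃ hs₃ ⟨lo₁, hlo₁, hhi₁, hB₁, heq₁⟩ hT₃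
  have hE₃ : CellEnv N k 0 id σ₃ := hE₂.same hs₃ rfl rfl rfl
  rw [wp_seq, wp_nset]
  refine ⟨by simp; omega, ?_⟩
  rw [wp_seq]
  refine (startRight_halts (n := N.n) (by simpa using hE₃.env.n0)).wp (by simp; omega) ?_
  intro σ₄ T₄ hs₄ hinit₄ hT₄
  simp at hT₄
  -- The first column that is not below the lower bound is one past the last reachable vertex.
  obtain ⟨X, hX⟩ : ∃ X : ℕ → ℕ, X = fun r => σ₃.narr 30 r - 1 := ⟨_, rfl⟩
  have hX1 : ∀ r < N.n, X r + 1 = σ₃.narr 30 r ∧ r ≤ X r ∧ X r < N.n := fun r hr => by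
    have h1 := hB₁.left r hr
    have h2 := hB₁.le r hr
    have h3 := hB₁.right r hr
    simp only [id] at h1
    simp only [hX]
    omega
  have hE₄ : CellEnv N k 1 X σ₄ := by
    refine ⟨(hE₃.env.setN (by omega)).same hs₄ rfl, ?_, fun _ r hr => ?_, fun r hr => (hX1 r hr).2⟩
    · rw [hs₄.n 5 rfl]; simp
    · rw [(hinit₄ r hr).1, hX]; simp
  -- The left ends need no reset: the first search leaves `X r + 1` there, which is where the second
  -- one starts.
  have e30 : σ₄.narr 30 = σ₃.narr 30 := by rw [hs₄.na 30 rfl]; simp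
  have r60' : σ₄.rreg 60 = σ₃.rreg 60 := by rw [hs₄.r 60 rfl]; simp
  rw [wp_seq]
  refine (search_halts (lo := lo₁) hE₄ hL ⟨hB₁.lo_nonneg, hB₁.not_feasK,
    by rw [r60']; exact hB₁.feasK, fun r hr => ?_, fun r hr => ?_, fun r hr => ?_,
    fun r hr c h1 h2 => ?_, fun r hr c h1 h2 => ?_⟩).wp (by omega) ?_
  · rw [e30]; have := (hX1 r hr).1; omega
  · rw [e30, (hinit₄ r hr).2]; have := hX1 r hr; omega
  · rw [(hinit₄ r hr).2]
  · rw [e30] at h2; have := hX1 r hr; omega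
  · rw [(hinit₄ r hr).2] at h1
    omega
  rintro σ₅ T₅ hs₅ ⟨lo₂, hlo₂, hhi₂, hB₂, heq₂⟩ hT₅
  have hE₅ : CellEnv N k 1 X σ₅ := hE₄.same hs₅ rfl rfl rfl
  rw [wp_seq, wp_rset]
  refine ⟨by simp; omega, ?_⟩
  refine (test_halts hE₅.env.setR hL hB₂.feasK.nonneg (by simp)).wp (by simp; omega) ?_
  intro σ₆ T₆ hs₆ htest hT₆
  rcases htest with ⟨-, hF⟩ | ⟨-, hF⟩
  swap
  · exact absurd hB₂.feasK hF
  refine ⟨_, hF, fun s' t' hs' => ?_⟩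
  by_contra hlt
  -- The second search only shrinks the interval between `lo` and `hi`, so what the first one has
  -- settled remains valid.
  refine DynamicPath.not_feasK_of_resolved (X := X) hB₂.lo_nonneg hB₂.not_feasK
    (fun a ha => (hX1 a ha).2) (fun a ha => ?_) (fun a ha hXa => ?_) (fun a ha b hb hbn => ?_)
    (not_le.1 hlt) ⟨s', hs'⟩
  · rcases eq_or_lt_of_le (hX1 a ha).2.1 with h | h
    · rw [← h, Profile.cost_of_le le_rfl]; exact hB₂.lo_nonneg
    · have := hB₁.low a ha (X a) h (by have := (hX1 a ha).1; omega)
      rw [cell, if_pos rfl] at this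
      exact this.trans hlo₂
  · have := hB₁.high a ha (X a + 1) (by rw [(hX1 a ha).1, heq₁ a ha]) hXa
    rw [cell, if_pos rfl] at this
    exact (hhi₂.trans r60'.le).trans this
  · rcases lt_or_ge b (σ₅.narr 30 a) with h | h
    · have := hB₂.low a ha b hb h
      rw [cell, if_neg one_ne_zero] at this
      exact Or.inl this
    · have := hB₂.high a ha b (by rwa [← heq₂ a ha]) hbn
      rw [cell, if_neg one_ne_zero] at this
      exact Or.inr this

/-- The number of steps of `kSink`. -/
def kSinkTime (n L : ℕ) : ℕ :=
  200 * n + L * (900 * (n + n) + 100) + testTime n L + optimizeTime n L + 200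

theorem kSink_halts (N : DynamicPath) {k L : ℕ} (hk : 1 ≤ k) (hL : N.n + N.n < 2 ^ L) :
    Halts kSink (input N k) (kSinkTime N.n L) fun σ' =>
      N.OptimalSinks k (output σ' (min k N.n)) := by
  unfold kSink Halts kSinkTime
  obtain ⟨KB, hKB⟩ : ∃ K, K = L * (900 * (N.n + N.n) + 100) := ⟨_, rfl⟩
  rw [← hKB, wp_seq]
  refine (setup_halts N k).wp (by omega) ?_
  rintro σ₁ T₁ hs₁ ⟨n2, n3, n4, hW, hD, hγ⟩ hT₁
  rw [wp_seq]
  refine (buildTree_halts n3 n4 (by omega) hL hW hD hγ).wp (by omega) ?_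
  intro σ₂ T₂ hs₂ htree hT₂
  have hE : Env N k σ₂ :=
    ⟨by rw [hs₂.n 0 rfl, hs₁.n 0 rfl]; rfl, by rw [hs₂.n 2 rfl, n2], by rw [hs₂.n 3 rfl, n3],
      by rw [hs₂.n 4 rfl, n4], htree⟩
  rw [wp_seq, wp_rset]
  refine ⟨by simp; omega, ?_⟩
  rw [wp_seq]
  refine (test_halts (t := 0) hE.setR hL le_rfl (by simp)).wp (by simp; omega) ?_
  intro σ₃ T₃ hs₃ htest hT₃
  simp at hT₃
  have hE₃ : Env N k σ₃ := hE.setR.same hs₃ rfl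
  rw [wp_ite]
  refine ⟨by simp; omega, fun h => ?_, fun h => ?_⟩
  · rw [wp_skip]
    refine ⟨by simp; omega, ?_⟩
    rcases htest with ⟨-, hF⟩ | ⟨h', -⟩
    -- The time `0` is tested separately, as the search needs an infeasible nonnegative lower bound.
    -- If it is feasible it is optimal, since feasible times are nonnegative.
    · exact ⟨0, hF, fun s' t' hs' => DynamicPath.FeasK.nonneg ⟨s', hs'⟩⟩
    · simp [h'] at h
  · exact (optimize_halts hE₃ hL hk (htest.not_feasK h)).wp (by simp; omega) fun _ _ _ h _ => h

/-- The two searches dominate, with `O(L)` rounds of `O(n * L ^ 2)` steps each; all other parts are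
absorbed using `1 ≤ n` and `1 ≤ L`. -/
theorem kSinkTime_le {n L : ℕ} (hn : 1 ≤ n) (hL : 1 ≤ L) :
    kSinkTime n L ≤ 300000 * (n * L ^ 3) := by
  have h1 : L ≤ L ^ 2 := Nat.le_self_pow (by norm_num) L
  have h2 : 1 * L ^ 2 ≤ L * L ^ 2 := Nat.mul_le_mul_right _ hL
  have h3 : L * L ^ 2 = L ^ 3 := by ring
  have hc : callTime L ≤ 950 * L ^ 2 := by
    have : callTime L = 200 * L ^ 2 + 600 * L + 150 := by rw [callTime]; ring
    omega
  have hnL : 1 * L ^ 2 ≤ n * L ^ 2 := Nat.mul_le_mul_right _ hn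
  have hnL' : n * 1 ≤ n * L ^ 2 := Nat.mul_le_mul_left _ (hL.trans h1)
  have ht : testTime n L ≤ 9200 * (n * L ^ 2) := by
    calc testTime n L ≤ 8 * n * (1150 * L ^ 2) := Nat.mul_le_mul (by omega) (by omega)
      _ = 9200 * (n * L ^ 2) := by ring
  have hr : roundTime n L ≤ 12100 * (n * L ^ 2) := by
    have h4 : L * (200 * n + 100) ≤ L ^ 2 * (300 * n) := Nat.mul_le_mul h1 (by omega)
    have h5 : n * (2 * callTime L + 400) ≤ n * (2300 * L ^ 2) := Nat.mul_le_mul_left _ (by omega)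
    have h6 : L ^ 2 * (300 * n) = 300 * (n * L ^ 2) := by ring
    have h7 : n * (2300 * L ^ 2) = 2300 * (n * L ^ 2) := by ring
    rw [roundTime]
    omega
  have hs : searchTime n L ≤ 84770 * (n * L ^ 3) := by
    calc searchTime n L ≤ 7 * L * (12110 * (n * L ^ 2)) := Nat.mul_le_mul (by omega) (by omega)
      _ = 84770 * (n * L ^ 3) := by ring
  have hnL3 : n * L ^ 2 ≤ n * L ^ 3 := Nat.mul_le_mul_left _ (by omega)
  have h4 : L * (900 * (n + n) + 100) ≤ L ^ 2 * (1900 * n) := Nat.mul_le_mul h1 (by omega)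
  have h5 : L ^ 2 * (1900 * n) = 1900 * (n * L ^ 2) := by ring
  rw [kSinkTime, optimizeTime]
  omega

/-- Both `log 2` and `Nat.log 2 n * log 2` are at most `log (n + 1)`, so the factor `3 / log 2 < 5`
suffices. The argument `n + 1` keeps the right side positive for `n = 1`. -/
theorem log_bound {n : ℕ} (hn : 1 ≤ n) : ((Nat.log 2 n + 2 : ℕ) : ℝ) ≤ 5 * Real.log (n + 1) := by
  have h2 := Real.log_two_gt_d9
  have h3 : Real.log 2 ≤ Real.log (n + 1) :=
    Real.log_le_log two_pos (by have : (1 : ℝ) ≤ n := by exact_mod_cast hn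
                                linarith)
  have h4 : (Nat.log 2 n : ℝ) * Real.log 2 ≤ Real.log (n + 1) := by
    rw [← Real.log_pow]
    refine Real.log_le_log (by positivity) ?_
    have := Nat.pow_log_le_self 2 (by omega : n ≠ 0)
    exact_mod_cast this.trans (Nat.le_succ n)
  push_cast
  nlinarith [(Nat.cast_nonneg (Nat.log 2 n) : (0 : ℝ) ≤ _)]

end RealRAM

theorem mainTheorem2 :
    ∃ (prog : RealRAM.Cmd) (C : ℝ), ∀ (N : DynamicPath) (k : ℕ), 1 ≤ k →
      ∃ (T : ℕ) (σ : RealRAM.Mem), RealRAM.Run prog (RealRAM.input N k) T σ ∧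
        (T : ℝ) ≤ C * (N.n * Real.log (N.n + 1) ^ 3) ∧
        N.OptimalSinks k (RealRAM.output σ (min k N.n)) := by
  refine ⟨RealRAM.kSink, 300000 * 5 ^ 3, fun N k hk => ?_⟩
  have hn := N.n_pos
  -- One is added for the strict bound on `n` and one for the doubling of the path.
  obtain ⟨L, hL⟩ : ∃ L, L = Nat.log 2 N.n + 2 := ⟨_, rfl⟩
  have hlt : N.n + N.n < 2 ^ L := by
    have := Nat.lt_pow_succ_log_self (b := 2) one_lt_two N.n
    rw [hL, pow_succ]
    simp only [Nat.succ_eq_add_one] at this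
    omega
  obtain ⟨T, σ, hr, hT, hopt⟩ := RealRAM.kSink_halts N hk hlt
  refine ⟨T, σ, hr, ?_, hopt⟩
  have h1 : (T : ℝ) ≤ 300000 * (N.n * (L : ℝ) ^ 3) := by
    exact_mod_cast hT.trans (RealRAM.kSinkTime_le hn (by omega))
  have h2 : (L : ℝ) ≤ 5 * Real.log (N.n + 1) := hL ▸ RealRAM.log_bound hn
  calc (T : ℝ) ≤ 300000 * (N.n * (L : ℝ) ^ 3) := h1
    _ ≤ 300000 * (N.n * (5 * Real.log (N.n + 1)) ^ 3) := by gcongr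
    _ = 300000 * 5 ^ 3 * (N.n * Real.log (N.n + 1) ^ 3) := by ring
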